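/- Let $L,s\ge 0$ be integers with $d:=2L+s\ge 2$, and put $\alpha:=\frac{2}{d-1}$. Let $\vartheta=(\vartheta_1,\dots,\vartheta_L)\in\mathbb R^L$, let $R_p:=\operatorname{diag}\bigl(r(p\vartheta_1),\dots,r(p\vartheta_L),1,\dots,1\bigr)$ ($s$ ones) for $p\in\mathbb Z$, where $r(\phi)=\begin{pmatrix}\cos\phi&-\sin\phi\\ \sin\phi&\cos\phi\end{pmatrix}$, fix $q\in\mathbb S^{d-1}$, and put $u_i:=R_i^{\top}q$ for $i\in\mathbb Z$. Let $\mathcal O_q:=\overline{\{u_i:i\in\mathbb Z\}}\subset\mathbb S^{d-1}$. With $\mathbb T=\mathbb R/\mathbb Z$ and $\theta:=\bigl(\frac{\vartheta_1}{2\pi},\dots,\frac{\vartheta_L}{2\pi}\bigr)\in\mathbb T^L$, let $\mathcal H_q:=\overline{\{i\theta \bmod 1:i\in\mathbb Z\}}\subset\mathbb T^L$, a closed subgroup with Haar probability measure $m_{\mathcal H_q}$, let $\Phi_q(x):=\operatorname{diag}\bigl(r(-2\pi x_1),\dots,r(-2\pi x_L),1,\dots,1\bigr)q$, and let $\pi_q:=(\Phi_q)_{\#}m_{\mathcal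 H_q}$. Let $(x_i)_{i\in\mathbb Z}$ be a stationary sequence of random variables with values in $\mathbb S^{d-1}$ such that, for some integer $m\ge 0$: (i) $(x_i)$ is $m$-dependent: for all $I,J\subset\mathbb Z$ with $|i-j|>m$ for every $i\in I$, $j\in J$, the families $(x_i)_{i\in I}$ and $(x_j)_{j\in J}$ are independent; (ii) the common law of the $x_i$ has a density $\rho$ with respect to surface measure on $\mathbb S^{d-1}$, and $\rho$ is continuous and strictly positive on a neighborhood of $\mathcal O_q$; (iii) for each $1\le\ell\le m$, the pair $(x_0,x_\ell)$ has a density with respect to product surface measure that is bounded on a neighborhood of $\mathcal O_q\times\mathcal O_q$. Let $U_i:=1-\langle u_i,x_i\rangle$. For real numbers $\beta_n$ and $1\le i\le n$ let $A_i:=e^{-\beta_nU_i}\big/\sum_{j=1}^n e^{-\beta_nU_j}$, and let $A_{(1)}\ge\dots\ge A_{(n)}$ be their decreasing rearrangement (with $A_{(i)}:=0$ for $i>n$). Let $$\overline C(q):=\frac{2^{1/\alpha}\sigma_{d-2}}{d-1}\int_{\mathbb S^{d-1}}\rho(u)\,\pi_q(du),$$ where $\sigma_{d-2}$ is the surface area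 of the unit sphere $\mathbb S^{d-2}\subset\mathbb R^{d-1}$. Assume that $\beta_nn^{-\alpha}\to\gamma\in(0,\infty)$ as $n\to\infty$, and let $\mathcal X$ be a Poisson point process on $\mathbb R_+=[0,\infty)$ with intensity measure $\overline\Lambda([0,y])=\overline C(q)(y/\gamma)^{1/\alpha}$, $y\ge 0$. Then, almost surely, the atoms of $\mathcal X$ are all simple and can be arranged in an infinite increasing sequence $0<Y_1<Y_2<\cdots$ with $\mathcal X=\sum_{j\ge1}\delta_{Y_j}$ and $\sum_{j\ge 1}e^{-Y_j}<\infty$, and for every fixed $k\ge 1$, $$\bigl(A_{(1)},\dots,A_{(k)}\bigr)\longrightarrow\bigl(W_1,\dots,W_k\bigr)\quad\text{in distribution as } n\to\infty,\qquad W_i:=\frac{e^{-Y_i}}{\sum_{j\ge1}e^{-Y_j}}.$$ -/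

import Mathlib

open MeasureTheory ProbabilityTheory Filter Topology
open scoped NNReal ENNReal Matrix

noncomputable section

namespace RopeAttention

/-! ### The rotary position embedding and its orbit

The ambient space is `ℝ^d = (ℝ²)^L ⊕ ℝ^s` with `d = 2 L + s`: there are `L` rotated planes and `s`
unrotated coordinates. The purely rotated case is `s = 0`. -/

/-- Coordinates of `ℝ^d`: the coordinate `(a, l)` is the `a`-th coordinate of the `l`-th plane. -/
abbrev Coord (L s : ℕ) : Type := (Fin 2 × Fin L) ⊕ Fin s

/-- The Euclidean space `ℝ^d`, `d = 2 L + s`. -/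
abbrev Space (L s : ℕ) : Type := EuclideanSpace ℝ (Coord L s)

/-- The unit sphere `S^(d-1)` of `ℝ^d`. -/
abbrev USphere (L s : ℕ) : Type := Metric.sphere (0 : Space L s) 1

/-- The plane rotation `r(φ)`. -/
def planeRot (φ : Real.Angle) : Matrix (Fin 2) (Fin 2) ℝ :=
  !![φ.cos, -φ.sin; φ.sin, φ.cos]

/-- The matrix `diag(r(φ_1), …, r(φ_L), 1, …, 1)`. -/
def blockRot {L : ℕ} (s : ℕ) (φ : Fin L → Real.Angle) : Matrix (Coord L s) (Coord L s) ℝ :=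
  Matrix.fromBlocks (Matrix.blockDiagonal fun l => planeRot (φ l)) 0 0 1

theorem planeRot_transpose (φ : Real.Angle) : (planeRot φ)ᵀ = planeRot (-φ) := by
  ext i j
  fin_cases i <;> fin_cases j <;> simp [planeRot]

theorem planeRot_neg_mul (φ : Real.Angle) : planeRot (-φ) * planeRot φ = 1 := by
  have h := Real.Angle.cos_sq_add_sin_sq φ
  ext i j
  fin_cases i <;> fin_cases j <;>
    simp [planeRot, Matrix.mul_apply, Fin.sum_univ_two] <;> linarith

theorem blockRot_transpose {L s : ℕ} (φ : Fin L → Real.Angle) :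
    (blockRot s φ)ᵀ = blockRot s (-φ) := by
  simp [blockRot, Matrix.fromBlocks_transpose, Matrix.blockDiagonal_transpose,
    planeRot_transpose]

theorem blockRot_transpose_mul {L s : ℕ} (φ : Fin L → Real.Angle) :
    (blockRot s φ)ᵀ * blockRot s φ = 1 := by
  rw [blockRot_transpose, blockRot, blockRot, Matrix.fromBlocks_multiply]
  simp only [Matrix.mul_zero, Matrix.zero_mul, add_zero, zero_add, Matrix.mul_one,
    ← Matrix.blockDiagonal_mul, Pi.neg_apply, planeRot_neg_mul]
  rw [show (fun _ : Fin L => (1 : Matrix (Fin 2) (Fin 2) ℝ)) = 1 from rfl,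
    Matrix.blockDiagonal_one, Matrix.fromBlocks_one]

/-- Block rotations act on the unit sphere. -/
theorem blockRot_mulVec_mem {L s : ℕ} (φ : Fin L → Real.Angle) (q : USphere L s) :
    WithLp.toLp 2 (blockRot s φ *ᵥ WithLp.ofLp (q : Space L s)) ∈
      Metric.sphere (0 : Space L s) 1 := by
  have hq : ‖(q : Space L s)‖ = 1 := mem_sphere_zero_iff_norm.1 q.2
  have key : ‖WithLp.toLp 2 (blockRot s φ *ᵥ WithLp.ofLp (q : Space L s))‖ ^ 2
      = ‖(q : Space L s)‖ ^ 2 := by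
    have h1 : ∀ v : Space L s, ‖v‖ ^ 2 = WithLp.ofLp v ⬝ᵥ WithLp.ofLp v := by
      intro v
      rw [EuclideanSpace.real_norm_sq_eq]
      simp [dotProduct, sq]
    rw [h1, h1]
    change (blockRot s φ *ᵥ WithLp.ofLp (q : Space L s)) ⬝ᵥ
      (blockRot s φ *ᵥ WithLp.ofLp (q : Space L s)) = _
    rw [Matrix.dotProduct_mulVec, Matrix.vecMul_mulVec, blockRot_transpose_mul, Matrix.vecMul_one]
  rw [mem_sphere_zero_iff_norm]
  rw [hq] at key
  nlinarith [norm_nonneg (WithLp.toLp 2 (blockRot s φ *ᵥ WithLp.ofLp (q : Space L s)))]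

/-- The RoPE matrix `R_p = diag(r(p ϑ_1), …, r(p ϑ_L), 1, …, 1)` at position `p`. -/
def ropeMatrix {L : ℕ} (s : ℕ) (ϑ : Fin L → ℝ) (p : ℤ) : Matrix (Coord L s) (Coord L s) ℝ :=
  blockRot s fun l => (((p : ℝ) * ϑ l : ℝ) : Real.Angle)

/-- The RoPE target direction `u_i = R_iᵀ q`. -/
def target {L s : ℕ} (ϑ : Fin L → ℝ) (q : USphere L s) (i : ℤ) : USphere L s :=
  ⟨WithLp.toLp 2 ((ropeMatrix s ϑ i)ᵀ *ᵥ WithLp.ofLp (q : Space L s)), by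
    rw [ropeMatrix, blockRot_transpose]
    exact blockRot_mulVec_mem _ q⟩

/-- The orbit closure `𝒪_q` of the targets in the sphere. -/
def orbitClosure {L s : ℕ} (ϑ : Fin L → ℝ) (q : USphere L s) : Set (USphere L s) :=
  closure (Set.range (target ϑ q))

/-- The torus `𝕋^L = (ℝ/ℤ)^L`. -/
abbrev Torus (L : ℕ) : Type := Fin L → UnitAddCircle

/-- The rotation vector `θ = (ϑ_1 / 2π, …, ϑ_L / 2π)` in the torus. -/
def torusFreq {L : ℕ} (ϑ : Fin L → ℝ) : Torus L :=
  fun l => ((ϑ l / (2 * Real.pi) : ℝ) : UnitAddCircle)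

/-- The isomorphism `ℝ/ℤ → ℝ/2πℤ`, `x ↦ 2π x`. -/
def turn : UnitAddCircle ≃+ Real.Angle :=
  AddCircle.equivAddCircle (1 : ℝ) (2 * Real.pi) one_ne_zero Real.two_pi_pos.ne'

theorem turn_coe (x : ℝ) : turn (x : UnitAddCircle) = ((2 * Real.pi * x : ℝ) : Real.Angle) := by
  rw [turn]
  erw [AddCircle.equivAddCircle_apply_mk]
  congr 1
  ring

/-- The map `Φ_q(x) = diag(r(-2π x_1), …, r(-2π x_L), 1, …, 1) q` from the torus to the sphere. -/
def phaseMap {L s : ℕ} (q : USphere L s) (x : Torus L) : USphere L s :=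
  ⟨WithLp.toLp 2 (blockRot s (fun l => turn (-x l)) *ᵥ WithLp.ofLp (q : Space L s)),
    blockRot_mulVec_mem _ q⟩

/-- The targets are the images of the multiples of `θ`. -/
theorem target_eq_phaseMap {L s : ℕ} (ϑ : Fin L → ℝ) (q : USphere L s) (i : ℤ) :
    target ϑ q i = phaseMap q (i • torusFreq ϑ) := by
  apply Subtype.ext
  simp only [target, phaseMap, ropeMatrix, blockRot_transpose]
  have h : (-fun l => (((i : ℝ) * ϑ l : ℝ) : Real.Angle)) =
      fun l => turn (-(i • torusFreq ϑ) l) := by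
    funext l
    rw [Pi.neg_apply, map_neg, Pi.smul_apply, map_zsmul, torusFreq, turn_coe,
      mul_div_cancel₀ _ Real.two_pi_pos.ne', ← Real.Angle.coe_zsmul, zsmul_eq_mul]
  rw [h]

/-- The closed subgroup `ℋ_q`, the closure of `{i θ mod 1 : i ∈ ℤ}` in the torus. -/
def phaseGroup {L : ℕ} (ϑ : Fin L → ℝ) : AddSubgroup (Torus L) :=
  (AddSubgroup.zmultiples (torusFreq ϑ)).topologicalClosure

instance {L : ℕ} (ϑ : Fin L → ℝ) : CompactSpace (phaseGroup ϑ) :=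
  isCompact_iff_compactSpace.mp
    (AddSubgroup.isClosed_topologicalClosure (AddSubgroup.zmultiples (torusFreq ϑ))).isCompact

/-- The Haar probability measure on `ℋ_q`: the Haar measure of total mass one. -/
def phaseHaar {L : ℕ} (ϑ : Fin L → ℝ) : Measure (phaseGroup ϑ) :=
  Measure.addHaarMeasure ⊤

/-- The phase law `π_q`, the image of the Haar probability measure of `ℋ_q` under `Φ_q`. -/
def phaseLaw {L s : ℕ} (ϑ : Fin L → ℝ) (q : USphere L s) : Measure (USphere L s) :=
  (phaseHaar ϑ).map fun h : phaseGroup ϑ => phaseMap q (h : Torus L)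

/-! ### Constants -/

/-- The critical exponent `α = 2 / (d - 1)`. -/
def critExp (d : ℕ) : ℝ := 2 / ((d : ℝ) - 1)

/-- Surface measure on the unit sphere of `ℝ^d`. -/
def surface (L s : ℕ) : Measure (USphere L s) := (volume : Measure (Space L s)).toSphere

instance (L s : ℕ) : IsFiniteMeasure (surface L s) := by
  unfold surface; infer_instance

/-- The surface area of the unit sphere `S^(k-1)` of `ℝ^k`. -/
def sphereArea (k : ℕ) : ℝ := (volume : Measure (EuclideanSpace ℝ (Fin k))).toSphere.real Set.univ

/-- The orbit average `C̄(q) = 2^(1/α) σ_(d-2) / (d - 1) ∫ ρ dπ_q`, where `σ_(d-2)` is the surface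
area of the unit sphere `S^(d-2)` of `ℝ^(d-1)`. -/
def orbitConst {L s : ℕ} (ϑ : Fin L → ℝ) (q : USphere L s) (ρ : USphere L s → ℝ≥0) : ℝ :=
  (2 : ℝ) ^ (1 / critExp (2 * L + s)) * sphereArea (2 * L + s - 1) / (((2 * L + s : ℕ) : ℝ) - 1) *
    ∫ u, (ρ u : ℝ) ∂(phaseLaw ϑ q)

theorem critExp_pos {d : ℕ} (hd : 2 ≤ d) : 0 < critExp d := by
  have : (2 : ℝ) ≤ d := by exact_mod_cast hd
  unfold critExp
  apply div_pos <;> linarith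

theorem orbitConst_nonneg {L s : ℕ} (hd : 2 ≤ 2 * L + s) (ϑ : Fin L → ℝ) (q : USphere L s)
    (ρ : USphere L s → ℝ≥0) : 0 ≤ orbitConst ϑ q ρ := by
  have h2 : (2 : ℝ) ≤ ((2 * L + s : ℕ) : ℝ) := by exact_mod_cast hd
  have h3 : (0 : ℝ) ≤ ((2 * L + s : ℕ) : ℝ) - 1 := by linarith
  have h4 : 0 ≤ sphereArea (2 * L + s - 1) := measureReal_nonneg
  have h5 : 0 ≤ ∫ u, (ρ u : ℝ) ∂(phaseLaw ϑ q) := integral_nonneg fun u => (ρ u).2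
  unfold orbitConst
  positivity

/-! ### Point processes on `ℝ₊` -/

/-- The measure `Λ` on `ℝ₊ = [0, ∞)` with `Λ([0, y]) = c (y / γ)^a`. -/
def powerIntensity (c γ a : ℝ) (hc : 0 ≤ c) (hγ : 0 < γ) (ha : 0 < a) : Measure ℝ≥0 :=
  StieltjesFunction.measure
    { toFun := fun y : ℝ≥0 => c * ((y : ℝ) / γ) ^ a
      mono' := fun x y hxy => by
        have hxy' : (x : ℝ) ≤ y := hxy
        dsimp only
        gcongr
      right_continuous' := fun x => by
        apply Continuous.continuousWithinAt
        exact continuous_const.mul ((Real.continuous_rpow_const ha.le).comp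
          (NNReal.continuous_coe.div_const γ)) }

theorem powerIntensity_Iic (c γ a : ℝ) (hc : 0 ≤ c) (hγ : 0 < γ) (ha : 0 < a) (y : ℝ≥0) :
    powerIntensity c γ a hc hγ ha (Set.Iic y) = ENNReal.ofReal (c * ((y : ℝ) / γ) ^ a) := by
  have h : (Set.Iic y : Set ℝ≥0) = Set.Icc 0 y := by ext; simp
  have hbot : 𝓝[<] (0 : ℝ≥0) = ⊥ := by
    rw [show Set.Iio (0 : ℝ≥0) = ∅ by ext; simp, nhdsWithin_empty]
  rw [h, powerIntensity, StieltjesFunction.measure_Icc, leftLim_eq_of_eq_bot _ hbot]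
  congr 1
  change c * ((y : ℝ) / γ) ^ a - c * (((0 : ℝ≥0) : ℝ) / γ) ^ a = _
  simp [Real.zero_rpow ha.ne']

/-- `𝒳` is a Poisson point process on `ℝ₊` with intensity measure `Λ`: a random boundedly finite
counting measure whose value on a measurable set `B` with `Λ(B) < ∞` has the Poisson law of mean
`Λ(B)`, and whose values on disjoint such sets are independent. -/
structure IsPoissonPointProcess {Ω : Type*} [MeasurableSpace Ω] (𝒳 : Ω → Measure ℝ≥0)
    (Λ : Measure ℝ≥0) (P : Measure Ω) : Prop where
  measurable : Measurable 𝒳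
  counting : ∀ ω, ∀ B : Set ℝ≥0, MeasurableSet B → Bornology.IsBounded B → ∃ k : ℕ, 𝒳 ω B = k
  law : ∀ B : Set ℝ≥0, MeasurableSet B → Λ B < ∞ →
    P.map (fun ω => 𝒳 ω B) = (poissonMeasure (Λ B).toNNReal).map (fun k : ℕ => (k : ℝ≥0∞))
  indep : ∀ (k : ℕ) (B : Fin k → Set ℝ≥0), (∀ i, MeasurableSet (B i)) → (∀ i, Λ (B i) < ∞) →
    Pairwise (fun i j => Disjoint (B i) (B j)) → iIndepFun (fun i ω => 𝒳 ω (B i)) P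

/-- The `j`-th arrival of a measure on `ℝ₊`, counting from `j = 0` and with multiplicity: the least
`y` such that `[0, y]` has mass at least `j + 1`. -/
def arrival (μ : Measure ℝ≥0) (j : ℕ) : ℝ≥0 := sInf {y : ℝ≥0 | (j : ℝ≥0∞) + 1 ≤ μ (Set.Iic y)}

/-- The limiting weights `e^(-Y_j) / ∑_l e^(-Y_l)`, where `Y_0, Y_1, …` are the arrivals. -/
def limitWeight (μ : Measure ℝ≥0) (j : ℕ) : ℝ :=
  Real.exp (-(arrival μ j : ℝ)) / ∑' l : ℕ, Real.exp (-(arrival μ l : ℝ))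

/-! ### Attention weights -/

/-- The distance `U_i = 1 - ⟨u_i, x_i⟩` of the key `x_i` to its target. -/
def dist2target {L s : ℕ} (ϑ : Fin L → ℝ) (q : USphere L s) (x : ℤ → USphere L s) (i : ℤ) : ℝ :=
  1 - inner ℝ (target ϑ q i : Space L s) (x i : Space L s)

/-- The attention weights `A_1, …, A_n` at inverse temperature `b`; `A_(i+1)` is the value at
`i : Fin n`. -/
def weight {L s : ℕ} (ϑ : Fin L → ℝ) (q : USphere L s) (x : ℤ → USphere L s) (b : ℝ) (n : ℕ)
    (i : Fin n) : ℝ :=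
  Real.exp (-b * dist2target ϑ q x ((i : ℤ) + 1)) /
    ∑ j : Fin n, Real.exp (-b * dist2target ϑ q x ((j : ℤ) + 1))

/-- The `j`-th largest entry of a finite family, counting from `j = 0` and with multiplicity; it is
`0` if the family has at most `j` entries. -/
def nthLargest {n : ℕ} (a : Fin n → ℝ) (j : ℕ) : ℝ :=
  if h : j < n then a (Tuple.sort (fun i => -a i) ⟨j, h⟩) else 0

/-! ### Assumptions on the keys -/

/-- The keys `(x_i)_{i ∈ ℤ}` form a stationary `m`-dependent sequence in the sphere, their common
law has density `ρ` with respect to surface measure, and the local density and anti-clustering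
bounds hold near the orbit closure. -/
structure CorrelatedKeys {L s : ℕ} (ϑ : Fin L → ℝ) (q : USphere L s) {Ω : Type*}
    [MeasurableSpace Ω] (P : Measure Ω) (x : ℤ → Ω → USphere L s) (m : ℕ)
    (ρ : USphere L s → ℝ≥0) : Prop where
  measurable : ∀ i, Measurable (x i)
  stationary : ∀ (r : ℕ) (κ : Fin r → ℤ) (h : ℤ),
    P.map (fun ω j => x (κ j) ω) = P.map (fun ω j => x (κ j + h) ω)
  m_dependent : ∀ I J : Set ℤ, (∀ i ∈ I, ∀ j ∈ J, (m : ℤ) < |i - j|) →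
    IndepFun (fun ω (i : I) => x i ω) (fun ω (j : J) => x j ω) P
  density_measurable : Measurable ρ
  density : ∀ i, P.map (x i) = (surface L s).withDensity fun u => (ρ u : ℝ≥0∞)
  density_local : ∃ V : Set (USphere L s), IsOpen V ∧ orbitClosure ϑ q ⊆ V ∧
    ContinuousOn ρ V ∧ ∀ u ∈ V, 0 < ρ u
  anti_clustering : ∀ l : ℕ, 1 ≤ l → l ≤ m → ∃ g : USphere L s × USphere L s → ℝ≥0∞,
    Measurable g ∧
    P.map (fun ω => (x 0 ω, x l ω)) = ((surface L s).prod (surface L s)).withDensity g ∧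
    ∃ V : Set (USphere L s × USphere L s), IsOpen V ∧ orbitClosure ϑ q ×ˢ orbitClosure ϑ q ⊆ V ∧
      ∃ M : ℝ≥0, ∀ p ∈ V, g p ≤ M

end RopeAttention

end

/-!
Put `k = d - 1` and rescale the distances to `β_n U_i`; the weights are the normalized exponentials
of these points. A cap of height `t` around `u` has surface area asymptotic to a constant times
`t ^ (k / 2)`, uniformly in `u`, so that `n P(β_n U_i ≤ y)` is close to a constant times
`ρ(u_i) (y / γ) ^ (k / 2)`, and the average over `i ≤ n` converges because the phases `i θ`
equidistribute in the closed subgroup they generate. Within distance `m` two keys are close to their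
targets with probability `O(n⁻²)`, and beyond distance `m` they are independent; hence the
characteristic function of the numbers of points in the cells of a grid converges to that of a
Poisson process, each `m`-dependent product being compared with the exponential of its sum.

Poisson limits of cell counts suffice for the ordered weights: up to an error controlled by the mesh
of the grid, the probability of an empty initial interval and the exponential mass of the tail, the
leading weights are Lipschitz functions of the cell counts, and the tail is small in mean because
both the prelimit and the limit have polynomially growing mean counts.
-/

noncomputable section

namespace RopeAttention

/-! ### Equidistribution in compact monothetic groups -/

section Equidistribution

variable {G E : Type*} [SeminormedAddCommGroup G] [CompactSpace G] [NormedAddCommGroup E]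
  [NormedSpace ℝ E] {g : G} {f : G → E}

theorem tendsto_birkhoffAverage_sub_of_dense (hg : Dense (AddSubgroup.zmultiples g : Set G))
    (hf : Continuous f) (x y : G) :
    Tendsto (fun n => birkhoffAverage ℝ (g + ·) f n x - birkhoffAverage ℝ (g + ·) f n y) atTop
      (𝓝 0) := by
  let S : Set G := {x | Tendsto
    (fun n => birkhoffAverage ℝ (g + ·) f n x - birkhoffAverage ℝ (g + ·) f n y) atTop (𝓝 0)}
  have hS_closed : IsClosed S := by
    have hg_lip : LipschitzWith 1 (g + ·) := (isometry_vadd G g).lipschitz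
    have hequi := (uniformEquicontinuous_birkhoffAverage ℝ hg_lip
      (CompactSpace.uniformContinuous_of_continuous hf)).equicontinuous
    refine Equicontinuous.isClosed_setOfPred_tendsto (fun x₀ => ?_)
      (continuous_const (y := (0 : E)))
    rw [Metric.equicontinuousAt_iff_right]
    simpa only [dist_sub_right] using Metric.equicontinuousAt_iff_right.1 (hequi x₀)
  have hS_shift : ∀ x, g + x ∈ S ↔ x ∈ S := fun x =>
    have hstep := tendsto_birkhoffAverage_apply_sub_birkhoffAverage' ℝ
      (isCompact_range hf).isBounded (g + ·) x
    ⟨fun h => by simpa [S] using h.sub hstep, fun h => by simpa [S] using hstep.add h⟩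
  have hS_orbit : ∀ k : ℤ, k • g + y ∈ S := fun k => by
    induction k using Int.induction_on with
    | zero => simp [S]
    | succ k ih => rwa [add_comm (k : ℤ), add_smul, one_smul, add_assoc, hS_shift]
    | pred k ih => rwa [← hS_shift, ← add_assoc, sub_smul, one_smul, add_sub_cancel]
  have hS_dense : Dense S := by
    have himage : Dense ((· + y) '' (AddSubgroup.zmultiples g : Set G)) :=
      (Homeomorph.addRight y).surjective.denseRange.dense_image (by fun_prop) hg
    refine himage.mono ?_
    rintro _ ⟨_, ⟨k, rfl⟩, rfl⟩
    exact hS_orbit k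
  exact hS_closed.closure_subset_iff.2 subset_rfl (hS_dense x)

variable [MeasurableSpace G] [BorelSpace G] (μ : Measure G) [IsProbabilityMeasure μ]
  [μ.IsAddLeftInvariant]

theorem integral_birkhoffAverage_add (g : G) (hf : Continuous f) {n : ℕ} (hn : n ≠ 0) :
    ∫ x, birkhoffAverage ℝ (g + ·) f n x ∂μ = ∫ x, f x ∂μ := by
  simp only [birkhoffAverage, birkhoffSum, add_left_iterate, integral_smul]
  rw [integral_finsetSum _ fun k _ => ?_]
  · simp only [integral_add_left_eq_self f, Finset.sum_const, Finset.card_range]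
    rw [← Nat.cast_smul_eq_nsmul ℝ, inv_smul_smul₀ (Nat.cast_ne_zero.2 hn)]
  · exact (hf.comp (continuous_const_add _)).integrable_of_hasCompactSupport
      (.of_compactSpace _)

theorem tendsto_birkhoffAverage_integral [CompleteSpace E]
    (hg : Dense (AddSubgroup.zmultiples g : Set G)) (hf : Continuous f) (x : G) :
    Tendsto (fun n => birkhoffAverage ℝ (g + ·) f n x) atTop (𝓝 (∫ y, f y ∂μ)) := by
  obtain ⟨M, hM⟩ := (isCompact_range hf).isBounded.exists_norm_le
  have hM' : ∀ y, ‖f y‖ ≤ M := fun y => hM _ ⟨y, rfl⟩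
  have hcont : ∀ n, Continuous (birkhoffAverage ℝ (g + ·) f n) := fun n => by
    unfold birkhoffAverage birkhoffSum
    simp only [add_left_iterate]
    fun_prop
  have hbound : ∀ n y, ‖birkhoffAverage ℝ (g + ·) f n y‖ ≤ M := fun n y => by
    rw [birkhoffAverage, norm_smul, norm_inv, RCLike.norm_natCast]
    refine inv_mul_le_of_le_mul₀ n.cast_nonneg ((norm_nonneg _).trans (hM' y)) ?_
    simpa [birkhoffSum] using norm_sum_le_of_le (Finset.range n) fun k _ => hM' ((g + ·)^[k] y)
  have hlim := tendsto_integral_of_dominated_convergence (μ := μ) (fun _ => M + M)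
    (fun n => ((hcont n).sub (continuous_const (y := birkhoffAverage ℝ (g + ·) f n x))
      ).aestronglyMeasurable_of_compactSpace)
    (integrable_const _)
    (fun n => ae_of_all _ fun y => norm_sub_le_of_le (hbound n y) (hbound n x))
    (ae_of_all _ fun y => tendsto_birkhoffAverage_sub_of_dense hg hf y x)
  rw [integral_zero] at hlim
  refine tendsto_of_tendsto_of_dist (f₁ := fun _ => ∫ y, f y ∂μ) tendsto_const_nhds ?_
  rw [← norm_zero (E := E)]
  refine hlim.norm.congr' ?_
  filter_upwards [eventually_ne_atTop 0] with n hn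
  simp only [Pi.sub_apply]
  rw [integral_sub ((hcont n).integrable_of_hasCompactSupport (.of_compactSpace _))
    (integrable_const _), integral_birkhoffAverage_add μ g hf hn, integral_const, dist_eq_norm,
    probReal_univ, one_smul]

end Equidistribution

theorem continuous_turn : Continuous turn :=
  (AddCircle.homeomorphAddCircle (1 : ℝ) (2 * Real.pi) one_ne_zero Real.two_pi_pos.ne').continuous

section PhaseSpace

variable {L s : ℕ}

theorem continuous_phaseMap (q : USphere L s) : Continuous (phaseMap q) := by
  refine Continuous.subtype_mk ((PiLp.continuous_toLp 2 _).comp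
    (Continuous.matrix_mulVec ?_ continuous_const)) _
  refine Continuous.matrix_fromBlocks (Continuous.matrix_blockDiagonal ?_) continuous_const
    continuous_const continuous_const
  refine continuous_pi fun l => continuous_matrix fun i j => ?_
  have hturn : Continuous fun x : Torus L => turn (-x l) :=
    continuous_turn.comp (continuous_apply l).neg
  have hcos := Real.Angle.continuous_cos.comp hturn
  have hsin := Real.Angle.continuous_sin.comp hturn
  fin_cases i <;> fin_cases j
  exacts [hcos, hsin.neg, hsin, hcos]

variable (ϑ : Fin L → ℝ) (q : USphere L s)

theorem phaseMap_mem_orbitClosure (h : phaseGroup ϑ) :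
    phaseMap q (h : Torus L) ∈ orbitClosure ϑ q := by
  refine map_mem_closure (continuous_phaseMap q) h.2 ?_
  rintro _ ⟨i, rfl⟩
  exact ⟨i, target_eq_phaseMap ϑ q i⟩

theorem target_mem_orbitClosure (i : ℤ) : target ϑ q i ∈ orbitClosure ϑ q :=
  subset_closure ⟨i, rfl⟩

theorem isCompact_orbitClosure : IsCompact (orbitClosure ϑ q) :=
  isClosed_closure.isCompact

instance : IsProbabilityMeasure (phaseHaar ϑ) :=
  ⟨Measure.addHaarMeasure_self⟩

instance : (phaseHaar ϑ).IsAddLeftInvariant := by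
  unfold phaseHaar; infer_instance

/-- The rotation vector `θ` as an element of the group `ℋ_q` that it topologically generates. -/
def phaseGen : phaseGroup ϑ :=
  ⟨torusFreq ϑ, AddSubgroup.le_topologicalClosure _ (AddSubgroup.mem_zmultiples _)⟩

theorem dense_zmultiples_phaseGen :
    Dense (AddSubgroup.zmultiples (phaseGen ϑ) : Set (phaseGroup ϑ)) := by
  refine Subtype.dense_iff.2 fun x hx => closure_mono ?_ hx
  rintro _ ⟨i, rfl⟩
  exact ⟨i • phaseGen ϑ, ⟨i, rfl⟩, rfl⟩

theorem target_add_one_eq_phaseMap (i : ℕ) :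
    target ϑ q ((i : ℤ) + 1) = phaseMap q ((phaseGen ϑ + ·)^[i] (phaseGen ϑ) : phaseGroup ϑ) := by
  rw [target_eq_phaseMap, add_left_iterate_apply, add_smul, one_smul, natCast_zsmul]
  rfl

variable {ϑ q}

theorem tendsto_target_average {ρ : USphere L s → ℝ} (hm : Measurable ρ)
    (hρ : ContinuousOn ρ (orbitClosure ϑ q)) :
    Tendsto (fun n : ℕ => (∑ i : Fin n, ρ (target ϑ q (((i : ℕ) : ℤ) + 1))) / n) atTop
      (𝓝 (∫ u, ρ u ∂(phaseLaw ϑ q))) := by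
  have hphase : Continuous fun h : phaseGroup ϑ => phaseMap q (h : Torus L) :=
    (continuous_phaseMap q).comp continuous_subtype_val
  have havg := tendsto_birkhoffAverage_integral (phaseHaar ϑ) (dense_zmultiples_phaseGen ϑ)
    (hρ.comp_continuous hphase (phaseMap_mem_orbitClosure ϑ q)) (phaseGen ϑ)
  rw [phaseLaw, integral_map hphase.measurable.aemeasurable hm.aestronglyMeasurable]
  refine havg.congr fun n => ?_
  simp only [target_add_one_eq_phaseMap]
  rw [Fin.sum_univ_eq_sum_range
    (fun i => ρ (phaseMap q ((phaseGen ϑ + ·)^[i] (phaseGen ϑ) : phaseGroup ϑ))) n, div_eq_inv_mul]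
  rfl

end PhaseSpace

/-! ### The area of spherical caps -/

/-- The volume of the unit ball of `ℝ^k`. -/
def ballVol (k : ℕ) : ℝ := (volume : Measure (EuclideanSpace ℝ (Fin k))).real (Metric.ball 0 1)

theorem ballVol_pos (k : ℕ) : 0 < ballVol k :=
  ENNReal.toReal_pos (Metric.measure_ball_pos _ _ one_pos).ne' measure_ball_lt_top.ne

theorem sphereArea_eq (k : ℕ) : sphereArea k = k * ballVol k := by
  simp [sphereArea, ballVol]

theorem prod_addHaar_cone {F : Type*} [NormedAddCommGroup F] [NormedSpace ℝ F]
    [FiniteDimensional ℝ F] [MeasurableSpace F] [BorelSpace F] (μ : Measure F)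
    [μ.IsAddHaarMeasure] {τ h : ℝ} (hτ : 0 ≤ τ) (hh : 0 ≤ h) :
    ((volume : Measure ℝ).prod μ) {z : ℝ × F | z.1 ∈ Set.Ioo 0 h ∧ ‖z.2‖ ≤ τ * z.1} =
      ENNReal.ofReal (τ ^ Module.finrank ℝ F * h ^ (Module.finrank ℝ F + 1) /
        (Module.finrank ℝ F + 1)) * μ (Metric.ball 0 1) := by
  set k := Module.finrank ℝ F
  have hfiber : ∀ a : ℝ, μ (Prod.mk a ⁻¹' {z : ℝ × F | z.1 ∈ Set.Ioo 0 h ∧ ‖z.2‖ ≤ τ * z.1}) =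
      (Set.Ioo 0 h).indicator (fun a => ENNReal.ofReal ((τ * a) ^ k) * μ (Metric.ball 0 1)) a := by
    intro a
    by_cases ha : a ∈ Set.Ioo 0 h
    · rw [Set.indicator_of_mem ha, ← Measure.addHaar_closedBall μ 0 (mul_nonneg hτ ha.1.le)]
      congr 1
      ext w
      simp [ha.1, ha.2]
    · rw [Set.indicator_of_notMem ha, ← measure_empty (μ := μ)]
      congr 1
      ext w
      simp only [Set.mem_preimage, Set.mem_ofPred_eq, ha, false_and, Set.mem_empty_iff_false]
  have hint : ∫ a in Set.Ioo 0 h, (τ * a) ^ k = τ ^ k * h ^ (k + 1) / (k + 1) := by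
    rw [← integral_Ioc_eq_integral_Ioo, ← intervalIntegral.integral_of_le hh]
    simp only [mul_pow, intervalIntegral.integral_const_mul, integral_pow]
    rw [zero_pow k.succ_ne_zero, sub_zero, mul_div_assoc]
  have hmeas : MeasurableSet {z : ℝ × F | z.1 ∈ Set.Ioo 0 h ∧ ‖z.2‖ ≤ τ * z.1} := by
    measurability
  rw [Measure.prod_apply hmeas, lintegral_congr hfiber, lintegral_indicator measurableSet_Ioo,
    lintegral_mul_const _ (by fun_prop), ← hint, ofReal_integral_eq_lintegral_ofReal]
  · exact (Continuous.integrableOn_Icc (by fun_prop)).mono_set Set.Ioo_subset_Icc_self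
  · refine (ae_restrict_iff' measurableSet_Ioo).2 (ae_of_all _ fun a ha => ?_)
    exact pow_nonneg (mul_nonneg hτ ha.1.le) k

section Cap

variable {E : Type*} [NormedAddCommGroup E] [InnerProductSpace ℝ E]

theorem inner_coe_sphere_le_norm (u : Metric.sphere (0 : E) 1) (v : E) :
    inner ℝ (u : E) v ≤ ‖v‖ := by
  simpa using real_inner_le_norm (u : E) v

/-- The spherical cap of height `t` around `u`. -/
def cap (u : Metric.sphere (0 : E) 1) (t : ℝ) : Set (Metric.sphere (0 : E) 1) :=
  {x | 1 - inner ℝ (u : E) (x : E) ≤ t}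

theorem isClosed_cap (u : Metric.sphere (0 : E) 1) (t : ℝ) : IsClosed (cap u t) :=
  isClosed_le (by fun_prop) continuous_const

theorem cap_mono (u : Metric.sphere (0 : E) 1) : Monotone (cap u) :=
  fun _ _ h _ hx => le_trans hx h

theorem dist_lt_of_mem_cap {u x : Metric.sphere (0 : E) 1} {t δ : ℝ} (hδ : 0 < δ)
    (ht : 2 * t < δ ^ 2) (hx : x ∈ cap u t) : dist x u < δ := by
  have hx : 1 - inner ℝ (u : E) (x : E) ≤ t := hx
  have hsq : ‖(x : E) - u‖ ^ 2 = 2 - 2 * inner ℝ (u : E) (x : E) := by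
    rw [norm_sub_sq_real, mem_sphere_zero_iff_norm.1 x.2, mem_sphere_zero_iff_norm.1 u.2,
      real_inner_comm]
    ring
  rw [Subtype.dist_eq, dist_eq_norm]
  exact lt_of_pow_lt_pow_left₀ 2 hδ.le (by rw [hsq]; linarith)

theorem exists_cap_oscillation {β : Type*} [PseudoMetricSpace β]
    {O : Set (Metric.sphere (0 : E) 1)} (hO : IsCompact O) {ρ : Metric.sphere (0 : E) 1 → β}
    (hρ : ∀ u ∈ O, ContinuousAt ρ u) {ε : ℝ} (hε : 0 < ε) :
    ∃ t₀ : ℝ, 0 < t₀ ∧ ∀ u ∈ O, ∀ x ∈ cap u t₀, dist (ρ u) (ρ x) < ε := by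
  obtain ⟨δ, hδ, hρδ⟩ := Metric.mem_uniformity_dist.1
    (hO.uniformContinuousAt_of_continuousAt ρ hρ (Metric.dist_mem_uniformity hε))
  refine ⟨δ ^ 2 / 4, by positivity, fun u hu x hx => hρδ ?_ hu⟩
  rw [dist_comm]
  exact dist_lt_of_mem_cap hδ (by nlinarith [pow_pos hδ 2]) hx

theorem exists_prod_cap_subset {O : Set (Metric.sphere (0 : E) 1)} (hO : IsCompact O)
    {V : Set (Metric.sphere (0 : E) 1 × Metric.sphere (0 : E) 1)} (hV : IsOpen V)
    (hOV : O ×ˢ O ⊆ V) :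
    ∃ t₀ : ℝ, 0 < t₀ ∧ ∀ u ∈ O, ∀ v ∈ O, cap u t₀ ×ˢ cap v t₀ ⊆ V := by
  obtain ⟨δ, hδ, hδV⟩ := (hO.prod hO).exists_thickening_subset_open hV hOV
  have hδ2 : 2 * (δ ^ 2 / 4) < δ ^ 2 := by nlinarith [pow_pos hδ 2]
  refine ⟨δ ^ 2 / 4, by positivity, fun u hu v hv z hz => hδV ?_⟩
  refine Metric.mem_thickening_iff.2 ⟨(u, v), ⟨hu, hv⟩, ?_⟩
  exact max_lt (dist_lt_of_mem_cap hδ hδ2 hz.1) (dist_lt_of_mem_cap hδ hδ2 hz.2)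

open scoped Pointwise in
theorem Ioo_smul_coe_image_cap (u : Metric.sphere (0 : E) 1) (t : ℝ) :
    (Set.Ioo (0 : ℝ) 1 • ((↑) '' cap u t : Set E)) =
      {v | (0 < ‖v‖ ∧ ‖v‖ < 1) ∧ (1 - t) * ‖v‖ ≤ inner ℝ (u : E) v} := by
  ext v
  simp only [Set.mem_smul, Set.mem_image, Set.mem_ofPred_eq]
  constructor
  · rintro ⟨r, ⟨hr0, hr1⟩, _, ⟨x, hx, rfl⟩, rfl⟩
    have hx : 1 - inner ℝ (u : E) (x : E) ≤ t := hx
    rw [norm_smul, mem_sphere_zero_iff_norm.1 x.2, mul_one, Real.norm_of_nonneg hr0.le,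
      inner_smul_right]
    exact ⟨⟨hr0, hr1⟩, by nlinarith⟩
  · rintro ⟨⟨h0, h1⟩, h⟩
    refine ⟨‖v‖, ⟨h0, h1⟩, ‖v‖⁻¹ • v, ⟨⟨‖v‖⁻¹ • v, ?_⟩, ?_, rfl⟩, ?_⟩
    · rw [mem_sphere_zero_iff_norm, norm_smul, norm_inv, norm_norm, inv_mul_cancel₀ h0.ne']
    · change 1 - inner ℝ (u : E) (‖v‖⁻¹ • v) ≤ t
      rw [inner_smul_right, inv_mul_eq_div, sub_le_comm, le_div_iff₀ h0]
      exact h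
    · rw [smul_smul, mul_inv_cancel₀ h0.ne', one_smul]

variable [FiniteDimensional ℝ E] [MeasurableSpace E] [BorelSpace E] {k : ℕ}

theorem exists_measurePreserving_inner_prod (hk : Module.finrank ℝ E = k + 1) {u : E}
    (hu : ‖u‖ = 1) :
    ∃ Ψ : E → ℝ × EuclideanSpace ℝ (Fin k), MeasurePreserving Ψ ∧
      ∀ v, (Ψ v).1 = inner ℝ u v ∧ ‖(Ψ v).2‖ ^ 2 = ‖v‖ ^ 2 - inner ℝ u v ^ 2 := by
  obtain ⟨b, hb⟩ := Orthonormal.exists_orthonormalBasis_extension_of_card_eq (𝕜 := ℝ)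
    (ι := Fin (k + 1)) (E := E) (by simp [hk]) (v := fun _ => u) (s := {0})
    (by
      rw [orthonormal_iff_ite]
      rintro ⟨i, rfl⟩ ⟨j, rfl⟩
      simp [hu])
  have hb0 : ∀ v, b.repr v 0 = inner ℝ u v := fun v => by rw [b.repr_apply_apply, hb 0 rfl]
  let e := MeasurableEquiv.piFinSuccAbove (fun _ : Fin (k + 1) => ℝ) 0
  refine ⟨fun v => Prod.map id (WithLp.toLp 2) (e (WithLp.ofLp (b.repr v))), ?_,
    fun v => ⟨hb0 v, ?_⟩⟩
  · exact ((MeasurePreserving.id _).prod (PiLp.volume_preserving_toLp (Fin k))).comp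
      ((volume_preserving_piFinSuccAbove (fun _ : Fin (k + 1) => ℝ) 0).comp
        ((PiLp.volume_preserving_ofLp (Fin (k + 1))).comp b.measurePreserving_repr))
  · rw [← b.repr.norm_map v, EuclideanSpace.real_norm_sq_eq, EuclideanSpace.real_norm_sq_eq,
      Fin.sum_univ_succ, hb0, add_sub_cancel_left]
    rfl

theorem volume_truncated_cone (hk : Module.finrank ℝ E = k + 1) {u : E} (hu : ‖u‖ = 1) {c h : ℝ}
    (hc0 : 0 < c) (hc1 : c ≤ 1) (hh : 0 ≤ h) :
    volume.real {v : E | inner ℝ u v ∈ Set.Ioo 0 h ∧ c * ‖v‖ ≤ inner ℝ u v} =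
      (√(1 - c ^ 2) / c) ^ k * h ^ (k + 1) / (k + 1) * ballVol k := by
  obtain ⟨Ψ, hΨ, hΨ_apply⟩ := exists_measurePreserving_inner_prod hk hu
  have hτ : 0 ≤ √(1 - c ^ 2) / c := by positivity
  have hpre : {v : E | inner ℝ u v ∈ Set.Ioo 0 h ∧ c * ‖v‖ ≤ inner ℝ u v} =
      Ψ ⁻¹' {z | z.1 ∈ Set.Ioo 0 h ∧ ‖z.2‖ ≤ √(1 - c ^ 2) / c * z.1} := by
    ext v
    simp only [Set.mem_preimage, Set.mem_ofPred_eq, (hΨ_apply v).1]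
    refine and_congr_right fun hv => ?_
    rw [← sq_le_sq₀ (by positivity) hv.1.le, ← sq_le_sq₀ (norm_nonneg _)
      (mul_nonneg hτ hv.1.le), (hΨ_apply v).2, mul_pow, mul_pow, div_pow,
      Real.sq_sqrt (by nlinarith), div_mul_eq_mul_div, le_div_iff₀ (by positivity)]
    constructor <;> intro hle <;> linarith
  have hmeas : MeasurableSet {z : ℝ × EuclideanSpace ℝ (Fin k) |
      z.1 ∈ Set.Ioo 0 h ∧ ‖z.2‖ ≤ √(1 - c ^ 2) / c * z.1} := by
    measurability
  rw [measureReal_def, hpre, hΨ.measure_preimage hmeas.nullMeasurableSet,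
    Measure.volume_eq_prod, prod_addHaar_cone volume hτ hh, finrank_euclideanSpace_fin,
    ENNReal.toReal_mul, ENNReal.toReal_ofReal (by positivity), ballVol, measureReal_def]

theorem toSphere_real_cap (hk : Module.finrank ℝ E = k + 1) (u : Metric.sphere (0 : E) 1)
    (t : ℝ) : (volume : Measure E).toSphere.real (cap u t) = (k + 1) *
      volume.real {v : E | (0 < ‖v‖ ∧ ‖v‖ < 1) ∧ (1 - t) * ‖v‖ ≤ inner ℝ (u : E) v} := by
  rw [measureReal_def, Measure.toSphere_apply' _ (isClosed_cap u t).measurableSet,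
    Ioo_smul_coe_image_cap, hk, ENNReal.toReal_mul, measureReal_def, ENNReal.toReal_natCast,
    Nat.cast_add_one]

theorem le_toSphere_real_cap (hk : Module.finrank ℝ E = k + 1) (u : Metric.sphere (0 : E) 1)
    {t : ℝ} (ht0 : 0 ≤ t) (ht1 : t < 1) :
    ballVol k * √(1 - (1 - t) ^ 2) ^ k * (1 - t) ≤
      (volume : Measure E).toSphere.real (cap u t) := by
  have hc0 : 0 < 1 - t := by linarith
  calc ballVol k * √(1 - (1 - t) ^ 2) ^ k * (1 - t)
      = (k + 1) * volume.real {v : E | inner ℝ (u : E) v ∈ Set.Ioo 0 (1 - t) ∧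
          (1 - t) * ‖v‖ ≤ inner ℝ (u : E) v} := by
        rw [volume_truncated_cone hk (mem_sphere_zero_iff_norm.1 u.2) hc0 (by linarith) hc0.le,
          div_pow]
        field_simp
        ring
    _ ≤ _ := by
        rw [toSphere_real_cap hk]
        refine mul_le_mul_of_nonneg_left (measureReal_mono ?_ ?_) (by positivity)
        · rintro v ⟨⟨hv0, hv1⟩, hv⟩
          exact ⟨⟨hv0.trans_le (inner_coe_sphere_le_norm u v), by nlinarith⟩, hv⟩
        · exact ((measure_mono fun v hv => by simpa using hv.1.2).trans_lt
            (measure_ball_lt_top (x := (0 : E)) (r := 1))).ne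

theorem toSphere_real_cap_le (hk : Module.finrank ℝ E = k + 1) (u : Metric.sphere (0 : E) 1)
    {t : ℝ} (ht0 : 0 ≤ t) (ht1 : t < 1) :
    (volume : Measure E).toSphere.real (cap u t) ≤
      ballVol k * √(1 - (1 - t) ^ 2) ^ k / (1 - t) ^ k := by
  have hc0 : 0 < 1 - t := by linarith
  calc (volume : Measure E).toSphere.real (cap u t)
      ≤ (k + 1) * volume.real {v : E | inner ℝ (u : E) v ∈ Set.Ioo 0 1 ∧
          (1 - t) * ‖v‖ ≤ inner ℝ (u : E) v} := by
        rw [toSphere_real_cap hk]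
        refine mul_le_mul_of_nonneg_left (measureReal_mono ?_ ?_) (by positivity)
        · rintro v ⟨⟨hv0, hv1⟩, hv⟩
          exact ⟨⟨(mul_pos hc0 hv0).trans_le hv, (inner_coe_sphere_le_norm u v).trans_lt hv1⟩, hv⟩
        · refine ((measure_mono fun v hv => ?_).trans_lt
            (measure_ball_lt_top (x := (0 : E)) (r := (1 - t)⁻¹))).ne
          rw [mem_ball_zero_iff, ← one_div, lt_div_iff₀' hc0]
          exact hv.2.trans_lt hv.1.2
    _ = _ := by
        rw [volume_truncated_cone hk (mem_sphere_zero_iff_norm.1 u.2) hc0 (by linarith)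
          zero_le_one, div_pow]
        field_simp
        ring

theorem tendsto_mul_sqrt_pow (hk : k ≠ 0) {t : ℕ → ℝ} (ht0 : ∀ᶠ n in atTop, 0 ≤ t n)
    (ht : Tendsto t atTop (𝓝 0)) {τ : ℝ}
    (hτ : Tendsto (fun n : ℕ => (n : ℝ) ^ (2 / (k : ℝ)) * t n) atTop (𝓝 τ)) :
    Tendsto (fun n : ℕ => (n : ℝ) * √(1 - (1 - t n) ^ 2) ^ k) atTop
      (𝓝 ((2 * τ) ^ ((k : ℝ) / 2))) := by
  have hprod : Tendsto (fun n : ℕ => ((n : ℝ) ^ (2 / (k : ℝ)) * t n) * (2 - t n)) atTop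
      (𝓝 (2 * τ)) := by
    simpa [mul_comm] using hτ.mul (ht.const_sub 2)
  refine (hprod.rpow_const (p := (k : ℝ) / 2) (Or.inr (by positivity))).congr' ?_
  filter_upwards [ht0, ht.eventually_le_const zero_lt_one] with n hn0 hn1
  have hnonneg : 0 ≤ 1 - (1 - t n) ^ 2 := by nlinarith
  have hfactor : (n : ℝ) ^ (2 / (k : ℝ)) * t n * (2 - t n) =
      (n : ℝ) ^ (2 / (k : ℝ)) * (1 - (1 - t n) ^ 2) := by ring
  have hk' : (k : ℝ) ≠ 0 := Nat.cast_ne_zero.2 hk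
  rw [hfactor, Real.mul_rpow (by positivity) hnonneg, ← Real.rpow_mul n.cast_nonneg,
    Real.sqrt_eq_rpow, ← Real.rpow_mul_natCast hnonneg, div_mul_div_cancel₀ hk',
    div_self two_ne_zero, Real.rpow_one, one_div_mul_eq_div]

theorem tendstoUniformly_mul_toSphere_real_cap (hk : Module.finrank ℝ E = k + 1) (hk0 : k ≠ 0)
    {t : ℕ → ℝ} (ht0 : ∀ᶠ n in atTop, 0 ≤ t n) (ht : Tendsto t atTop (𝓝 0)) {τ : ℝ}
    (hτ : Tendsto (fun n : ℕ => (n : ℝ) ^ (2 / (k : ℝ)) * t n) atTop (𝓝 τ)) :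
    TendstoUniformly (fun (n : ℕ) u => n * (volume : Measure E).toSphere.real (cap u (t n)))
      (fun _ => ballVol k * (2 * τ) ^ ((k : ℝ) / 2)) atTop := by
  have hmain := (tendsto_mul_sqrt_pow hk0 ht0 ht hτ).const_mul (ballVol k)
  have hone : Tendsto (fun n => 1 - t n) atTop (𝓝 1) := by simpa using ht.const_sub 1
  have hlower := hmain.mul hone
  have hupper := hmain.div (hone.pow k) (by simp)
  rw [mul_one] at hlower
  rw [one_pow, div_one] at hupper
  refine Metric.tendstoUniformly_iff.2 fun ε hε => ?_
  filter_upwards [ht0, ht.eventually_lt_const zero_lt_one,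
    hlower.eventually (Metric.ball_mem_nhds _ hε),
    hupper.eventually (Metric.ball_mem_nhds _ hε)] with n hn0 hn1 hnlower hnupper u
  rw [Real.dist_eq, abs_lt] at hnlower hnupper ⊢
  have hlo := mul_le_mul_of_nonneg_left (le_toSphere_real_cap hk u hn0 hn1) n.cast_nonneg
  have hhi := mul_le_mul_of_nonneg_left (toSphere_real_cap_le hk u hn0 hn1) n.cast_nonneg
  simp only [Pi.div_apply] at hnupper
  rw [← mul_assoc, mul_left_comm] at hlo
  rw [← mul_div_assoc, mul_left_comm] at hhi
  constructor <;> linarith [hnlower.1, hnupper.2]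

theorem toSphere_real_cap_le_rpow (hk : Module.finrank ℝ E = k + 1)
    (u : Metric.sphere (0 : E) 1) {t : ℝ} (ht0 : 0 ≤ t) (ht1 : t ≤ 1 / 2) :
    (volume : Measure E).toSphere.real (cap u t) ≤
      ballVol k * 2 ^ k * (2 * t) ^ ((k : ℝ) / 2) := by
  have hκ := ballVol_pos k
  have hsqrt : √(1 - (1 - t) ^ 2) ^ k ≤ (2 * t) ^ ((k : ℝ) / 2) := by
    rw [show (k : ℝ) / 2 = (1 / 2) * (k : ℕ) by ring, Real.rpow_mul_natCast (by positivity),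
      ← Real.sqrt_eq_rpow]
    gcongr
    nlinarith
  calc _ ≤ ballVol k * √(1 - (1 - t) ^ 2) ^ k / (1 - t) ^ k :=
        toSphere_real_cap_le hk u ht0 (by linarith)
    _ ≤ ballVol k * (2 * t) ^ ((k : ℝ) / 2) / (1 / 2) ^ k := by
        gcongr
        linarith
    _ = _ := by
        rw [one_div, inv_pow, div_inv_eq_mul]
        ring

end Cap

theorem abs_withDensity_real_sub_le {α : Type*} [MeasurableSpace α] {σ : Measure α}
    [IsFiniteMeasure σ] {ρ : α → ℝ≥0} (hρ : Measurable ρ) {B : Set α} (hB : MeasurableSet B)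
    {a ε : ℝ} (h : ∀ x ∈ B, |(ρ x : ℝ) - a| ≤ ε) :
    |(σ.withDensity fun x => (ρ x : ℝ≥0∞)).real B - a * σ.real B| ≤ ε * σ.real B := by
  have hm : Measurable fun x => (ρ x : ℝ) := hρ.coe_nnreal_real
  have hreal : (σ.withDensity fun x => (ρ x : ℝ≥0∞)).real B = ∫ x in B, (ρ x : ℝ) ∂σ := by
    rw [measureReal_def, withDensity_apply _ hB,
      integral_eq_lintegral_of_nonneg_ae (ae_of_all _ fun x => (ρ x).coe_nonneg)
        hm.aestronglyMeasurable]
    simp_rw [ENNReal.ofReal_coe_nnreal]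
  have hint : IntegrableOn (fun x => (ρ x : ℝ)) B σ := by
    refine Measure.integrableOn_of_bounded (M := |a| + ε) (measure_ne_top _ _)
      hm.aestronglyMeasurable ((ae_restrict_iff' hB).2 (ae_of_all _ fun x hx => ?_))
    rw [Real.norm_eq_abs]
    linarith [h x hx, abs_sub_abs_le_abs_sub (ρ x : ℝ) a]
  have hsub : ∫ x in B, (ρ x : ℝ) ∂σ - a * σ.real B = ∫ x in B, ((ρ x : ℝ) - a) ∂σ := by
    rw [integral_sub hint (integrable_const _), setIntegral_const, smul_eq_mul, mul_comm a]
  rw [hreal, hsub, ← Real.norm_eq_abs]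
  exact norm_setIntegral_le_of_norm_le_const (measure_lt_top _ _) h

/-! ### Products of `m`-dependent factors close to one -/

theorem norm_prod_range_sub_prod_range_le {x : ℕ → ℂ} (hx : ∀ i, ‖1 + x i‖ ≤ 1) {l j : ℕ}
    (hlj : l ≤ j) :
    ‖∏ i ∈ Finset.range j, (1 + x i) - ∏ i ∈ Finset.range l, (1 + x i)‖ ≤
      ∑ i ∈ Finset.Ico l j, ‖x i‖ := by
  induction j, hlj using Nat.le_induction with
  | base => simp
  | succ j hj ih =>
    have hprod : ‖∏ i ∈ Finset.range j, (1 + x i)‖ ≤ 1 := by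
      rw [norm_prod]
      exact Finset.prod_le_one (fun _ _ => norm_nonneg _) fun i _ => hx i
    rw [Finset.prod_range_succ, Finset.sum_Ico_succ_top hj]
    calc _ = ‖(∏ i ∈ Finset.range j, (1 + x i) - ∏ i ∈ Finset.range l, (1 + x i)) +
          (∏ i ∈ Finset.range j, (1 + x i)) * x j‖ := by ring_nf
      _ ≤ _ := norm_add_le_of_le ih (by
        rw [norm_mul]
        exact mul_le_of_le_one_left (norm_nonneg _) hprod)

theorem norm_prod_one_add_sub_exp_sum_le {e : ℕ → ℂ} {n : ℕ} (he : ∀ i < n, ‖1 + e i‖ ≤ 1)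
    (he1 : ∀ i < n, ‖e i‖ ≤ 1) :
    ‖∏ i ∈ Finset.range n, (1 + e i) - Complex.exp (∑ i ∈ Finset.range n, e i)‖ ≤
      ∑ i ∈ Finset.range n, ‖e i‖ ^ 2 := by
  induction n with
  | zero => simp
  | succ n ih =>
    have hexp : ‖Complex.exp (∑ i ∈ Finset.range n, e i)‖ ≤ 1 := by
      rw [Complex.norm_exp, Real.exp_le_one_iff, Complex.re_sum]
      refine Finset.sum_nonpos fun i hi => ?_
      simpa using (Complex.re_le_norm (1 + e i)).trans
        (he i ((Finset.mem_range.1 hi).trans n.lt_succ_self))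
    rw [Finset.prod_range_succ, Finset.sum_range_succ, Finset.sum_range_succ, Complex.exp_add]
    calc _ = ‖(∏ i ∈ Finset.range n, (1 + e i) - Complex.exp (∑ i ∈ Finset.range n, e i)) *
            (1 + e n) -
          Complex.exp (∑ i ∈ Finset.range n, e i) * (Complex.exp (e n) - 1 - e n)‖ := by ring_nf
      _ ≤ ‖∏ i ∈ Finset.range n, (1 + e i) - Complex.exp (∑ i ∈ Finset.range n, e i)‖ +
          ‖Complex.exp (e n) - 1 - e n‖ := by
        refine norm_sub_le_of_le ?_ ?_ <;> rw [norm_mul]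
        · exact mul_le_of_le_one_right (norm_nonneg _) (he n n.lt_succ_self)
        · exact mul_le_of_le_one_left (norm_nonneg _) hexp
      _ ≤ _ := add_le_add
        (ih (fun i hi => he i (hi.trans n.lt_succ_self)) fun i hi =>
          he1 i (hi.trans n.lt_succ_self))
        (Complex.norm_exp_sub_one_sub_id_le (he1 n n.lt_succ_self))

theorem norm_le_two_of_norm_one_add_le_one {z : ℂ} (hz : ‖1 + z‖ ≤ 1) : ‖z‖ ≤ 2 := by
  simpa [one_add_one_eq_two] using norm_sub_le_of_le hz (norm_one (α := ℂ)).le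

section WeakDependence

variable {Ω : Type*} [MeasurableSpace Ω] {P : Measure Ω}

theorem integral_mul_one_add_sub_of_indepFun {Q R Y : Ω → ℂ} (hQ : Integrable Q P)
    (hR : Integrable R P) (hY : Integrable Y P) (hQY : Integrable (fun ω => Q ω * Y ω) P)
    (hRY : IndepFun R Y P) :
    ∫ ω, Q ω * (1 + Y ω) ∂P - (∫ ω, Q ω ∂P) * (1 + ∫ ω, Y ω ∂P) =
      ∫ ω, (Q ω - R ω) * Y ω ∂P - (∫ ω, (Q ω - R ω) ∂P) * ∫ ω, Y ω ∂P := by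
  simp_rw [mul_add, mul_one, sub_mul]
  have hRY_int : Integrable (fun ω => R ω * Y ω) P := hRY.integrable_mul hR hY
  rw [integral_add hQ hQY, integral_sub hQY hRY_int, integral_sub hQ hR,
    hRY.integral_fun_mul_eq_mul_integral hR.aestronglyMeasurable hY.aestronglyMeasurable]
  ring

variable [IsProbabilityMeasure P]

theorem integrable_of_norm_one_add_le_one {Y : Ω → ℂ} (hY : Measurable Y)
    (hY1 : ∀ ω, ‖1 + Y ω‖ ≤ 1) : Integrable Y P :=
  .of_bound hY.aestronglyMeasurable 2
    (ae_of_all _ fun ω => norm_le_two_of_norm_one_add_le_one (hY1 ω))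

theorem norm_one_add_integral_le_one {Y : Ω → ℂ} (hY : Measurable Y)
    (hY1 : ∀ ω, ‖1 + Y ω‖ ≤ 1) : ‖1 + ∫ ω, Y ω ∂P‖ ≤ 1 := by
  have hadd : 1 + ∫ ω, Y ω ∂P = ∫ ω, (1 + Y ω) ∂P := by
    rw [integral_add (integrable_const _) (integrable_of_norm_one_add_le_one hY hY1)]
    simp
  simpa [hadd] using norm_integral_le_of_norm_le_const (μ := P) (ae_of_all _ hY1)

variable {X : ℕ → Ω → ℂ} {m n : ℕ}

-- The factor `1 + X j` is decoupled from the first `j - m` factors; the `m` factors in between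
-- differ from one by at most `∑ ‖X i‖`.
theorem norm_integral_prod_succ_sub_le (hX : ∀ i, Measurable (X i)) (hX1 : ∀ i ω, ‖1 + X i ω‖ ≤ 1)
    {j : ℕ} (hind : IndepFun (fun ω => ∏ i ∈ Finset.range (j - m), (1 + X i ω)) (X j) P) :
    ‖∫ ω, ∏ i ∈ Finset.range (j + 1), (1 + X i ω) ∂P -
        (∫ ω, ∏ i ∈ Finset.range j, (1 + X i ω) ∂P) * (1 + ∫ ω, X j ω ∂P)‖ ≤
      ∑ i ∈ Finset.Ico (j - m) j,
        (∫ ω, ‖X i ω‖ * ‖X j ω‖ ∂P + (∫ ω, ‖X i ω‖ ∂P) * ∫ ω, ‖X j ω‖ ∂P) := by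
  let Q : ℕ → Ω → ℂ := fun j ω => ∏ i ∈ Finset.range j, (1 + X i ω)
  have hQ : ∀ j, Measurable (Q j) := fun j => by fun_prop
  have hQ1 : ∀ j ω, ‖Q j ω‖ ≤ 1 := fun j ω => by
    rw [norm_prod]
    exact Finset.prod_le_one (fun _ _ => norm_nonneg _) fun i _ => hX1 i ω
  have hQ_int : ∀ j, Integrable (Q j) P := fun j =>
    .of_bound (hQ j).aestronglyMeasurable 1 (ae_of_all _ (hQ1 j))
  have hX_int : ∀ j, Integrable (X j) P := fun j =>
    integrable_of_norm_one_add_le_one (hX j) (hX1 j)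
  have hXX_int : ∀ i, Integrable (fun ω => ‖X i ω‖ * ‖X j ω‖) P := fun i =>
    (hX_int j).norm.bdd_mul (c := 2) (by fun_prop) (ae_of_all _ fun ω => by
      simpa using norm_le_two_of_norm_one_add_le_one (hX1 i ω))
  have hQX_int : ∀ i, Integrable (fun ω => Q i ω * X j ω) P := fun i =>
    (hX_int j).bdd_mul (hQ i).aestronglyMeasurable (ae_of_all _ (hQ1 i))
  have hnear : ∀ ω, ‖Q j ω - Q (j - m) ω‖ ≤ ∑ i ∈ Finset.Ico (j - m) j, ‖X i ω‖ := fun ω =>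
    norm_prod_range_sub_prod_range_le (fun i => hX1 i ω) (j.sub_le m)
  simp_rw [Finset.prod_range_succ]
  rw [integral_mul_one_add_sub_of_indepFun (hQ_int j) (hQ_int (j - m)) (hX_int j) (hQX_int j) hind,
    Finset.sum_add_distrib, ← Finset.sum_mul,
    ← integral_finsetSum _ fun i _ => hXX_int i,
    ← integral_finsetSum _ fun i _ => (hX_int i).norm]
  refine norm_sub_le_of_le ?_ ?_
  · refine norm_integral_le_of_norm_le (integrable_finsetSum _ fun i _ => hXX_int i)
      (ae_of_all _ fun ω => ?_)
    rw [norm_mul, ← Finset.sum_mul]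
    exact mul_le_mul_of_nonneg_right (hnear ω) (norm_nonneg _)
  · rw [norm_mul]
    gcongr
    · exact norm_integral_le_of_norm_le (integrable_finsetSum _ fun i _ => (hX_int i).norm)
        (ae_of_all _ hnear)
    · exact norm_integral_le_integral_norm _

theorem norm_integral_prod_sub_prod_le (hX : ∀ i, Measurable (X i))
    (hX1 : ∀ i ω, ‖1 + X i ω‖ ≤ 1)
    (hind : ∀ j < n, IndepFun (fun ω => ∏ i ∈ Finset.range (j - m), (1 + X i ω)) (X j) P) :
    ‖∫ ω, ∏ i ∈ Finset.range n, (1 + X i ω) ∂P - ∏ i ∈ Finset.range n, (1 + ∫ ω, X i ω ∂P)‖ ≤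
      ∑ j ∈ Finset.range n, ∑ i ∈ Finset.Ico (j - m) j,
        (∫ ω, ‖X i ω‖ * ‖X j ω‖ ∂P + (∫ ω, ‖X i ω‖ ∂P) * ∫ ω, ‖X j ω‖ ∂P) := by
  induction n with
  | zero => simp
  | succ n ih =>
    rw [Finset.prod_range_succ (fun i => 1 + ∫ ω, X i ω ∂P), Finset.sum_range_succ]
    calc _ = ‖(∫ ω, ∏ i ∈ Finset.range (n + 1), (1 + X i ω) ∂P -
            (∫ ω, ∏ i ∈ Finset.range n, (1 + X i ω) ∂P) * (1 + ∫ ω, X n ω ∂P)) +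
          (∫ ω, ∏ i ∈ Finset.range n, (1 + X i ω) ∂P -
            ∏ i ∈ Finset.range n, (1 + ∫ ω, X i ω ∂P)) * (1 + ∫ ω, X n ω ∂P)‖ := by ring_nf
      _ ≤ _ := (norm_add_le_of_le
        (norm_integral_prod_succ_sub_le hX hX1 (hind n n.lt_succ_self)) (by
          rw [norm_mul]
          exact (mul_le_of_le_one_right (norm_nonneg _)
            (norm_one_add_integral_le_one (hX n) (hX1 n))).trans
              (ih fun j hj => hind j (hj.trans n.lt_succ_self)))).trans_eq (add_comm _ _)

theorem norm_integral_prod_sub_prod_le_of_le (hX : ∀ i, Measurable (X i))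
    (hX1 : ∀ i ω, ‖1 + X i ω‖ ≤ 1)
    (hind : ∀ j < n, IndepFun (fun ω => ∏ i ∈ Finset.range (j - m), (1 + X i ω)) (X j) P)
    {δ η : ℝ} (hδ : ∀ i < n, ∫ ω, ‖X i ω‖ ∂P ≤ δ)
    (hη : ∀ i j, i < j → j ≤ i + m → j < n → ∫ ω, ‖X i ω‖ * ‖X j ω‖ ∂P ≤ η) (hη0 : 0 ≤ η) :
    ‖∫ ω, ∏ i ∈ Finset.range n, (1 + X i ω) ∂P - ∏ i ∈ Finset.range n, (1 + ∫ ω, X i ω ∂P)‖ ≤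
      n * (m * (η + δ ^ 2)) := by
  refine (norm_integral_prod_sub_prod_le hX hX1 hind).trans ?_
  refine (Finset.sum_le_card_nsmul _ _ (m * (η + δ ^ 2)) fun j hj => ?_).trans (by simp)
  rw [Finset.mem_range] at hj
  have hterm : ∀ i ∈ Finset.Ico (j - m) j,
      ∫ ω, ‖X i ω‖ * ‖X j ω‖ ∂P + (∫ ω, ‖X i ω‖ ∂P) * ∫ ω, ‖X j ω‖ ∂P ≤ η + δ ^ 2 := by
    intro i hi
    rw [Finset.mem_Ico] at hi
    have hi_nonneg : 0 ≤ ∫ ω, ‖X i ω‖ ∂P := integral_nonneg fun _ => norm_nonneg _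
    have hj_nonneg : 0 ≤ ∫ ω, ‖X j ω‖ ∂P := integral_nonneg fun _ => norm_nonneg _
    rw [sq]
    exact add_le_add (hη i j hi.2 (by omega) hj) (mul_le_mul (hδ i (hi.2.trans hj)) (hδ j hj)
      hj_nonneg (hi_nonneg.trans (hδ i (hi.2.trans hj))))
  refine (Finset.sum_le_card_nsmul _ _ _ hterm).trans ?_
  rw [nsmul_eq_mul, Nat.card_Ico]
  gcongr
  omega

end WeakDependence

theorem tendsto_integral_prod_exp {Ω : Type*} [MeasurableSpace Ω] {P : Measure Ω}
    [IsProbabilityMeasure P] {X : ℕ → ℕ → Ω → ℂ} (hX : ∀ n i, Measurable (X n i))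
    (hX1 : ∀ n i ω, ‖1 + X n i ω‖ ≤ 1) {m : ℕ}
    (hind : ∀ n, ∀ j < n,
      IndepFun (fun ω => ∏ i ∈ Finset.range (j - m), (1 + X n i ω)) (X n j) P)
    {C : ℝ} (hC0 : 0 ≤ C) (hC : ∀ᶠ n : ℕ in atTop, ∀ i < n, ∫ ω, ‖X n i ω‖ ∂P ≤ C / n)
    (hCC : ∀ᶠ n : ℕ in atTop, ∀ i j, i < j → j ≤ i + m → j < n →
      ∫ ω, ‖X n i ω‖ * ‖X n j ω‖ ∂P ≤ C / n ^ 2)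
    {z : ℂ} (hz : Tendsto (fun n => ∑ i ∈ Finset.range n, ∫ ω, X n i ω ∂P) atTop (𝓝 z)) :
    Tendsto (fun n => ∫ ω, ∏ i ∈ Finset.range n, (1 + X n i ω) ∂P) atTop
      (𝓝 (Complex.exp z)) := by
  have hlim : Tendsto (fun n : ℕ => (m * (C + C ^ 2) + C ^ 2) / (n : ℝ)) atTop (𝓝 0) :=
    tendsto_const_div_atTop_nhds_zero_nat _
  have hCn : Tendsto (fun n : ℕ => C / (n : ℝ)) atTop (𝓝 0) :=
    tendsto_const_div_atTop_nhds_zero_nat _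
  refine (tendsto_iff_of_dist (squeeze_zero' (Eventually.of_forall fun _ => dist_nonneg) ?_
    hlim)).1 ((Complex.continuous_exp.tendsto z).comp hz)
  filter_upwards [hC, hCC, eventually_ne_atTop 0, hCn.eventually_le_const zero_lt_one]
    with n hCn hCCn hn hn1
  have hmean : ∀ i < n, ‖∫ ω, X n i ω ∂P‖ ≤ C / n := fun i hi =>
    (norm_integral_le_integral_norm _).trans (hCn i hi)
  have hprod := norm_integral_prod_sub_prod_le_of_le (hX n) (hX1 n) (hind n) hCn hCCn
    (by positivity)
  have hexp := norm_prod_one_add_sub_exp_sum_le (e := fun i => ∫ ω, X n i ω ∂P) (n := n)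
    (fun i _ => norm_one_add_integral_le_one (hX n i) (hX1 n i))
    fun i hi => (hmean i hi).trans hn1
  have hsq : ∑ i ∈ Finset.range n, ‖∫ ω, X n i ω ∂P‖ ^ 2 ≤ n * (C / n) ^ 2 := by
    refine (Finset.sum_le_card_nsmul _ _ ((C / n) ^ 2) fun i hi => ?_).trans (by simp)
    gcongr
    exact hmean i (Finset.mem_range.1 hi)
  rw [dist_comm, dist_eq_norm]
  calc _ ≤ n * (m * (C / n ^ 2 + (C / n) ^ 2)) + n * (C / n) ^ 2 :=
        (norm_sub_le_norm_sub_add_norm_sub _ (∏ i ∈ Finset.range n, (1 + ∫ ω, X n i ω ∂P)) _).trans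
          (add_le_add hprod (hexp.trans hsq))
    _ = _ := by
        field_simp

/-! ### Discretization of weights -/

/-- The grid cell `((c - 1) / r, c / r]`, which is `{0}` for `c = 0`. -/
def cell (r c : ℕ) : Set ℝ≥0 := {y | ⌈(r : ℝ≥0) * y⌉₊ = c}

theorem measurableSet_cell (r c : ℕ) : MeasurableSet (cell r c) :=
  (Nat.measurable_ceil.comp (measurable_const.mul measurable_id)) (measurableSet_singleton c)

theorem ceil_mul_le_iff {r : ℕ} (hr : 0 < r) (y : ℝ≥0) (c : ℕ) :
    ⌈(r : ℝ≥0) * y⌉₊ ≤ c ↔ y ≤ c / r := by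
  rw [Nat.ceil_le, le_div_iff₀' (by exact_mod_cast hr)]

theorem pairwise_disjoint_cell (r : ℕ) : Pairwise (Function.onFun Disjoint (cell r)) :=
  fun _ _ hcd => Set.disjoint_left.2 fun _ hy hy' => hcd (hy.symm.trans hy')

theorem biUnion_cell {r : ℕ} (hr : 0 < r) (c : ℕ) :
    ⋃ c' ∈ Finset.range (c + 1), cell r c' = Set.Iic ((c : ℝ≥0) / r) := by
  ext y
  simp only [Set.mem_iUnion, Finset.mem_range, exists_prop, Set.mem_Iic, ← ceil_mul_le_iff hr]
  exact ⟨fun ⟨c', h, hy⟩ => by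
    have : ⌈(r : ℝ≥0) * y⌉₊ = c' := hy
    omega, fun h => ⟨_, by omega, rfl⟩⟩

theorem cell_subset_Iic {r : ℕ} (hr : 0 < r) (c : ℕ) : cell r c ⊆ Set.Iic ((c : ℝ≥0) / r) :=
  fun y hy => (ceil_mul_le_iff hr y c).1 (le_of_eq hy)

theorem exp_le_of_mem_cell {r c : ℕ} (hr : 0 < r) {y : ℝ≥0} (hy : y ∈ cell r c) :
    Real.exp (-(c / r : ℝ)) ≤ Real.exp (-(y : ℝ)) := by
  have hy_le : (y : ℝ) ≤ c / r := by exact_mod_cast cell_subset_Iic hr c hy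
  exact Real.exp_le_exp.2 (neg_le_neg hy_le)

theorem exp_le_mul_of_mem_cell {r c : ℕ} (hr : 0 < r) {y : ℝ≥0} (hy : y ∈ cell r c) :
    Real.exp (-(y : ℝ)) ≤ Real.exp (1 / r) * Real.exp (-(c / r : ℝ)) := by
  have hceil : ⌈(r : ℝ≥0) * y⌉₊ = c := hy
  have hlt : (c : ℝ) < r * y + 1 := by
    exact_mod_cast hceil ▸ Nat.ceil_lt_add_one (zero_le : 0 ≤ r * y)
  rw [← Real.exp_add, Real.exp_le_exp, ← sub_eq_add_neg, ← sub_div, le_div_iff₀ (by positivity)]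
  linarith

theorem sum_real_cell {r : ℕ} (hr : 0 < r) {μ : Measure ℝ≥0} (hμ : ∀ y, μ (Set.Iic y) ≠ ∞)
    (c : ℕ) : ∑ c' ∈ Finset.range (c + 1), μ.real (cell r c') =
      μ.real (Set.Iic ((c : ℝ≥0) / r)) := by
  rw [← biUnion_cell hr, measureReal_biUnion_finset
    (fun _ _ _ _ h => pairwise_disjoint_cell r h) (fun _ _ => measurableSet_cell r _)
    (fun c' _ => ((measure_mono (cell_subset_Iic hr c')).trans_lt (hμ _).lt_top).ne)]

/-- The vector of cell counts on the grid of mesh `1 / r` of `[0, r]`. -/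
def counts (r : ℕ) (μ : Measure ℝ≥0) : EuclideanSpace ℝ (Fin (r ^ 2 + 1)) :=
  WithLp.toLp 2 fun c => μ.real (cell r c)

theorem measurable_counts (r : ℕ) : Measurable (counts r) :=
  (PiLp.continuous_toLp 2 _).measurable.comp (measurable_pi_lambda _ fun c =>
    (Measure.measurable_coe (measurableSet_cell r c)).ennreal_toReal)

/-- The exponential weight of the `j`-th arrival, read off from cell counts. -/
def gridExp (r j : ℕ) (v : EuclideanSpace ℝ (Fin (r ^ 2 + 1))) : ℝ :=
  ⨆ c, if (j : ℝ) + 1 ≤ ∑ c' ∈ Finset.Iic c, v c' then Real.exp (-((c : ℕ) / r : ℝ)) else 0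

/-- The sum of the exponential weights, read off from cell counts. -/
def gridSum (r : ℕ) (v : EuclideanSpace ℝ (Fin (r ^ 2 + 1))) : ℝ :=
  ∑ c, v c * Real.exp (-((c : ℕ) / r : ℝ))

/-- The leading normalized weights, read off from cell counts. -/
def gridWeight (r k : ℕ) (v : EuclideanSpace ℝ (Fin (r ^ 2 + 1))) : Fin k → ℝ :=
  fun j => gridExp r j v / gridSum r v

theorem measurable_gridWeight (r k : ℕ) : Measurable (gridWeight r k) := by
  refine measurable_pi_lambda _ fun j => Measurable.div (Measurable.iSup fun c => ?_) ?_
  · refine Measurable.ite (measurableSet_le measurable_const ?_) measurable_const measurable_const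
    fun_prop
  · unfold gridSum
    fun_prop

theorem sum_Iic_counts {r : ℕ} (hr : 0 < r) {μ : Measure ℝ≥0} (hμ : ∀ y, μ (Set.Iic y) ≠ ∞)
    (c : Fin (r ^ 2 + 1)) :
    ∑ c' ∈ Finset.Iic c, counts r μ c' = μ.real (Set.Iic (((c : ℕ) : ℝ≥0) / r)) := by
  rw [← sum_real_cell hr hμ, Nat.range_succ_eq_Iic, ← Fin.map_valEmbedding_Iic, Finset.sum_map]
  rfl

section Deterministic

variable {μ : Measure ℝ≥0}

/-- The total exponential mass. -/
def expMass (μ : Measure ℝ≥0) : ℝ≥0∞ := ∫⁻ y, ENNReal.ofReal (Real.exp (-(y : ℝ))) ∂μ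

/-- The exponential mass beyond `r`. -/
def expTail (r : ℕ) (μ : Measure ℝ≥0) : ℝ≥0∞ :=
  ∫⁻ y in Set.Ioi (r : ℝ≥0), ENNReal.ofReal (Real.exp (-(y : ℝ))) ∂μ

theorem exp_neg_le_expMass {y : ℝ≥0} (hy : 1 ≤ μ (Set.Iic y)) :
    ENNReal.ofReal (Real.exp (-(y : ℝ))) ≤ expMass μ := by
  calc _ ≤ ENNReal.ofReal (Real.exp (-(y : ℝ))) * μ (Set.Iic y) := le_mul_of_one_le_right' hy
    _ = ∫⁻ _ in Set.Iic y, ENNReal.ofReal (Real.exp (-(y : ℝ))) ∂μ := by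
        rw [setLIntegral_const]
    _ ≤ ∫⁻ z in Set.Iic y, ENNReal.ofReal (Real.exp (-(z : ℝ))) ∂μ :=
        setLIntegral_mono' measurableSet_Iic fun z hz => by
          have : (z : ℝ) ≤ y := hz
          gcongr
    _ ≤ _ := setLIntegral_le_lintegral _ _

theorem expTail_le_tsum (r : ℕ) (μ : Measure ℝ≥0) :
    expTail r μ ≤ ∑' i : ℕ, ENNReal.ofReal (Real.exp (-((i + r : ℕ) : ℝ))) *
      μ (Set.Iic (((i + r : ℕ) : ℝ≥0) + 1)) := by
  have hcov : Set.Ioi (r : ℝ≥0) ⊆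
      ⋃ i : ℕ, Set.Icc ((i + r : ℕ) : ℝ≥0) (((i + r : ℕ) : ℝ≥0) + 1) := by
    intro y hy
    refine Set.mem_iUnion.2 ⟨⌊y⌋₊ - r, ?_⟩
    rw [Nat.sub_add_cancel (Nat.le_floor (le_of_lt hy))]
    exact ⟨Nat.floor_le (by positivity), (Nat.lt_floor_add_one y).le⟩
  calc expTail r μ ≤ ∫⁻ y in ⋃ i : ℕ, Set.Icc ((i + r : ℕ) : ℝ≥0) (((i + r : ℕ) : ℝ≥0) + 1),
        ENNReal.ofReal (Real.exp (-(y : ℝ))) ∂μ := lintegral_mono_set hcov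
    _ ≤ ∑' i : ℕ, ∫⁻ y in Set.Icc ((i + r : ℕ) : ℝ≥0) (((i + r : ℕ) : ℝ≥0) + 1),
        ENNReal.ofReal (Real.exp (-(y : ℝ))) ∂μ := lintegral_iUnion_le _ _
    _ ≤ _ := ENNReal.tsum_le_tsum fun i => by
        calc _ ≤ ∫⁻ _ in Set.Icc ((i + r : ℕ) : ℝ≥0) (((i + r : ℕ) : ℝ≥0) + 1),
              ENNReal.ofReal (Real.exp (-((i + r : ℕ) : ℝ))) ∂μ :=
              setLIntegral_mono' measurableSet_Icc fun y hy => by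
                have : ((i + r : ℕ) : ℝ) ≤ y := by exact_mod_cast hy.1
                gcongr
          _ ≤ _ := by
            rw [setLIntegral_const]
            gcongr
            exact Set.Icc_subset_Iic_self

theorem ofReal_gridSum (hμ : ∀ y, μ (Set.Iic y) ≠ ∞) {r : ℕ} (hr : 0 < r) :
    ENNReal.ofReal (gridSum r (counts r μ)) =
      ∑ c ∈ Finset.range (r ^ 2 + 1),
        ENNReal.ofReal (Real.exp (-(c / r : ℝ))) * μ (cell r c) := by
  rw [gridSum, ENNReal.ofReal_sum_of_nonneg
    fun c _ => mul_nonneg (show 0 ≤ counts r μ c from measureReal_nonneg) (Real.exp_pos _).le,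
    ← Fin.sum_univ_eq_sum_range (fun c : ℕ =>
      ENNReal.ofReal (Real.exp (-(c / r : ℝ))) * μ (cell r c))]
  refine Finset.sum_congr rfl fun c _ => ?_
  rw [mul_comm, ENNReal.ofReal_mul (Real.exp_pos _).le]
  congr 1
  exact ofReal_measureReal ((measure_mono (cell_subset_Iic hr c)).trans_lt (hμ _).lt_top).ne

theorem setLIntegral_grid {r : ℕ} (hr : 0 < r) (f : ℝ≥0 → ℝ≥0∞) :
    ∫⁻ y in Set.Iic (r : ℝ≥0), f y ∂μ =
      ∑ c ∈ Finset.range (r ^ 2 + 1), ∫⁻ y in cell r c, f y ∂μ := by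
  have hIic : Set.Iic (r : ℝ≥0) = ⋃ c ∈ Finset.range (r ^ 2 + 1), cell r c := by
    rw [biUnion_cell hr]
    congr 1
    push_cast
    field_simp
  rw [hIic, lintegral_biUnion_finset (fun _ _ _ _ h => pairwise_disjoint_cell r h)
    (fun _ _ => measurableSet_cell r _)]

theorem gridSum_le_expMass (hμ : ∀ y, μ (Set.Iic y) ≠ ∞) {r : ℕ} (hr : 0 < r) :
    ENNReal.ofReal (gridSum r (counts r μ)) ≤ expMass μ := by
  rw [ofReal_gridSum hμ hr]
  calc _ ≤ ∑ c ∈ Finset.range (r ^ 2 + 1),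
        ∫⁻ y in cell r c, ENNReal.ofReal (Real.exp (-(y : ℝ))) ∂μ :=
        Finset.sum_le_sum fun c _ => by
          rw [← setLIntegral_const]
          exact setLIntegral_mono' (measurableSet_cell r c) fun y hy =>
            ENNReal.ofReal_le_ofReal (exp_le_of_mem_cell hr hy)
    _ ≤ _ := by
      rw [← setLIntegral_grid hr]
      exact setLIntegral_le_lintegral _ _

theorem expMass_le (hμ : ∀ y, μ (Set.Iic y) ≠ ∞) {r : ℕ} (hr : 0 < r) :
    expMass μ ≤ ENNReal.ofReal (Real.exp (1 / r) * gridSum r (counts r μ)) + expTail r μ := by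
  rw [ENNReal.ofReal_mul (Real.exp_pos _).le, ofReal_gridSum hμ hr, Finset.mul_sum]
  rw [expMass, expTail, ← lintegral_add_compl _ (measurableSet_Iic (a := (r : ℝ≥0))),
    Set.compl_Iic, setLIntegral_grid hr]
  refine add_le_add (Finset.sum_le_sum fun c _ => ?_) le_rfl
  rw [← mul_assoc, ← ENNReal.ofReal_mul (Real.exp_pos _).le, ← setLIntegral_const]
  exact setLIntegral_mono' (measurableSet_cell r c) fun y hy =>
    ENNReal.ofReal_le_ofReal (exp_le_mul_of_mem_cell hr hy)

theorem natCast_add_one_le_real_iff (hμ : ∀ y, μ (Set.Iic y) ≠ ∞) {y : ℝ≥0} {j : ℕ} :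
    (j : ℝ) + 1 ≤ μ.real (Set.Iic y) ↔ (j : ℝ≥0∞) + 1 ≤ μ (Set.Iic y) := by
  rw [measureReal_def, ← ENNReal.ofReal_le_iff_le_toReal (hμ y),
    ENNReal.ofReal_add (by positivity) zero_le_one]
  simp

theorem gridExp_nonneg (r j : ℕ) (v : EuclideanSpace ℝ (Fin (r ^ 2 + 1))) : 0 ≤ gridExp r j v :=
  Real.iSup_nonneg fun c => by
    split_ifs
    · exact (Real.exp_pos _).le
    · exact le_rfl

theorem gridSum_nonneg (r : ℕ) (μ : Measure ℝ≥0) : 0 ≤ gridSum r (counts r μ) :=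
  Finset.sum_nonneg fun _ _ => mul_nonneg measureReal_nonneg (Real.exp_pos _).le

theorem gridExp_le_gridSum (r j : ℕ) (μ : Measure ℝ≥0) :
    gridExp r j (counts r μ) ≤ gridSum r (counts r μ) := by
  refine ciSup_le fun c => ?_
  split_ifs with h
  · have hnn : ∀ c, 0 ≤ counts r μ c := fun c => measureReal_nonneg
    calc Real.exp (-((c : ℕ) / r : ℝ))
        ≤ (∑ c' ∈ Finset.Iic c, counts r μ c') * Real.exp (-((c : ℕ) / r : ℝ)) := by
          refine le_mul_of_one_le_left (Real.exp_pos _).le (le_trans ?_ h)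
          linarith [(Nat.cast_nonneg j : (0 : ℝ) ≤ j)]
      _ ≤ ∑ c' ∈ Finset.Iic c, counts r μ c' * Real.exp (-((c' : ℕ) / r : ℝ)) := by
          rw [Finset.sum_mul]
          refine Finset.sum_le_sum fun c' hc' => ?_
          have hc : ((c' : ℕ) : ℝ) ≤ (c : ℕ) := by exact_mod_cast Finset.mem_Iic.1 hc'
          have := hnn c'
          gcongr
      _ ≤ _ := Finset.sum_le_sum_of_subset_of_nonneg (Finset.subset_univ _)
          fun c' _ _ => mul_nonneg (hnn c') (Real.exp_pos _).le
  · exact gridSum_nonneg r μ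

/-- The `j`-th arrival of a counting measure, with arrivals numbered from zero and multiple atoms
repeated. -/
def IsArrival (μ : Measure ℝ≥0) (j : ℕ) (a : ℝ≥0) : Prop :=
  ∀ y, (j : ℝ≥0∞) + 1 ≤ μ (Set.Iic y) ↔ a ≤ y

theorem gridExp_le_exp (hμ : ∀ y, μ (Set.Iic y) ≠ ∞) {j : ℕ} {a : ℝ≥0} (ha : IsArrival μ j a)
    {r : ℕ} (hr : 0 < r) :
    gridExp r j (counts r μ) ≤ Real.exp (-(a : ℝ)) := by
  refine ciSup_le fun c => ?_
  split_ifs with h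
  · rw [sum_Iic_counts hr hμ, natCast_add_one_le_real_iff hμ, ha _] at h
    have h' : (a : ℝ) ≤ (c : ℕ) / r := by exact_mod_cast h
    exact Real.exp_le_exp.2 (neg_le_neg h')
  · exact (Real.exp_pos _).le

theorem exp_le_gridExp (hμ : ∀ y, μ (Set.Iic y) ≠ ∞) {j : ℕ} {a : ℝ≥0} (ha : IsArrival μ j a)
    {r : ℕ} (hr : 0 < r) :
    Real.exp (-(a : ℝ)) ≤ Real.exp (1 / r) * gridExp r j (counts r μ) + Real.exp (-r) := by
  rcases le_or_gt a r with har | har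
  · let c : Fin (r ^ 2 + 1) := ⟨⌈(r : ℝ≥0) * a⌉₊, by
      rw [Nat.lt_succ_iff, ceil_mul_le_iff hr]
      refine har.trans_eq ?_
      push_cast
      field_simp⟩
    have hle : Real.exp (-((c : ℕ) / r : ℝ)) ≤ gridExp r j (counts r μ) := by
      refine le_ciSup_of_le (Set.finite_range _).bddAbove c (if_pos ?_).ge
      rw [sum_Iic_counts hr hμ, natCast_add_one_le_real_iff hμ, ha _, ← ceil_mul_le_iff hr]
    calc Real.exp (-(a : ℝ)) ≤ Real.exp (1 / r) * Real.exp (-((c : ℕ) / r : ℝ)) :=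
          exp_le_mul_of_mem_cell (c := c) hr rfl
      _ ≤ Real.exp (1 / r) * gridExp r j (counts r μ) := by gcongr
      _ ≤ _ := le_add_of_nonneg_right (Real.exp_pos _).le
  · have hr_le : (r : ℝ) ≤ a := by exact_mod_cast har.le
    exact (Real.exp_le_exp.2 (neg_le_neg hr_le)).trans (le_add_of_nonneg_left
      (mul_nonneg (Real.exp_pos _).le (gridExp_nonneg r j _)))

theorem abs_div_sub_div_le {A S g s δ τ κ : ℝ} (hS : 0 < S) (hg : 0 ≤ g) (hgs : g ≤ s)
    (hgA : g ≤ A) (hA : A ≤ (1 + δ) * g + κ) (hsS : s ≤ S) (hSs : S ≤ (1 + δ) * s + τ)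
    (hδ : 0 ≤ δ) (hτ : 0 ≤ τ) (hκ : 0 ≤ κ) :
    |A / S - g / s| ≤ δ + (κ + τ) / S := by
  have hs : 0 ≤ s := hg.trans hgs
  obtain ⟨w, hw⟩ : ∃ w, w = g / s := ⟨_, rfl⟩
  have hw0 : 0 ≤ w := hw ▸ div_nonneg hg hs
  have hw1 : w ≤ 1 := hw ▸ div_le_one_of_le₀ hgs hs
  have hgw : g = w * s :=
    hw ▸ (div_mul_cancel_of_imp fun hs0 => le_antisymm (hgs.trans_eq hs0) hg).symm
  have hwδ : w * (δ * s) ≤ δ * S :=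
    (mul_le_of_le_one_left (by positivity) hw1).trans (by gcongr)
  have hlower : w * S ≤ A + δ * S + τ := by
    linarith [mul_le_mul_of_nonneg_left hSs hw0, mul_le_of_le_one_left hτ hw1]
  have hupper : A ≤ w * S + δ * S + κ := by
    rw [hgw] at hA
    linarith [mul_le_mul_of_nonneg_left hsS hw0]
  calc |A / S - g / s| = |A - w * S| / S := by
        rw [← hw, div_sub' hS.ne', abs_div, abs_of_pos hS, mul_comm S]
    _ ≤ (δ * S + (κ + τ)) / S := by
        gcongr
        rw [abs_le]
        constructor <;> linarith
    _ = δ + (κ + τ) / S := by field_simp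

end Deterministic

/-! ### Convergence of weights from convergence of cell counts -/

/-- A boundedly finite measure on `ℝ₊` with integer values. -/
def IsCounting (μ : Measure ℝ≥0) : Prop :=
  ∀ B : Set ℝ≥0, MeasurableSet B → Bornology.IsBounded B → ∃ n : ℕ, μ B = n

/-- A counting measure with finite exponential mass whose leading normalized exponential weights
are `w`. -/
structure HasWeights {k : ℕ} (μ : Measure ℝ≥0) (w : Fin k → ℝ) : Prop where
  counting : IsCounting μ
  expMass_ne_top : expMass μ ≠ ∞
  weights : ∃ a : Fin k → ℝ≥0, ∀ j : Fin k, IsArrival μ j (a j) ∧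
    w j = Real.exp (-(a j : ℝ)) / (expMass μ).toReal

/-- The error made on the grid of mesh `1 / r` of `[0, r]` in the leading weights of a measure that
charges `[0, K]` and has exponential mass `τ` beyond `r`. -/
def gridError (r K : ℕ) (τ : ℝ≥0∞) : ℝ≥0∞ :=
  ENNReal.ofReal (Real.exp (1 / r) - 1) +
    ENNReal.ofReal (Real.exp K) * (ENNReal.ofReal (Real.exp (-r)) + τ)

theorem exp_one_div_natCast_sub_one_nonneg (r : ℕ) : 0 ≤ Real.exp (1 / r) - 1 :=
  sub_nonneg.2 (Real.one_le_exp (by positivity))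

theorem gridError_mono (r K : ℕ) : Monotone (gridError r K) := fun τ τ' hτ => by
  unfold gridError
  gcongr

theorem ofReal_eq_gridError (r K : ℕ) {τ : ℝ≥0∞} (hτ : τ ≠ ∞) :
    ENNReal.ofReal (Real.exp (1 / r) - 1 + Real.exp K * (Real.exp (-r) + τ.toReal)) =
      gridError r K τ := by
  rw [ENNReal.ofReal_add (exp_one_div_natCast_sub_one_nonneg r) (by positivity),
    ENNReal.ofReal_mul (Real.exp_pos _).le,
    ENNReal.ofReal_add (Real.exp_pos _).le ENNReal.toReal_nonneg, ENNReal.ofReal_toReal hτ,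
    gridError]

theorem tendsto_gridError (K : ℕ) {τ : ℕ → ℝ≥0∞} (hτ : Tendsto τ atTop (𝓝 0)) :
    Tendsto (fun r => gridError r K (τ r)) atTop (𝓝 0) := by
  have hmesh : Tendsto (fun r : ℕ => ENNReal.ofReal (Real.exp (1 / r) - 1)) atTop (𝓝 0) := by
    simpa using ENNReal.tendsto_ofReal
      (((Real.continuous_exp.tendsto 0).comp tendsto_one_div_atTop_nhds_zero_nat).sub_const 1)
  have hexp : Tendsto (fun r : ℕ => ENNReal.ofReal (Real.exp (-r))) atTop (𝓝 0) := by
    simpa using ENNReal.tendsto_ofReal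
      (Real.tendsto_exp_neg_atTop_nhds_zero.comp tendsto_natCast_atTop_atTop)
  simpa [gridError] using hmesh.add (ENNReal.Tendsto.const_mul (hexp.add hτ)
    (Or.inr (ENNReal.ofReal_ne_top (r := Real.exp K))))

theorem lintegral_gridError {Ω : Type*} [MeasurableSpace Ω] {P : Measure Ω}
    [IsProbabilityMeasure P] (r K : ℕ) (τ : Ω → ℝ≥0∞) :
    ∫⁻ ω, gridError r K (τ ω) ∂P = gridError r K (∫⁻ ω, τ ω ∂P) := by
  simp only [gridError]
  rw [lintegral_add_left measurable_const, lintegral_const_mul' _ _ ENNReal.ofReal_ne_top,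
    lintegral_add_left measurable_const]
  simp

theorem isBounded_Iic_nnreal (y : ℝ≥0) : Bornology.IsBounded (Set.Iic y) :=
  Set.Icc_bot (a := y) ▸ Metric.isBounded_Icc ⊥ y

theorem IsCounting.Iic_ne_top {μ : Measure ℝ≥0} (h : IsCounting μ) (y : ℝ≥0) :
    μ (Set.Iic y) ≠ ∞ := by
  obtain ⟨n, hn⟩ := h _ measurableSet_Iic (isBounded_Iic_nnreal y)
  simp [hn]

namespace HasWeights

variable {k : ℕ} {μ : Measure ℝ≥0} {w : Fin k → ℝ}

theorem counts_mem_range (h : HasWeights μ w) {r : ℕ} (hr : 0 < r) :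
    counts r μ ∈ Set.range fun v : Fin (r ^ 2 + 1) → ℕ =>
      (WithLp.toLp 2 fun c => (v c : ℝ) : EuclideanSpace ℝ (Fin (r ^ 2 + 1))) := by
  choose v hv using fun c : Fin (r ^ 2 + 1) => h.counting _ (measurableSet_cell r c)
    ((isBounded_Iic_nnreal _).subset (cell_subset_Iic hr c))
  exact ⟨v, by simp [counts, measureReal_def, hv]⟩

theorem exp_neg_le_toReal_expMass (h : HasWeights μ w) {y : ℝ≥0} (hy : 1 ≤ μ (Set.Iic y)) :
    Real.exp (-(y : ℝ)) ≤ (expMass μ).toReal :=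
  (ENNReal.ofReal_le_iff_le_toReal h.expMass_ne_top).1 (exp_neg_le_expMass hy)

theorem exp_neg_isArrival_le (h : HasWeights μ w) {j : ℕ} {a : ℝ≥0} (ha : IsArrival μ j a) :
    Real.exp (-(a : ℝ)) ≤ (expMass μ).toReal :=
  h.exp_neg_le_toReal_expMass (le_add_self.trans ((ha a).2 le_rfl))

theorem norm_sub_gridWeight_le_one (h : HasWeights μ w) (r : ℕ) :
    ‖w - gridWeight r k (counts r μ)‖ ≤ 1 := by
  obtain ⟨a, ha⟩ := h.weights
  refine (pi_norm_le_iff_of_nonneg zero_le_one).2 fun j => ?_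
  rw [Pi.sub_apply, (ha j).2, Real.norm_eq_abs, gridWeight, ← Real.dist_eq]
  refine Real.dist_le_of_mem_Icc_01
    ⟨by positivity, div_le_one_of_le₀ (h.exp_neg_isArrival_le (ha j).1) ENNReal.toReal_nonneg⟩
    ⟨div_nonneg (gridExp_nonneg _ _ _) (gridSum_nonneg r μ),
      div_le_one_of_le₀ (gridExp_le_gridSum r j μ) (gridSum_nonneg r μ)⟩

theorem norm_sub_gridWeight_le (h : HasWeights μ w) {r : ℕ} (hr : 0 < r) {K : ℕ}
    (hK : 1 ≤ μ (Set.Iic (K : ℝ≥0))) :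
    ‖w - gridWeight r k (counts r μ)‖ ≤
      Real.exp (1 / r) - 1 + Real.exp K * (Real.exp (-r) + (expTail r μ).toReal) := by
  have hδ := exp_one_div_natCast_sub_one_nonneg r
  have hμ := h.counting.Iic_ne_top
  have hS := h.expMass_ne_top
  have hT : expTail r μ ≠ ∞ := ne_top_of_le_ne_top hS (setLIntegral_le_lintegral _ _)
  obtain ⟨a, ha⟩ := h.weights
  refine (pi_norm_le_iff_of_nonneg (by positivity)).2 fun j => ?_
  have hS0 := (Real.exp_pos _).trans_le (h.exp_neg_isArrival_le (ha j).1)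
  have hmass : (expMass μ).toReal ≤
      (1 + (Real.exp (1 / r) - 1)) * gridSum r (counts r μ) + (expTail r μ).toReal := by
    rw [add_sub_cancel]
    simpa only [ENNReal.toReal_add ENNReal.ofReal_ne_top hT, ENNReal.toReal_ofReal
      (mul_nonneg (Real.exp_pos _).le (gridSum_nonneg r μ))] using
      ENNReal.toReal_mono (ENNReal.add_ne_top.2 ⟨ENNReal.ofReal_ne_top, hT⟩) (expMass_le hμ hr)
  have hinv : 1 / (expMass μ).toReal ≤ Real.exp K := by
    rw [one_div, inv_le_comm₀ hS0 (Real.exp_pos _), ← Real.exp_neg]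
    exact h.exp_neg_le_toReal_expMass hK
  rw [Pi.sub_apply, (ha j).2, Real.norm_eq_abs]
  calc _ ≤ Real.exp (1 / r) - 1 +
        (Real.exp (-r) + (expTail r μ).toReal) / (expMass μ).toReal :=
        abs_div_sub_div_le hS0 (gridExp_nonneg _ _ _) (gridExp_le_gridSum r j μ)
          (gridExp_le_exp hμ (ha j).1 hr) (by simpa using exp_le_gridExp hμ (ha j).1 hr)
          ((ENNReal.ofReal_le_iff_le_toReal hS).1 (gridSum_le_expMass hμ hr)) hmass hδ
          ENNReal.toReal_nonneg (Real.exp_pos _).le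
    _ ≤ _ := by
        rw [div_eq_mul_one_div (Real.exp (-r) + (expTail r μ).toReal),
          mul_comm _ (1 / (expMass μ).toReal)]
        gcongr

theorem enorm_sub_gridWeight_le (h : HasWeights μ w) {r : ℕ} (hr : 0 < r) (K : ℕ) :
    ‖w - gridWeight r k (counts r μ)‖ₑ ≤ gridError r K (expTail r μ) +
      {μ : Measure ℝ≥0 | ¬ 1 ≤ μ (Set.Iic (K : ℝ≥0))}.indicator 1 μ := by
  have hT : expTail r μ ≠ ∞ :=
    ne_top_of_le_ne_top h.expMass_ne_top (setLIntegral_le_lintegral _ _)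
  rw [← ofReal_norm]
  by_cases hK : 1 ≤ μ (Set.Iic (K : ℝ≥0))
  · rw [← ofReal_eq_gridError r K hT]
    exact (ENNReal.ofReal_le_ofReal (h.norm_sub_gridWeight_le hr hK)).trans le_self_add
  · rw [Set.indicator_of_mem (by simpa using hK), Pi.one_apply]
    exact (ENNReal.ofReal_le_one.2 (h.norm_sub_gridWeight_le_one r)).trans le_add_self

end HasWeights

/-- A bound for the expected exponential mass beyond `r`, given polynomial mean growth. -/
def tailBound (C : ℝ≥0) (q r : ℕ) : ℝ≥0∞ :=
  ∑' i : ℕ, ENNReal.ofReal (Real.exp (-((i + r : ℕ) : ℝ))) * (C * ((i + r : ℕ) + 1) ^ q)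

theorem summable_exp_neg_mul_succ_pow (C : ℝ) (q : ℕ) :
    Summable fun i : ℕ => Real.exp (-(i : ℝ)) * (C * ((i : ℝ) + 1) ^ q) := by
  refine (((summable_nat_add_iff 1).2
    (Real.summable_pow_mul_exp_neg_nat_mul q one_pos)).mul_left (C * Real.exp 1)).congr fun i => ?_
  have hexp : Real.exp (-(i : ℝ)) = Real.exp 1 * Real.exp (-1 * ((i + 1 : ℕ) : ℝ)) := by
    rw [← Real.exp_add]
    push_cast
    ring_nf
  rw [hexp]
  push_cast
  ring

theorem tailBound_zero_ne_top (C : ℝ≥0) (q : ℕ) : tailBound C q 0 ≠ ∞ := by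
  rw [tailBound]
  convert (summable_exp_neg_mul_succ_pow C q).tsum_ofReal_ne_top using 4 with i
  rw [ENNReal.ofReal_mul (Real.exp_pos _).le, ENNReal.ofReal_mul NNReal.zero_le_coe,
    ENNReal.ofReal_pow (by positivity), ENNReal.ofReal_add (by positivity) zero_le_one]
  simp

theorem tendsto_tailBound (C : ℝ≥0) (q : ℕ) : Tendsto (tailBound C q) atTop (𝓝 0) :=
  ENNReal.tendsto_sum_nat_add
    (fun i : ℕ => ENNReal.ofReal (Real.exp (-(i : ℝ))) * (C * ((i : ℝ≥0∞) + 1) ^ q))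
    (by simpa [tailBound] using tailBound_zero_ne_top C q)

theorem lintegral_expTail_le {Ω : Type*} [MeasurableSpace Ω] {P : Measure Ω}
    {M : Ω → Measure ℝ≥0} (hM : Measurable M) {C : ℝ≥0} {q : ℕ}
    (hmom : ∀ y : ℕ, ∫⁻ ω, M ω (Set.Iic ((y : ℝ≥0) + 1)) ∂P ≤ C * ((y : ℝ≥0∞) + 1) ^ q) (r : ℕ) :
    ∫⁻ ω, expTail r (M ω) ∂P ≤ tailBound C q r := by
  have hM_Iic : ∀ y, Measurable fun ω => M ω (Set.Iic y) := fun y =>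
    (Measure.measurable_coe measurableSet_Iic).comp hM
  refine (lintegral_mono fun ω => expTail_le_tsum r (M ω)).trans ?_
  rw [lintegral_tsum fun i => ((hM_Iic _).const_mul _).aemeasurable]
  refine ENNReal.tsum_le_tsum fun i => ?_
  rw [lintegral_const_mul _ (hM_Iic _)]
  gcongr
  exact_mod_cast hmom (i + r)

-- On the closed discrete lattice every function is continuous, and bounded functions on it extend.
theorem tendsto_integral_of_lattice {N : ℕ} {Ω Ω' : Type*} [MeasurableSpace Ω]
    [MeasurableSpace Ω'] {P : Measure Ω} [IsProbabilityMeasure P] {P' : Measure Ω'}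
    [IsProbabilityMeasure P'] {V : ℕ → Ω → EuclideanSpace ℝ (Fin N)}
    {V' : Ω' → EuclideanSpace ℝ (Fin N)}
    (hV : TendstoInDistribution V atTop V' (fun _ => P) P')
    (hlat : ∀ᶠ n in atTop, ∀ᵐ ω ∂P, V n ω ∈ Set.range fun v : Fin N → ℕ =>
      (WithLp.toLp 2 fun c => (v c : ℝ) : EuclideanSpace ℝ (Fin N)))
    (hlat' : ∀ᵐ ω ∂P', V' ω ∈ Set.range fun v : Fin N → ℕ =>
      (WithLp.toLp 2 fun c => (v c : ℝ) : EuclideanSpace ℝ (Fin N)))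
    (h : EuclideanSpace ℝ (Fin N) → ℝ) {B : ℝ} (hB : ∀ v, |h v| ≤ B) :
    Tendsto (fun n => ∫ ω, h (V n ω) ∂P) atTop (𝓝 (∫ ω, h (V' ω) ∂P')) := by
  let e : (Fin N → ℕ) → EuclideanSpace ℝ (Fin N) := fun v => WithLp.toLp 2 fun c => (v c : ℝ)
  have he : IsClosedEmbedding e :=
    (PiLp.homeomorph 2 fun _ : Fin N => ℝ).symm.isClosedEmbedding.comp
      (IsClosedEmbedding.piMap fun _ => Nat.isClosedEmbedding_coe_real)
  obtain ⟨g, -, hg⟩ := BoundedContinuousFunction.exists_extension_norm_eq_of_isClosedEmbedding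
    (.ofNormedAddCommGroup (fun v => h (e v)) continuous_of_discreteTopology B fun v => hB _) he
  have hgh : ∀ v ∈ Set.range e, g v = h v := by
    rintro _ ⟨v, rfl⟩
    exact congrFun hg v
  have hlim := (ProbabilityMeasure.tendsto_iff_forall_integral_tendsto.1 hV.tendsto) g
  simp only [ProbabilityMeasure.coe_mk] at hlim
  rw [integral_map hV.aemeasurable_limit g.continuous.aestronglyMeasurable] at hlim
  rw [integral_congr_ae (hlat'.mono fun ω hω => (hgh _ hω).symm)]
  refine hlim.congr' ?_
  filter_upwards [hlat] with n hn
  rw [integral_map (hV.forall_aemeasurable n) g.continuous.aestronglyMeasurable]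
  exact integral_congr_ae (hn.mono fun ω hω => hgh _ hω)

theorem measurableSet_not_one_le_Iic {Ω : Type*} [MeasurableSpace Ω] {M : Ω → Measure ℝ≥0}
    (hM : Measurable M) (y : ℝ≥0) : MeasurableSet {ω | ¬ 1 ≤ M ω (Set.Iic y)} :=
  (measurableSet_le measurable_const ((Measure.measurable_coe measurableSet_Iic).comp hM)).compl

theorem enorm_integral_sub_gridWeight_le {k : ℕ} {Ω : Type*} [MeasurableSpace Ω] {P : Measure Ω}
    [IsProbabilityMeasure P] {M : Ω → Measure ℝ≥0} (hM : Measurable M) {C : ℝ≥0} {q : ℕ}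
    (hmom : ∀ y : ℕ, ∫⁻ ω, M ω (Set.Iic ((y : ℝ≥0) + 1)) ∂P ≤ C * ((y : ℝ≥0∞) + 1) ^ q)
    {w : Ω → Fin k → ℝ} (hw : AEMeasurable w P) (hgood : ∀ᵐ ω ∂P, HasWeights (M ω) (w ω))
    {f : (Fin k → ℝ) → ℝ} {B : ℝ} (hB : ∀ x, |f x| ≤ B) {l : ℝ≥0} (hf : LipschitzWith l f)
    {r : ℕ} (hr : 0 < r) (K : ℕ) :
    ‖∫ ω, f (w ω) ∂P - ∫ ω, f (gridWeight r k (counts r (M ω))) ∂P‖ₑ ≤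
      l * gridError r K (tailBound C q r) + l * P {ω | ¬ 1 ≤ M ω (Set.Iic (K : ℝ≥0))} := by
  have hf_int : ∀ {v : Ω → Fin k → ℝ}, AEMeasurable v P → Integrable (fun ω => f (v ω)) P :=
    fun hv => .of_bound (hf.continuous.measurable.comp_aemeasurable hv).aestronglyMeasurable B
      (ae_of_all _ fun _ => hB _)
  have hgrid : Measurable fun ω => gridWeight r k (counts r (M ω)) :=
    (measurable_gridWeight r k).comp ((measurable_counts r).comp hM)
  have hempty := measurableSet_not_one_le_Iic hM K
  rw [← integral_sub (hf_int hw) (hf_int hgrid.aemeasurable), ← mul_add]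
  calc _ ≤ ∫⁻ ω, ‖f (w ω) - f (gridWeight r k (counts r (M ω)))‖ₑ ∂P :=
        enorm_integral_le_lintegral_enorm _
    _ ≤ ∫⁻ ω, l * (gridError r K (expTail r (M ω)) +
          {ω | ¬ 1 ≤ M ω (Set.Iic (K : ℝ≥0))}.indicator 1 ω) ∂P := by
        refine lintegral_mono_ae (hgood.mono fun ω hω => ?_)
        simp only [← edist_eq_enorm_sub]
        refine (hf _ _).trans (mul_le_mul_right ?_ _)
        rw [edist_eq_enorm_sub]
        exact hω.enorm_sub_gridWeight_le hr K
    _ = l * (gridError r K (∫⁻ ω, expTail r (M ω) ∂P) +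
          P {ω | ¬ 1 ≤ M ω (Set.Iic (K : ℝ≥0))}) := by
        rw [lintegral_const_mul' _ _ ENNReal.coe_ne_top,
          lintegral_add_right _ (measurable_one.indicator hempty), lintegral_indicator_one hempty,
          lintegral_gridError]
    _ ≤ _ := by
        gcongr
        exact gridError_mono r K (lintegral_expTail_le hM hmom r)

/-- The indicator that the window `[0, K]` is empty, read off from cell counts. -/
def emptyTest (K : ℕ) (v : EuclideanSpace ℝ (Fin (K ^ 2 + 1))) : ℝ :=
  if 1 ≤ ∑ c ∈ Finset.Iic (Fin.last (K ^ 2)), v c then 0 else 1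

theorem abs_emptyTest_le (K : ℕ) (v : EuclideanSpace ℝ (Fin (K ^ 2 + 1))) :
    |emptyTest K v| ≤ 1 := by
  unfold emptyTest
  split_ifs <;> simp

theorem HasWeights.emptyTest_counts {k : ℕ} {μ : Measure ℝ≥0} {w : Fin k → ℝ}
    (hμ : HasWeights μ w) {K : ℕ} (hK : 0 < K) :
    emptyTest K (counts K μ) = if 1 ≤ μ (Set.Iic (K : ℝ≥0)) then 0 else 1 := by
  have hlast : (((Fin.last (K ^ 2) : Fin (K ^ 2 + 1)) : ℕ) : ℝ≥0) / K = K := by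
    rw [Fin.val_last]
    push_cast
    field_simp
  rw [emptyTest, sum_Iic_counts hK hμ.counting.Iic_ne_top, hlast]
  exact if_congr
    (by simpa using natCast_add_one_le_real_iff hμ.counting.Iic_ne_top (j := 0)) rfl rfl

theorem ofReal_integral_emptyTest {k : ℕ} {Ω : Type*} [MeasurableSpace Ω] {P : Measure Ω}
    [IsFiniteMeasure P] {M : Ω → Measure ℝ≥0} (hM : Measurable M) {w : Ω → Fin k → ℝ}
    (hw : ∀ᵐ ω ∂P, HasWeights (M ω) (w ω)) {K : ℕ} (hK : 0 < K) :
    ENNReal.ofReal (∫ ω, emptyTest K (counts K (M ω)) ∂P) =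
      P {ω | ¬ 1 ≤ M ω (Set.Iic (K : ℝ≥0))} := by
  rw [integral_congr_ae (g := {ω | ¬ 1 ≤ M ω (Set.Iic (K : ℝ≥0))}.indicator 1)
    (hw.mono fun ω hω => ?_), integral_indicator_one (measurableSet_not_one_le_Iic hM K),
    ofReal_measureReal]
  rw [hω.emptyTest_counts hK]
  by_cases h : 1 ≤ M ω (Set.Iic (K : ℝ≥0))
  · rw [if_pos h, Set.indicator_of_notMem (by simpa using h)]
  · rw [if_neg h, Set.indicator_of_mem (by simpa using h), Pi.one_apply]

theorem tendsto_of_forall_exists_edist_le {ι α : Type*} [PseudoEMetricSpace α] {l : Filter ι}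
    {u : ι → α} {a : α} (h : ∀ ε : ℝ≥0∞, 0 < ε → ∃ v : ι → α, ∃ b, Tendsto v l (𝓝 b) ∧
      (∀ᶠ i in l, edist (u i) (v i) ≤ ε) ∧ edist b a ≤ ε) : Tendsto u l (𝓝 a) := by
  rw [tendsto_iff_edist_tendsto_0, ENNReal.tendsto_nhds_zero]
  intro ε hε
  obtain ⟨v, b, hvb, huv, hba⟩ := h (ε / 3) (ENNReal.div_pos hε.ne' (by simp))
  rw [tendsto_iff_edist_tendsto_0, ENNReal.tendsto_nhds_zero] at hvb
  filter_upwards [huv, hvb (ε / 3) (ENNReal.div_pos hε.ne' (by simp))] with i huv hvb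
  rw [← ENNReal.add_thirds ε]
  exact (edist_triangle4 _ (v i) b _).trans (by gcongr)

section Transfer

variable {k : ℕ} {Ω Ω' : Type*} [MeasurableSpace Ω] [MeasurableSpace Ω'] {P : Measure Ω}
  [IsProbabilityMeasure P] {P' : Measure Ω'} [IsProbabilityMeasure P']
  {M : ℕ → Ω → Measure ℝ≥0} {M' : Ω' → Measure ℝ≥0} {w : ℕ → Ω → Fin k → ℝ}
  {w' : Ω' → Fin k → ℝ}

theorem tendsto_integral_counts (hgood : ∀ᶠ n in atTop, ∀ᵐ ω ∂P, HasWeights (M n ω) (w n ω))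
    (hgood' : ∀ᵐ ω ∂P', HasWeights (M' ω) (w' ω)) {r : ℕ} (hr : 0 < r)
    (hcell : TendstoInDistribution (fun n ω => counts r (M n ω)) atTop
      (fun ω => counts r (M' ω)) (fun _ => P) P')
    (h : EuclideanSpace ℝ (Fin (r ^ 2 + 1)) → ℝ) {B : ℝ} (hB : ∀ v, |h v| ≤ B) :
    Tendsto (fun n => ∫ ω, h (counts r (M n ω)) ∂P) atTop
      (𝓝 (∫ ω, h (counts r (M' ω)) ∂P')) :=
  tendsto_integral_of_lattice hcell
    (hgood.mono fun _ hn => hn.mono fun _ hω => hω.counts_mem_range hr)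
    (hgood'.mono fun _ hω => hω.counts_mem_range hr) h hB

theorem tendsto_measure_not_one_le_Iic (hM : ∀ n, Measurable (M n)) (hM' : Measurable M')
    (hgood : ∀ᶠ n in atTop, ∀ᵐ ω ∂P, HasWeights (M n ω) (w n ω))
    (hgood' : ∀ᵐ ω ∂P', HasWeights (M' ω) (w' ω)) {K : ℕ} (hK : 0 < K)
    (hcell : TendstoInDistribution (fun n ω => counts K (M n ω)) atTop
      (fun ω => counts K (M' ω)) (fun _ => P) P') :
    Tendsto (fun n => P {ω | ¬ 1 ≤ M n ω (Set.Iic (K : ℝ≥0))}) atTop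
      (𝓝 (P' {ω | ¬ 1 ≤ M' ω (Set.Iic (K : ℝ≥0))})) := by
  have hlim := ENNReal.tendsto_ofReal
    (tendsto_integral_counts hgood hgood' hK hcell (emptyTest K) (abs_emptyTest_le K))
  rw [ofReal_integral_emptyTest hM' hgood' hK] at hlim
  exact hlim.congr' (hgood.mono fun n hn => ofReal_integral_emptyTest (hM n) hn hK)

theorem tendstoInDistribution_weights (hM : ∀ n, Measurable (M n)) (hM' : Measurable M')
    (hw : ∀ n, AEMeasurable (w n) P) (hw' : AEMeasurable w' P')
    (hgood : ∀ᶠ n in atTop, ∀ᵐ ω ∂P, HasWeights (M n ω) (w n ω))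
    (hgood' : ∀ᵐ ω ∂P', HasWeights (M' ω) (w' ω)) {C : ℝ≥0} {q : ℕ}
    (hmom : ∀ᶠ n in atTop, ∀ y : ℕ,
      ∫⁻ ω, M n ω (Set.Iic ((y : ℝ≥0) + 1)) ∂P ≤ C * ((y : ℝ≥0∞) + 1) ^ q)
    (hmom' : ∀ y : ℕ, ∫⁻ ω, M' ω (Set.Iic ((y : ℝ≥0) + 1)) ∂P' ≤ C * ((y : ℝ≥0∞) + 1) ^ q)
    (hcell : ∀ r, 0 < r → TendstoInDistribution (fun n ω => counts r (M n ω)) atTop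
      (fun ω => counts r (M' ω)) (fun _ => P) P')
    (hinf : Tendsto (fun K : ℕ => P' {ω | ¬ 1 ≤ M' ω (Set.Iic (K : ℝ≥0))}) atTop (𝓝 0)) :
    TendstoInDistribution w atTop w' (fun _ => P) P' where
  forall_aemeasurable := hw
  aemeasurable_limit := hw'
  tendsto := by
    refine tendsto_iff_forall_lipschitz_integral_tendsto.2 ?_
    rintro f ⟨D, hD⟩ ⟨l, hf⟩
    have hB : ∀ x, |f x| ≤ D + |f 0| := fun x =>
      sub_le_iff_le_add.1 ((abs_sub_abs_le_abs_sub _ _).trans (hD x 0))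
    simp only [ProbabilityMeasure.coe_mk]
    rw [integral_map hw' hf.continuous.aestronglyMeasurable]
    simp_rw [fun n => integral_map (hw n) (f := f) hf.continuous.aestronglyMeasurable]
    refine tendsto_of_forall_exists_edist_le fun ε hε => ?_
    have hε2 : 0 < ε / 2 := ENNReal.half_pos hε.ne'
    obtain ⟨K, hK, hK0⟩ : ∃ K : ℕ, l * P' {ω | ¬ 1 ≤ M' ω (Set.Iic (K : ℝ≥0))} < ε / 2 ∧ 0 < K := by
      have hlim := ENNReal.Tendsto.const_mul (a := (l : ℝ≥0∞)) hinf (Or.inr ENNReal.coe_ne_top)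
      rw [mul_zero] at hlim
      exact ((hlim.eventually_lt_const hε2).and (eventually_gt_atTop 0)).exists
    obtain ⟨r, hr, hr0⟩ : ∃ r : ℕ, l * gridError r K (tailBound C q r) < ε / 2 ∧ 0 < r := by
      have hlim := ENNReal.Tendsto.const_mul (a := (l : ℝ≥0∞))
        (tendsto_gridError K (tendsto_tailBound C q)) (Or.inr ENNReal.coe_ne_top)
      rw [mul_zero] at hlim
      exact ((hlim.eventually_lt_const hε2).and (eventually_gt_atTop 0)).exists
    have hempty := ENNReal.Tendsto.const_mul (a := (l : ℝ≥0∞))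
      (tendsto_measure_not_one_le_Iic hM hM' hgood hgood' hK0 (hcell K hK0))
      (Or.inr ENNReal.coe_ne_top)
    refine ⟨_, _, tendsto_integral_counts hgood hgood' hr0 (hcell r hr0)
      (fun v => f (gridWeight r k v)) fun v => hB _, ?_, ?_⟩
    · filter_upwards [hgood, hmom, hempty.eventually_lt_const hK] with n hgood hmom hempty
      rw [edist_eq_enorm_sub, ← ENNReal.add_halves ε]
      exact (enorm_integral_sub_gridWeight_le (hM n) hmom (hw n) hgood hB hf hr0 K).trans
        (add_le_add hr.le hempty.le)
    · rw [edist_comm, edist_eq_enorm_sub, ← ENNReal.add_halves ε]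
      exact (enorm_integral_sub_gridWeight_le hM' hmom' hw' hgood' hB hf hr0 K).trans
        (add_le_add hr.le hK.le)

end Transfer

/-! ### Poisson limit of cell counts -/

/-- The counting measure of the first `n` points of a sequence. -/
def pointMeasure (n : ℕ) (y : ℕ → ℝ≥0) : Measure ℝ≥0 := ∑ i ∈ Finset.range n, Measure.dirac (y i)

theorem pointMeasure_apply (n : ℕ) (y : ℕ → ℝ≥0) {B : Set ℝ≥0} (hB : MeasurableSet B) :
    pointMeasure n y B = ∑ i ∈ Finset.range n, B.indicator 1 (y i) := by
  simp [pointMeasure, Measure.finsetSum_apply, hB]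

theorem measurable_pointMeasure {Ω : Type*} [MeasurableSpace Ω] (n : ℕ) {Y : ℕ → Ω → ℝ≥0}
    (hY : ∀ i, Measurable (Y i)) : Measurable fun ω => pointMeasure n fun i => Y i ω := by
  refine Measure.measurable_of_measurable_coe _ fun B hB => ?_
  simp_rw [pointMeasure_apply _ _ hB]
  exact Finset.measurable_sum _ fun i _ => (measurable_one.indicator hB).comp (hY i)

theorem lintegral_pointMeasure {Ω : Type*} [MeasurableSpace Ω] {P : Measure Ω} (n : ℕ)
    {Y : ℕ → Ω → ℝ≥0} (hY : ∀ i, Measurable (Y i)) {B : Set ℝ≥0} (hB : MeasurableSet B) :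
    ∫⁻ ω, pointMeasure n (fun i => Y i ω) B ∂P = ∑ i ∈ Finset.range n, P (Y i ⁻¹' B) := by
  have hind : ∀ i, Measurable fun ω => B.indicator (1 : ℝ≥0 → ℝ≥0∞) (Y i ω) := fun i =>
    (measurable_one.indicator hB).comp (hY i)
  simp_rw [pointMeasure_apply _ _ hB, lintegral_finsetSum _ fun i _ => hind i]
  exact Finset.sum_congr rfl fun i _ => lintegral_indicator_one (hY i hB)

theorem sum_indicator_cell {E : Type*} [AddCommMonoid E] (r : ℕ) {N : ℕ} (g : Fin N → E)
    (y : ℝ≥0) : ∑ c : Fin N, (cell r c).indicator (fun _ => g c) y =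
      if h : ⌈(r : ℝ≥0) * y⌉₊ < N then g ⟨_, h⟩ else 0 := by
  split_ifs with h
  · rw [Finset.sum_eq_single ⟨_, h⟩]
    · exact Set.indicator_of_mem (show y ∈ cell r _ from rfl) _
    · intro c _ hc
      refine Set.indicator_of_notMem (fun hy => hc (Fin.ext ?_)) _
      exact (show ⌈(r : ℝ≥0) * y⌉₊ = c from hy).symm
    · simp
  · refine Finset.sum_eq_zero fun c _ => Set.indicator_of_notMem (fun hy => h ?_) _
    rw [show ⌈(r : ℝ≥0) * y⌉₊ = c from hy]
    exact c.2

theorem counts_pointMeasure (r n : ℕ) (y : ℕ → ℝ≥0) (c : Fin (r ^ 2 + 1)) :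
    counts r (pointMeasure n y) c =
      ∑ i ∈ Finset.range n, (cell r c).indicator (fun _ => (1 : ℝ)) (y i) := by
  change (pointMeasure n y (cell r c)).toReal = _
  rw [pointMeasure_apply _ _ (measurableSet_cell r c), ENNReal.toReal_sum]
  · refine Finset.sum_congr rfl fun i _ => ?_
    by_cases h : y i ∈ cell r c <;> simp [h]
  · intro i _
    by_cases h : y i ∈ cell r c <;> simp [h]

/-- The factor `e^(i t_c) - 1` of a point in the cell `c`. -/
def cellFactor (r : ℕ) (t : EuclideanSpace ℝ (Fin (r ^ 2 + 1))) (y : ℝ≥0) : ℂ :=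
  ∑ c : Fin (r ^ 2 + 1), (cell r c).indicator (fun _ => Complex.exp (t c * Complex.I) - 1) y

theorem measurable_cellFactor (r : ℕ) (t : EuclideanSpace ℝ (Fin (r ^ 2 + 1))) :
    Measurable (cellFactor r t) :=
  Finset.measurable_sum _ fun c _ => measurable_const.indicator (measurableSet_cell r c)

theorem one_add_cellFactor (r : ℕ) (t : EuclideanSpace ℝ (Fin (r ^ 2 + 1))) (y : ℝ≥0) :
    1 + cellFactor r t y = Complex.exp (((∑ c : Fin (r ^ 2 + 1),
      (cell r c).indicator (fun _ => t c) y : ℝ) : ℂ) * Complex.I) := by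
  rw [cellFactor, sum_indicator_cell, sum_indicator_cell r (fun c => t c)]
  split_ifs <;> simp

theorem norm_one_add_cellFactor (r : ℕ) (t : EuclideanSpace ℝ (Fin (r ^ 2 + 1))) (y : ℝ≥0) :
    ‖1 + cellFactor r t y‖ = 1 := by
  rw [one_add_cellFactor, Complex.norm_exp_ofReal_mul_I]

theorem norm_cellFactor_le {r : ℕ} (hr : 0 < r) (t : EuclideanSpace ℝ (Fin (r ^ 2 + 1)))
    (y : ℝ≥0) : ‖cellFactor r t y‖ ≤ (Set.Iic (r : ℝ≥0)).indicator (fun _ => 2) y := by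
  by_cases hy : y ∈ Set.Iic (r : ℝ≥0)
  · rw [Set.indicator_of_mem hy]
    calc ‖cellFactor r t y‖ = ‖(1 + cellFactor r t y) - 1‖ := by ring_nf
      _ ≤ ‖1 + cellFactor r t y‖ + ‖(1 : ℂ)‖ := norm_sub_le _ _
      _ = 2 := by rw [norm_one_add_cellFactor, norm_one]; norm_num
  · rw [Set.indicator_of_notMem hy, cellFactor, sum_indicator_cell, dif_neg, norm_zero]
    refine fun hlt => hy (((ceil_mul_le_iff hr y (r ^ 2)).1 (by omega)).trans_eq ?_)
    push_cast
    field_simp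

theorem real_cell_zero {r : ℕ} (hr : 0 < r) {μ : Measure ℝ≥0} (hμ : ∀ y, μ (Set.Iic y) ≠ ∞) :
    μ.real (cell r 0) = μ.real (Set.Iic 0) := by
  simpa using sum_real_cell hr hμ 0

theorem real_cell_succ {r : ℕ} (hr : 0 < r) {μ : Measure ℝ≥0} (hμ : ∀ y, μ (Set.Iic y) ≠ ∞)
    (c : ℕ) : μ.real (cell r (c + 1)) =
      μ.real (Set.Iic (((c + 1 : ℕ) : ℝ≥0) / r)) - μ.real (Set.Iic ((c : ℝ≥0) / r)) := by
  rw [← sum_real_cell hr hμ, ← sum_real_cell hr hμ, Finset.sum_range_succ _ (c + 1)]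
  ring

theorem tendsto_sum_real_cell {Ω : Type*} [MeasurableSpace Ω] {P : Measure Ω}
    [IsFiniteMeasure P] {Y : ℕ → ℕ → Ω → ℝ≥0} (hY : ∀ n i, Measurable (Y n i))
    {Λ : Measure ℝ≥0} (hΛ : ∀ y, Λ (Set.Iic y) ≠ ∞)
    (hlim : ∀ y, Tendsto (fun n => ∑ i ∈ Finset.range n, P.real {ω | Y n i ω ≤ y}) atTop
      (𝓝 (Λ.real (Set.Iic y)))) {r : ℕ} (hr : 0 < r) (c : ℕ) :
    Tendsto (fun n => ∑ i ∈ Finset.range n, P.real (Y n i ⁻¹' cell r c)) atTop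
      (𝓝 (Λ.real (cell r c))) := by
  have hmap : ∀ n i, ∀ B, MeasurableSet B → P.real (Y n i ⁻¹' B) = (P.map (Y n i)).real B :=
    fun n i B hB => (map_measureReal_apply (hY n i) hB).symm
  have hIic : ∀ n i y, P.real {ω | Y n i ω ≤ y} = (P.map (Y n i)).real (Set.Iic y) :=
    fun n i y => hmap n i _ measurableSet_Iic
  have hfin : ∀ n i y, P.map (Y n i) (Set.Iic y) ≠ ∞ := fun n i y => measure_ne_top _ _
  simp_rw [hIic] at hlim
  simp_rw [fun n i => hmap n i _ (measurableSet_cell r c)]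
  cases c with
  | zero =>
    simp_rw [fun n i => real_cell_zero hr (hfin n i)]
    rw [real_cell_zero hr hΛ]
    exact hlim 0
  | succ c =>
    simp_rw [fun n i => real_cell_succ hr (hfin n i), Finset.sum_sub_distrib]
    rw [real_cell_succ hr hΛ]
    exact (hlim _).sub (hlim _)

theorem IsPoissonPointProcess.map_real {Ω : Type*} [MeasurableSpace Ω] {𝒳 : Ω → Measure ℝ≥0}
    {Λ : Measure ℝ≥0} {P : Measure Ω} (h : IsPoissonPointProcess 𝒳 Λ P) {B : Set ℝ≥0}
    (hB : MeasurableSet B) (hΛ : Λ B < ∞) :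
    P.map (fun ω => (𝒳 ω).real B) = (poissonMeasure (Λ B).toNNReal).map (Nat.cast : ℕ → ℝ) := by
  have hm : Measurable fun ω => 𝒳 ω B := (Measure.measurable_coe hB).comp h.measurable
  have hreal : (fun ω => (𝒳 ω).real B) = ENNReal.toReal ∘ fun ω => 𝒳 ω B := rfl
  rw [hreal, ← Measure.map_map ENNReal.measurable_toReal hm, h.law B hB hΛ,
    Measure.map_map ENNReal.measurable_toReal .of_discrete]
  congr 1

theorem IsPoissonPointProcess.charFun_counts {Ω : Type*} [MeasurableSpace Ω]
    {𝒳 : Ω → Measure ℝ≥0} {Λ : Measure ℝ≥0} {P : Measure Ω} [IsProbabilityMeasure P]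
    (h : IsPoissonPointProcess 𝒳 Λ P) (hΛ : ∀ y, Λ (Set.Iic y) ≠ ∞) {r : ℕ} (hr : 0 < r)
    (t : EuclideanSpace ℝ (Fin (r ^ 2 + 1))) :
    charFun (P.map fun ω => counts r (𝒳 ω)) t =
      Complex.exp (∑ c : Fin (r ^ 2 + 1),
        (Λ.real (cell r c) : ℂ) * (Complex.exp (t c * Complex.I) - 1)) := by
  have hfin : ∀ c : ℕ, Λ (cell r c) < ∞ := fun c =>
    (measure_mono (cell_subset_Iic hr c)).trans_lt (hΛ _).lt_top
  have hind : iIndepFun (fun (c : Fin (r ^ 2 + 1)) ω => (𝒳 ω).real (cell r c)) P :=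
    (h.indep _ (fun c => cell r c) (fun c => measurableSet_cell r c) (fun c => hfin c)
      (fun c c' hcc => pairwise_disjoint_cell r (by simpa [Fin.ext_iff] using hcc))).comp
      (fun _ => ENNReal.toReal) fun _ => ENNReal.measurable_toReal
  have hm : ∀ c : Fin (r ^ 2 + 1), Measurable fun ω => (𝒳 ω).real (cell r c) := fun c =>
    ((Measure.measurable_coe (measurableSet_cell r c)).comp h.measurable).ennreal_toReal
  rw [Complex.exp_sum]
  refine ((iIndepFun_iff_charFun_pi fun c => (hm c).aemeasurable).1 hind t).trans
    (Finset.prod_congr rfl fun c _ => ?_)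
  rw [h.map_real (measurableSet_cell r c) (hfin c), charFun_map_cast_poissonMeasure]
  rfl

theorem charFun_counts_pointMeasure {Ω : Type*} [MeasurableSpace Ω] {P : Measure Ω}
    {Y : ℕ → Ω → ℝ≥0} (hY : ∀ i, Measurable (Y i)) (r n : ℕ)
    (t : EuclideanSpace ℝ (Fin (r ^ 2 + 1))) :
    charFun (P.map fun ω => counts r (pointMeasure n fun i => Y i ω)) t =
      ∫ ω, ∏ i ∈ Finset.range n, (1 + cellFactor r t (Y i ω)) ∂P := by
  have hm : Measurable fun ω => counts r (pointMeasure n fun i => Y i ω) :=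
    (measurable_counts r).comp (measurable_pointMeasure n hY)
  rw [charFun_apply, integral_map hm.aemeasurable (by fun_prop)]
  refine integral_congr_ae (ae_of_all _ fun ω => ?_)
  dsimp only
  simp_rw [one_add_cellFactor]
  rw [← Complex.exp_sum, ← Finset.sum_mul, ← Complex.ofReal_sum, Finset.sum_comm]
  congr 3
  rw [PiLp.inner_apply]
  refine Finset.sum_congr rfl fun c _ => ?_
  rw [counts_pointMeasure, Real.inner_apply, mul_comm, Finset.mul_sum]
  refine Finset.sum_congr rfl fun i _ => ?_
  by_cases h : Y i ω ∈ cell r c <;> simp [h]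

section Factor

variable {Ω : Type*} [MeasurableSpace Ω] {P : Measure Ω} [IsFiniteMeasure P] {r : ℕ}
  (t : EuclideanSpace ℝ (Fin (r ^ 2 + 1))) {Y Y' : Ω → ℝ≥0}

theorem integral_cellFactor (hY : Measurable Y) : ∫ ω, cellFactor r t (Y ω) ∂P =
    ∑ c : Fin (r ^ 2 + 1), (P.real (Y ⁻¹' cell r c) : ℂ) *
      (Complex.exp (t c * Complex.I) - 1) := by
  have hpre : ∀ c : ℕ, MeasurableSet (Y ⁻¹' cell r c) := fun c => hY (measurableSet_cell r c)
  refine (integral_finsetSum _ fun c _ =>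
    (integrable_const (Complex.exp (t c * Complex.I) - 1)).indicator (hpre c)).trans
    (Finset.sum_congr rfl fun c _ => ?_)
  rw [← Complex.real_smul]
  exact integral_indicator_const _ (hpre c)

theorem integral_norm_cellFactor_le (hr : 0 < r) (hY : Measurable Y) :
    ∫ ω, ‖cellFactor r t (Y ω)‖ ∂P ≤ 2 * P.real {ω | Y ω ≤ r} := by
  have hset : MeasurableSet {ω | Y ω ≤ r} := measurableSet_le hY measurable_const
  calc ∫ ω, ‖cellFactor r t (Y ω)‖ ∂P
      ≤ ∫ ω, {ω | Y ω ≤ r}.indicator (fun _ => (2 : ℝ)) ω ∂P :=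
        integral_mono_of_nonneg (ae_of_all _ fun _ => norm_nonneg _)
          ((integrable_const _).indicator hset) (ae_of_all _ fun ω => norm_cellFactor_le hr t _)
    _ = 2 * P.real {ω | Y ω ≤ r} := by
        rw [integral_indicator_const _ hset, smul_eq_mul, mul_comm]

theorem integral_norm_cellFactor_mul_le (hr : 0 < r) (hY : Measurable Y) (hY' : Measurable Y') :
    ∫ ω, ‖cellFactor r t (Y ω)‖ * ‖cellFactor r t (Y' ω)‖ ∂P ≤
      4 * P.real {ω | Y ω ≤ r ∧ Y' ω ≤ r} := by
  have hset : MeasurableSet {ω | Y ω ≤ r ∧ Y' ω ≤ r} :=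
    (hY measurableSet_Iic).inter (hY' measurableSet_Iic)
  calc ∫ ω, ‖cellFactor r t (Y ω)‖ * ‖cellFactor r t (Y' ω)‖ ∂P
      ≤ ∫ ω, {ω | Y ω ≤ r ∧ Y' ω ≤ r}.indicator (fun _ => (4 : ℝ)) ω ∂P := by
        refine integral_mono_of_nonneg
          (ae_of_all _ fun _ => mul_nonneg (norm_nonneg _) (norm_nonneg _))
          ((integrable_const _).indicator hset) (ae_of_all _ fun ω => ?_)
        refine (mul_le_mul (norm_cellFactor_le hr t _) (norm_cellFactor_le hr t _)
          (norm_nonneg _) (Set.indicator_nonneg (fun _ _ => zero_le_two) _)).trans_eq ?_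
        by_cases hω : Y ω ≤ r <;> by_cases hω' : Y' ω ≤ r <;>
          norm_num [Set.indicator_apply, hω, hω']
    _ = 4 * P.real {ω | Y ω ≤ r ∧ Y' ω ≤ r} := by
        rw [integral_indicator_const _ hset, smul_eq_mul, mul_comm]

end Factor

section PoissonLimit

variable {Ω : Type*} [MeasurableSpace Ω] {P : Measure Ω} [IsProbabilityMeasure P]
  {Y : ℕ → ℕ → Ω → ℝ≥0} {m : ℕ} {Λ : Measure ℝ≥0}

theorem tendsto_charFun_counts_pointMeasure (hY : ∀ n i, Measurable (Y n i))
    (hind : ∀ n j, IndepFun (fun ω (i : Fin (j - m)) => Y n i ω) (Y n j) P)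
    (hC : ∀ y : ℝ≥0, ∃ C : ℝ, 0 ≤ C ∧ ∀ᶠ n : ℕ in atTop, ∀ i < n,
      P.real {ω | Y n i ω ≤ y} ≤ C / n)
    (hCC : ∀ y : ℝ≥0, ∃ C : ℝ, 0 ≤ C ∧ ∀ᶠ n : ℕ in atTop, ∀ i j, i < j → j ≤ i + m → j < n →
      P.real {ω | Y n i ω ≤ y ∧ Y n j ω ≤ y} ≤ C / n ^ 2)
    (hΛ : ∀ y, Λ (Set.Iic y) ≠ ∞)
    (hlim : ∀ y, Tendsto (fun n => ∑ i ∈ Finset.range n, P.real {ω | Y n i ω ≤ y}) atTop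
      (𝓝 (Λ.real (Set.Iic y)))) {r : ℕ} (hr : 0 < r) (t : EuclideanSpace ℝ (Fin (r ^ 2 + 1))) :
    Tendsto (fun n => charFun (P.map fun ω => counts r (pointMeasure n fun i => Y n i ω)) t) atTop
      (𝓝 (Complex.exp (∑ c : Fin (r ^ 2 + 1),
        (Λ.real (cell r c) : ℂ) * (Complex.exp (t c * Complex.I) - 1)))) := by
  refine Tendsto.congr (fun n => (charFun_counts_pointMeasure (hY n) r n t).symm) ?_
  obtain ⟨C₁, hC₁0, hC₁⟩ := hC r
  obtain ⟨C₂, hC₂0, hC₂⟩ := hCC r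
  refine tendsto_integral_prod_exp (X := fun n i ω => cellFactor r t (Y n i ω)) (m := m)
    (C := 2 * C₁ + 4 * C₂) (fun n i => (measurable_cellFactor r t).comp (hY n i))
    (fun n i ω => (norm_one_add_cellFactor r t _).le) (fun n j _ => ?_) (by positivity) ?_ ?_ ?_
  · have hprod : (fun ω => ∏ i ∈ Finset.range (j - m), (1 + cellFactor r t (Y n i ω))) =
        fun ω => ∏ i : Fin (j - m), (1 + cellFactor r t (Y n i ω)) :=
      funext fun ω => (Fin.prod_univ_eq_prod_range
        (fun i => 1 + cellFactor r t (Y n i ω)) (j - m)).symm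
    rw [hprod]
    exact (hind n j).comp (φ := fun y : Fin (j - m) → ℝ≥0 => ∏ i, (1 + cellFactor r t (y i)))
      (Finset.measurable_prod _ fun i _ => measurable_const.add
        ((measurable_cellFactor r t).comp (measurable_pi_apply i))) (measurable_cellFactor r t)
  · filter_upwards [hC₁] with n hn i hi
    calc _ ≤ 2 * (C₁ / n) := (integral_norm_cellFactor_le t hr (hY n i)).trans (by
          gcongr
          exact hn i hi)
      _ = 2 * C₁ / n := by ring
      _ ≤ (2 * C₁ + 4 * C₂) / n := by
          gcongr
          linarith
  · filter_upwards [hC₂] with n hn i j hij hjm hjn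
    calc _ ≤ 4 * (C₂ / n ^ 2) :=
          (integral_norm_cellFactor_mul_le t hr (hY n i) (hY n j)).trans (by
            gcongr
            exact hn i j hij hjm hjn)
      _ = 4 * C₂ / n ^ 2 := by ring
      _ ≤ (2 * C₁ + 4 * C₂) / n ^ 2 := by
          gcongr
          linarith
  · simp_rw [fun n i => integral_cellFactor t (hY n i) (P := P)]
    simp_rw [Finset.sum_comm (s := Finset.range _), ← Finset.sum_mul, ← Complex.ofReal_sum]
    exact tendsto_finsetSum _ fun c _ => ((Complex.continuous_ofReal.tendsto _).comp
      (tendsto_sum_real_cell hY hΛ hlim hr c)).mul_const _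

theorem tendstoInDistribution_counts (hY : ∀ n i, Measurable (Y n i))
    (hind : ∀ n j, IndepFun (fun ω (i : Fin (j - m)) => Y n i ω) (Y n j) P)
    (hC : ∀ y : ℝ≥0, ∃ C : ℝ, 0 ≤ C ∧ ∀ᶠ n : ℕ in atTop, ∀ i < n,
      P.real {ω | Y n i ω ≤ y} ≤ C / n)
    (hCC : ∀ y : ℝ≥0, ∃ C : ℝ, 0 ≤ C ∧ ∀ᶠ n : ℕ in atTop, ∀ i j, i < j → j ≤ i + m → j < n →
      P.real {ω | Y n i ω ≤ y ∧ Y n j ω ≤ y} ≤ C / n ^ 2)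
    (hΛ : ∀ y, Λ (Set.Iic y) ≠ ∞)
    (hlim : ∀ y, Tendsto (fun n => ∑ i ∈ Finset.range n, P.real {ω | Y n i ω ≤ y}) atTop
      (𝓝 (Λ.real (Set.Iic y))))
    {Ω' : Type*} [MeasurableSpace Ω'] {P' : Measure Ω'} [IsProbabilityMeasure P']
    {𝒳 : Ω' → Measure ℝ≥0} (h𝒳 : IsPoissonPointProcess 𝒳 Λ P') {r : ℕ} (hr : 0 < r) :
    TendstoInDistribution (fun n ω => counts r (pointMeasure n fun i => Y n i ω)) atTop
      (fun ω => counts r (𝒳 ω)) (fun _ => P) P' where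
  forall_aemeasurable n :=
    ((measurable_counts r).comp (measurable_pointMeasure n (hY n))).aemeasurable
  aemeasurable_limit := ((measurable_counts r).comp h𝒳.measurable).aemeasurable
  tendsto := ProbabilityMeasure.tendsto_of_tendsto_charFun fun t => by
    rw [ProbabilityMeasure.coe_mk, h𝒳.charFun_counts hΛ hr]
    exact tendsto_charFun_counts_pointMeasure hY hind hC hCC hΛ hlim hr t

end PoissonLimit

/-! ### Arrivals of a counting measure -/

theorem tendsto_measure_Iic_nhdsGT {μ : Measure ℝ≥0} (hμ : ∀ y, μ (Set.Iic y) ≠ ∞) (y : ℝ≥0) :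
    Tendsto (fun z => μ (Set.Iic z)) (𝓝[>] y) (𝓝 (μ (Set.Iic y))) := by
  have hIic : Set.Iic y = ⋂ z > y, Set.Iic z := by
    ext x
    simp only [Set.mem_Iic, Set.mem_iInter]
    exact ⟨fun hx z hz => hx.trans hz.le, le_of_forall_gt_imp_ge_of_dense⟩
  rw [hIic]
  exact tendsto_measure_biInter_gt (fun _ _ => measurableSet_Iic.nullMeasurableSet)
    (fun _ _ _ h => Set.Iic_subset_Iic.2 h) ⟨y + 1, lt_add_one y, hμ _⟩

section Arrival

variable {μ : Measure ℝ≥0}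

theorem IsCounting.isArrival_arrival (hμ : IsCounting μ) {j : ℕ}
    (hj : ∃ y, (j : ℝ≥0∞) + 1 ≤ μ (Set.Iic y)) : IsArrival μ j (arrival μ j) := fun y => by
  refine ⟨fun h => csInf_le (OrderBot.bddBelow _) h, fun h => ?_⟩
  refine ge_of_tendsto (tendsto_measure_Iic_nhdsGT hμ.Iic_ne_top y) ?_
  filter_upwards [self_mem_nhdsWithin] with z hz
  obtain ⟨x, hx, hxz⟩ := exists_lt_of_csInf_lt hj (h.trans_lt hz)
  exact le_trans hx (measure_mono (Set.Iic_subset_Iic.2 hxz.le))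

-- If no such `y` exists, `arrival μ j` is the infimum of the empty set, which is `0` in `ℝ≥0`.
theorem IsCounting.arrival_le_iff (hμ : IsCounting μ) (j : ℕ) (y : ℝ≥0) : arrival μ j ≤ y ↔
    (j : ℝ≥0∞) + 1 ≤ μ (Set.Iic y) ∨ ∀ n : ℕ, ¬ (j : ℝ≥0∞) + 1 ≤ μ (Set.Iic (n : ℝ≥0)) := by
  by_cases hj : ∃ y, (j : ℝ≥0∞) + 1 ≤ μ (Set.Iic y)
  · rw [hμ.isArrival_arrival hj y, or_iff_left]
    intro h
    obtain ⟨n, hn⟩ := exists_nat_ge (arrival μ j)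
    exact h n ((hμ.isArrival_arrival hj _).2 hn)
  · have hzero : arrival μ j = 0 := by
      rw [arrival, Set.eq_empty_of_forall_notMem (s := {y | (j : ℝ≥0∞) + 1 ≤ μ (Set.Iic y)})
        fun y hy => hj ⟨y, hy⟩]
      exact NNReal.sInf_empty
    rw [hzero]
    exact ⟨fun _ => Or.inr fun n hn => hj ⟨_, hn⟩, fun _ => bot_le⟩

theorem measurable_arrival {Ω : Type*} [MeasurableSpace Ω] {M : Ω → Measure ℝ≥0}
    (hM : Measurable M) (hcount : ∀ ω, IsCounting (M ω)) (j : ℕ) :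
    Measurable fun ω => arrival (M ω) j := by
  have hIic : ∀ y, MeasurableSet {ω | (j : ℝ≥0∞) + 1 ≤ M ω (Set.Iic y)} := fun y =>
    measurableSet_le measurable_const ((Measure.measurable_coe measurableSet_Iic).comp hM)
  refine measurable_of_Iic fun y => ?_
  have hpre : (fun ω => arrival (M ω) j) ⁻¹' Set.Iic y =
      {ω | (j : ℝ≥0∞) + 1 ≤ M ω (Set.Iic y)} ∪
        ⋂ n : ℕ, {ω | (j : ℝ≥0∞) + 1 ≤ M ω (Set.Iic (n : ℝ≥0))}ᶜ := by
    ext ω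
    simp only [Set.mem_preimage, Set.mem_Iic, (hcount ω).arrival_le_iff, Set.mem_union,
      Set.mem_ofPred_eq, Set.mem_iInter, Set.mem_compl_iff]
  rw [hpre]
  exact (hIic y).union (MeasurableSet.iInter fun n => (hIic n).compl)

theorem arrival_zero_pos (hμ : IsCounting μ) (hzero : μ (Set.Iic 0) = 0)
    (hpos : ∃ y, 1 ≤ μ (Set.Iic y)) : 0 < arrival μ 0 := by
  refine pos_iff_ne_zero.2 fun h => ?_
  have hle := (hμ.isArrival_arrival (j := 0) (by simpa using hpos) 0).2 h.le
  simp [hzero] at hle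

variable (hμ : IsCounting μ) (hinf : ∀ j : ℕ, ∃ y, (j : ℝ≥0∞) + 1 ≤ μ (Set.Iic y))

include hμ hinf

theorem sum_dirac_arrival_Iic {n : ℕ} {y : ℝ≥0} (hn : μ (Set.Iic y) = n) :
    (Measure.sum fun j : ℕ => Measure.dirac (arrival μ j)) (Set.Iic y) = n := by
  have hdirac : ∀ j : ℕ, Measure.dirac (arrival μ j) (Set.Iic y) =
      if j ∈ Finset.range n then 1 else 0 := fun j => by
    have hmem : arrival μ j ≤ y ↔ j ∈ Finset.range n := by
      rw [← hμ.isArrival_arrival (hinf j), hn, Finset.mem_range, ← Nat.succ_le_iff]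
      exact_mod_cast Iff.rfl
    rw [Measure.dirac_apply' _ measurableSet_Iic, Set.indicator_apply]
    exact if_congr hmem rfl rfl
  rw [Measure.sum_apply _ measurableSet_Iic, tsum_congr hdirac,
    tsum_eq_sum (s := Finset.range n) fun j hj => if_neg hj,
    Finset.sum_congr rfl fun j hj => if_pos hj]
  simp

theorem eq_sum_dirac_arrival : μ = Measure.sum fun j : ℕ => Measure.dirac (arrival μ j) := by
  refine Measure.ext_of_generateFrom_of_iUnion (Set.range Set.Iic) (fun n : ℕ => Set.Iic (n : ℝ≥0))
    (BorelSpace.measurable_eq.trans (borel_eq_generateFrom_Iic ℝ≥0)) isPiSystem_Iic ?_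
    (fun n => ⟨_, rfl⟩) (fun n => hμ.Iic_ne_top _) ?_
  · exact Set.eq_univ_of_forall fun y => Set.mem_iUnion.2 (exists_nat_ge y)
  · rintro _ ⟨y, rfl⟩
    obtain ⟨n, hn⟩ := hμ _ measurableSet_Iic (isBounded_Iic_nnreal y)
    rw [hn, sum_dirac_arrival_Iic hμ hinf hn]

theorem strictMono_arrival (hsimple : ∀ y, μ {y} ≤ 1) : StrictMono (arrival μ) := by
  refine strictMono_nat_of_lt_succ fun j => lt_of_le_of_ne ?_ fun heq => ?_
  · rw [← hμ.isArrival_arrival (hinf j)]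
    refine le_trans ?_ ((hμ.isArrival_arrival (hinf (j + 1)) _).2 le_rfl)
    gcongr
    simp
  · have htwo : 2 ≤ μ {arrival μ j} := by
      calc (2 : ℝ≥0∞) = ∑ i ∈ {j, j + 1}, Measure.dirac (arrival μ i) {arrival μ j} := by
            rw [Finset.sum_pair (by lia), ← heq]
            simp [one_add_one_eq_two]
        _ ≤ ∑' i, Measure.dirac (arrival μ i) {arrival μ j} := ENNReal.sum_le_tsum _
        _ = μ {arrival μ j} := by
            rw [← Measure.sum_apply _ (measurableSet_singleton _), ← eq_sum_dirac_arrival hμ hinf]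
    exact absurd (htwo.trans (hsimple _)) (by norm_num)

theorem expMass_eq_tsum :
    expMass μ = ∑' j : ℕ, ENNReal.ofReal (Real.exp (-(arrival μ j : ℝ))) := by
  have hexp : Measurable fun y : ℝ≥0 => ENNReal.ofReal (Real.exp (-(y : ℝ))) := by fun_prop
  calc expMass μ = expMass (Measure.sum fun j : ℕ => Measure.dirac (arrival μ j)) := by
        rw [← eq_sum_dirac_arrival hμ hinf]
    _ = ∑' j : ℕ, ENNReal.ofReal (Real.exp (-(arrival μ j : ℝ))) :=
        (lintegral_sum_measure _ _).trans (tsum_congr fun _ => lintegral_dirac' _ hexp)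

theorem summable_exp_arrival (hS : expMass μ ≠ ∞) :
    Summable fun j : ℕ => Real.exp (-(arrival μ j : ℝ)) := by
  rw [expMass_eq_tsum hμ hinf] at hS
  exact (ENNReal.summable_toReal hS).congr fun j => ENNReal.toReal_ofReal (Real.exp_pos _).le

theorem tsum_exp_arrival (hS : expMass μ ≠ ∞) :
    ∑' j : ℕ, Real.exp (-(arrival μ j : ℝ)) = (expMass μ).toReal := by
  rw [expMass_eq_tsum hμ hinf, ← ENNReal.ofReal_tsum_of_nonneg (fun _ => (Real.exp_pos _).le)
    (summable_exp_arrival hμ hinf hS),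
    ENNReal.toReal_ofReal (tsum_nonneg fun _ => (Real.exp_pos _).le)]

theorem hasWeights_limitWeight (hS : expMass μ ≠ ∞) (k : ℕ) :
    HasWeights μ fun j : Fin k => limitWeight μ j where
  counting := hμ
  expMass_ne_top := hS
  weights := ⟨fun j => arrival μ j, fun j => ⟨hμ.isArrival_arrival (hinf j), by
    rw [limitWeight, tsum_exp_arrival hμ hinf hS]⟩⟩

end Arrival

theorem measurable_expMass : Measurable expMass :=
  Measure.measurable_lintegral (by fun_prop)

theorem measurable_expTail (r : ℕ) : Measurable (expTail r) := by
  have hexp : Measurable fun y : ℝ≥0 => ENNReal.ofReal (Real.exp (-(y : ℝ))) := by fun_prop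
  have hind := Measure.measurable_lintegral (hexp.indicator (measurableSet_Ioi (a := (r : ℝ≥0))))
  simp_rw [lintegral_indicator (measurableSet_Ioi (a := (r : ℝ≥0)))] at hind
  exact hind

/-! ### Poisson probabilities -/

theorem poissonMeasure_lt (l : ℝ≥0) (n : ℕ) :
    poissonMeasure l {k : ℕ | (k : ℝ≥0∞) < n} =
      ENNReal.ofReal (∑ j ∈ Finset.range n, Real.exp (-l) * l ^ j / j.factorial) := by
  have hrange : {k : ℕ | (k : ℝ≥0∞) < n} = (Finset.range n : Set ℕ) := by ext; simp
  rw [hrange, ← sum_measure_singleton, ENNReal.ofReal_sum_of_nonneg fun _ _ => by positivity]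
  simp_rw [poissonMeasure_singleton]

theorem poissonMeasure_two_le (l : ℝ≥0) :
    poissonMeasure l {k : ℕ | 2 ≤ (k : ℝ≥0∞)} ≤ ENNReal.ofReal (l ^ 2) := by
  have hcompl : {k : ℕ | 2 ≤ (k : ℝ≥0∞)} = {k : ℕ | (k : ℝ≥0∞) < (2 : ℕ)}ᶜ := by
    ext
    simp [Nat.succ_le_iff]
  rw [hcompl, prob_compl_eq_one_sub .of_discrete, poissonMeasure_lt, ← ENNReal.ofReal_one,
    ← ENNReal.ofReal_sub _ (Finset.sum_nonneg fun _ _ => by positivity)]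
  refine ENNReal.ofReal_le_ofReal ?_
  have hexp : 1 - (l : ℝ) ≤ Real.exp (-l) := Real.one_sub_le_exp_neg l
  calc 1 - ∑ j ∈ Finset.range 2, Real.exp (-l) * (l : ℝ) ^ j / j.factorial
      = 1 - Real.exp (-l) * (1 + l) := by
        simp only [Finset.sum_range_succ, Finset.sum_range_zero, Nat.factorial]
        push_cast
        ring
    _ ≤ 1 - (1 - l) * (1 + l) := by gcongr
    _ = (l : ℝ) ^ 2 := by ring

theorem lintegral_natCast_poissonMeasure (l : ℝ≥0) :
    ∫⁻ k : ℕ, (k : ℝ≥0∞) ∂poissonMeasure l = l := by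
  have hterm : ∀ n : ℕ, ENNReal.ofReal (Real.exp (-l) * l ^ (n + 1) / (n + 1).factorial) *
      ((n + 1 : ℕ) : ℝ≥0∞) = l * ENNReal.ofReal (Real.exp (-l) * l ^ n / n.factorial) := by
    intro n
    rw [← ENNReal.ofReal_natCast (n + 1), ← ENNReal.ofReal_mul (by positivity),
      ← ENNReal.ofReal_coe_nnreal (p := l), ← ENNReal.ofReal_mul NNReal.zero_le_coe]
    congr 1
    rw [Nat.factorial_succ]
    push_cast
    field_simp
    ring
  rw [poissonMeasure, lintegral_sum_measure]
  simp_rw [lintegral_smul_measure, lintegral_dirac, smul_eq_mul]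
  rw [tsum_eq_zero_add' ENNReal.summable]
  simp_rw [hterm]
  rw [ENNReal.tsum_mul_left, ← ENNReal.ofReal_tsum_of_nonneg (fun _ => by positivity)
    (hasSum_one_poissonMeasure l).summable, (hasSum_one_poissonMeasure l).tsum_eq]
  simp

/-! ### Almost sure structure of a Poisson process -/

theorem IsCounting.exists_two_le_preimage_cell {μ : Measure ℝ≥0} (hμ : IsCounting μ)
    {φ : ℝ≥0 → ℝ≥0} {K N : ℕ} (hN : 0 < N) {y : ℝ≥0} (hy0 : φ y ≠ 0) (hyK : φ y ≤ K)
    (hy : 1 < μ {y}) : ∃ k < K * N, 2 ≤ μ (φ ⁻¹' cell N (k + 1)) := by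
  have hpos : 0 < ⌈(N : ℝ≥0) * φ y⌉₊ :=
    Nat.ceil_pos.2 (mul_pos (by exact_mod_cast hN) (pos_iff_ne_zero.2 hy0))
  have hle : ⌈(N : ℝ≥0) * φ y⌉₊ ≤ K * N := by
    rw [Nat.ceil_le]
    push_cast
    rw [mul_comm]
    gcongr
  have hmem : y ∈ φ ⁻¹' cell N (⌈(N : ℝ≥0) * φ y⌉₊ - 1 + 1) := by
    rw [Nat.sub_add_cancel hpos]
    rfl
  refine ⟨⌈(N : ℝ≥0) * φ y⌉₊ - 1, by lia, ?_⟩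
  refine le_trans ?_ (measure_mono (Set.singleton_subset_iff.2 hmem))
  obtain ⟨n, hn⟩ := hμ {y} (measurableSet_singleton y) Bornology.isBounded_singleton
  rw [hn] at hy ⊢
  have hn1 : 1 < n := by exact_mod_cast hy
  exact_mod_cast hn1

theorem measure_preimage_cell {Λ : Measure ℝ≥0} {φ : ℝ≥0 → ℝ≥0} {c : ℝ≥0} (hφ : Measurable φ)
    (hΛφ : ∀ t, Λ (φ ⁻¹' Set.Iic t) = c * t) {N : ℕ} (hN : 0 < N) (k : ℕ) :
    Λ (φ ⁻¹' cell N (k + 1)) < ∞ ∧ Λ.real (φ ⁻¹' cell N (k + 1)) = c / N := by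
  have hIic : ∀ t, (Λ.map φ) (Set.Iic t) = (c * t : ℝ≥0) := fun t => by
    rw [Measure.map_apply hφ measurableSet_Iic, hΛφ, ENNReal.coe_mul]
  have hfin : ∀ t, (Λ.map φ) (Set.Iic t) ≠ ∞ := fun t => hIic t ▸ ENNReal.coe_ne_top
  rw [← Measure.map_apply hφ (measurableSet_cell _ _),
    ← map_measureReal_apply hφ (measurableSet_cell _ _), real_cell_succ hN hfin]
  refine ⟨(measure_mono (cell_subset_Iic hN _)).trans_lt (hfin _).lt_top, ?_⟩
  rw [measureReal_def, measureReal_def, hIic, hIic, ENNReal.coe_toReal, ENNReal.coe_toReal]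
  push_cast
  ring

namespace IsPoissonPointProcess

variable {Ω : Type*} [MeasurableSpace Ω] {𝒳 : Ω → Measure ℝ≥0} {Λ : Measure ℝ≥0} {P : Measure Ω}

theorem measure_preimage (h : IsPoissonPointProcess 𝒳 Λ P) {B : Set ℝ≥0}
    (hB : MeasurableSet B) (hΛ : Λ B < ∞) {S : Set ℝ≥0∞} (hS : MeasurableSet S) :
    P {ω | 𝒳 ω B ∈ S} = poissonMeasure (Λ B).toNNReal {k : ℕ | (k : ℝ≥0∞) ∈ S} := by
  have hm : Measurable fun ω => 𝒳 ω B := (Measure.measurable_coe hB).comp h.measurable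
  have hmap := Measure.map_apply (μ := P) hm hS
  rw [h.law B hB hΛ, Measure.map_apply .of_discrete hS] at hmap
  exact hmap.symm

theorem lintegral_apply (h : IsPoissonPointProcess 𝒳 Λ P) {B : Set ℝ≥0}
    (hB : MeasurableSet B) (hΛ : Λ B < ∞) : ∫⁻ ω, 𝒳 ω B ∂P = Λ B := by
  have hm : Measurable fun ω => 𝒳 ω B := (Measure.measurable_coe hB).comp h.measurable
  have hid : Measurable fun x : ℝ≥0∞ => x := measurable_id
  rw [← lintegral_map hid hm, h.law B hB hΛ, lintegral_map hid .of_discrete,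
    lintegral_natCast_poissonMeasure, ENNReal.coe_toNNReal hΛ.ne]

theorem ae_apply_eq_zero (h : IsPoissonPointProcess 𝒳 Λ P) {B : Set ℝ≥0}
    (hB : MeasurableSet B) (hΛ : Λ B = 0) : ∀ᵐ ω ∂P, 𝒳 ω B = 0 :=
  (lintegral_eq_zero_iff ((Measure.measurable_coe hB).comp h.measurable)).1
    ((h.lintegral_apply hB (hΛ ▸ ENNReal.zero_lt_top)).trans hΛ)

theorem measure_two_le (h : IsPoissonPointProcess 𝒳 Λ P) {B : Set ℝ≥0}
    (hB : MeasurableSet B) (hΛ : Λ B < ∞) :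
    P {ω | 2 ≤ 𝒳 ω B} ≤ ENNReal.ofReal (Λ.real B ^ 2) :=
  (h.measure_preimage (S := Set.Ici 2) hB hΛ measurableSet_Ici).le.trans
    (poissonMeasure_two_le _)

theorem tendsto_measure_lt (h : IsPoissonPointProcess 𝒳 Λ P) (hΛ : ∀ y, Λ (Set.Iic y) ≠ ∞)
    (hinf : Tendsto (fun K : ℕ => Λ.real (Set.Iic (K : ℝ≥0))) atTop atTop) (n : ℕ) :
    Tendsto (fun K : ℕ => P {ω | 𝒳 ω (Set.Iic (K : ℝ≥0)) < n}) atTop (𝓝 0) := by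
  have hlaw : ∀ K : ℕ, P {ω | 𝒳 ω (Set.Iic (K : ℝ≥0)) < n} = ENNReal.ofReal
      (∑ j ∈ Finset.range n, Real.exp (-Λ.real (Set.Iic (K : ℝ≥0))) *
        Λ.real (Set.Iic (K : ℝ≥0)) ^ j / j.factorial) := fun K =>
    (h.measure_preimage (S := Set.Iio (n : ℝ≥0∞)) measurableSet_Iic (hΛ _).lt_top
      measurableSet_Iio).trans (poissonMeasure_lt _ n)
  simp_rw [hlaw]
  rw [← ENNReal.ofReal_zero, ← Finset.sum_const_zero (s := Finset.range n)]
  refine ENNReal.tendsto_ofReal (tendsto_finsetSum _ fun j _ => ?_)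
  simpa [mul_comm, mul_div_assoc] using
    ((Real.tendsto_pow_mul_exp_neg_atTop_nhds_zero j).comp hinf).div_const (j.factorial : ℝ)

theorem ae_infinite (h : IsPoissonPointProcess 𝒳 Λ P) (hΛ : ∀ y, Λ (Set.Iic y) ≠ ∞)
    (hinf : Tendsto (fun K : ℕ => Λ.real (Set.Iic (K : ℝ≥0))) atTop atTop) :
    ∀ᵐ ω ∂P, ∀ j : ℕ, ∃ y, (j : ℝ≥0∞) + 1 ≤ 𝒳 ω (Set.Iic y) := by
  refine ae_all_iff.2 fun j => ?_
  rw [ae_iff]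
  refine le_antisymm (ge_of_tendsto' (h.tendsto_measure_lt hΛ hinf (j + 1)) fun K => ?_) bot_le
  exact measure_mono fun ω hω => by simpa using not_exists.1 hω (K : ℝ≥0)

section Simple

variable {φ : ℝ≥0 → ℝ≥0} {c : ℝ≥0} (hφ : Measurable φ) (hΛφ : ∀ t, Λ (φ ⁻¹' Set.Iic t) = c * t)

include hφ hΛφ

theorem measure_exists_multiple_le (h : IsPoissonPointProcess 𝒳 Λ P) {K N : ℕ} (hN : 0 < N) :
    P {ω | ∃ y, φ y ≠ 0 ∧ φ y ≤ K ∧ 1 < 𝒳 ω {y}} ≤ ENNReal.ofReal (K * c ^ 2 / N) := by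
  have hN0 : (N : ℝ) ≠ 0 := by exact_mod_cast hN.ne'
  calc _ ≤ P (⋃ k ∈ Finset.range (K * N), {ω | 2 ≤ 𝒳 ω (φ ⁻¹' cell N (k + 1))}) := by
        refine measure_mono fun ω ⟨y, hy0, hyK, hy⟩ => ?_
        obtain ⟨k, hk, hk2⟩ := IsCounting.exists_two_le_preimage_cell (h.counting ω) hN hy0 hyK hy
        exact Set.mem_biUnion (Finset.mem_coe.2 (Finset.mem_range.2 hk)) hk2
    _ ≤ ∑ k ∈ Finset.range (K * N), P {ω | 2 ≤ 𝒳 ω (φ ⁻¹' cell N (k + 1))} :=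
        measure_biUnion_finset_le _ _
    _ ≤ ∑ k ∈ Finset.range (K * N), ENNReal.ofReal ((c / N) ^ 2) :=
        Finset.sum_le_sum fun k _ => by
          obtain ⟨hfin, hreal⟩ := measure_preimage_cell hφ hΛφ hN k
          exact hreal ▸ h.measure_two_le (hφ (measurableSet_cell _ _)) hfin
    _ = ENNReal.ofReal (K * c ^ 2 / N) := by
        rw [Finset.sum_const, Finset.card_range, nsmul_eq_mul, ← ENNReal.ofReal_natCast,
          ← ENNReal.ofReal_mul (by positivity)]
        congr 1
        push_cast
        field_simp

-- The time change `φ` makes the intensity uniform, so that a bounded window is covered by `O(N)`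
-- cells each of which carries two points with probability `O(N⁻²)`.
theorem ae_simple (h : IsPoissonPointProcess 𝒳 Λ P) : ∀ᵐ ω ∂P, ∀ y, 𝒳 ω {y} ≤ 1 := by
  have hwindow : ∀ K : ℕ, ∀ᵐ ω ∂P, ¬ ∃ y, φ y ≠ 0 ∧ φ y ≤ K ∧ 1 < 𝒳 ω {y} := fun K => by
    simp only [ae_iff, not_not]
    have hlim : Tendsto (fun N : ℕ => ENNReal.ofReal (K * c ^ 2 / N)) atTop (𝓝 0) := by
      rw [← ENNReal.ofReal_zero]
      exact ENNReal.tendsto_ofReal (tendsto_const_div_atTop_nhds_zero_nat _)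
    refine le_antisymm (ge_of_tendsto hlim ?_) bot_le
    filter_upwards [eventually_gt_atTop 0] with N hN
    exact h.measure_exists_multiple_le hφ hΛφ hN
  filter_upwards [h.ae_apply_eq_zero (hφ measurableSet_Iic) ((hΛφ 0).trans (by simp)),
    ae_all_iff.2 hwindow] with ω hzero hmultiple y
  by_cases hy : φ y = 0
  · have hsub : {y} ⊆ φ ⁻¹' Set.Iic 0 := Set.singleton_subset_iff.2 hy.le
    exact (measure_mono hsub).trans (hzero.le.trans zero_le_one)
  · obtain ⟨K, hK⟩ := exists_nat_ge (φ y)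
    exact not_lt.1 fun hy1 => hmultiple K ⟨y, hy, hK, hy1⟩

end Simple

theorem ae_expMass_ne_top (h : IsPoissonPointProcess 𝒳 Λ P) {C : ℝ≥0} {q : ℕ}
    (hmom : ∀ y : ℕ, ∫⁻ ω, 𝒳 ω (Set.Iic ((y : ℝ≥0) + 1)) ∂P ≤ C * ((y : ℝ≥0∞) + 1) ^ q) :
    ∀ᵐ ω ∂P, expMass (𝒳 ω) ≠ ∞ := by
  obtain ⟨r, hr, hr0⟩ := (((tendsto_tailBound C q).eventually_lt_const ENNReal.zero_lt_top).and
    (eventually_gt_atTop 0)).exists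
  filter_upwards [ae_lt_top ((measurable_expTail r).comp h.measurable)
    ((lintegral_expTail_le h.measurable hmom r).trans_lt hr).ne] with ω hω
  exact ne_top_of_le_ne_top (ENNReal.add_ne_top.2 ⟨ENNReal.ofReal_ne_top, hω.ne⟩)
    (expMass_le (IsCounting.Iic_ne_top (h.counting ω)) hr0)

theorem aemeasurable_limitWeight (h : IsPoissonPointProcess 𝒳 Λ P) {k : ℕ}
    (hS : ∀ᵐ ω ∂P, expMass (𝒳 ω) ≠ ∞)
    (hinf : ∀ᵐ ω ∂P, ∀ j : ℕ, ∃ y, (j : ℝ≥0∞) + 1 ≤ 𝒳 ω (Set.Iic y)) :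
    AEMeasurable (fun ω (j : Fin k) => limitWeight (𝒳 ω) j) P := by
  refine ⟨fun ω j => Real.exp (-(arrival (𝒳 ω) j : ℝ)) / (expMass (𝒳 ω)).toReal,
    measurable_pi_lambda _ fun j => Measurable.div ?_
      (measurable_expMass.comp h.measurable).ennreal_toReal, ?_⟩
  · have := measurable_arrival h.measurable h.counting j
    fun_prop
  · filter_upwards [hS, hinf] with ω hS hinf
    funext j
    rw [limitWeight, tsum_exp_arrival (h.counting ω) hinf hS]

end IsPoissonPointProcess

theorem ofReal_mul_natCast_add_one_pow {C : ℝ} (hC : 0 ≤ C) (y q : ℕ) :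
    ENNReal.ofReal (C * ((y : ℝ) + 1) ^ q) = (C.toNNReal : ℝ≥0∞) * ((y : ℝ≥0∞) + 1) ^ q := by
  rw [ENNReal.ofReal_mul hC, ENNReal.ofReal_pow (by positivity),
    ENNReal.ofReal_add (by positivity) zero_le_one, ENNReal.ofReal_natCast, ENNReal.ofReal_one]
  rfl

section PowerIntensity

variable {c γ a : ℝ} (hc : 0 < c) (hγ : 0 < γ) (ha : 0 < a)

theorem powerIntensity_Iic_ne_top (y : ℝ≥0) :
    powerIntensity c γ a hc.le hγ ha (Set.Iic y) ≠ ∞ := by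
  rw [powerIntensity_Iic]
  exact ENNReal.ofReal_ne_top

theorem powerIntensity_real_Iic (y : ℝ≥0) :
    (powerIntensity c γ a hc.le hγ ha).real (Set.Iic y) = c * ((y : ℝ) / γ) ^ a := by
  rw [measureReal_def, powerIntensity_Iic, ENNReal.toReal_ofReal (by positivity)]

theorem tendsto_powerIntensity_real_Iic :
    Tendsto (fun K : ℕ => (powerIntensity c γ a hc.le hγ ha).real (Set.Iic (K : ℝ≥0))) atTop
      atTop := by
  simp_rw [powerIntensity_real_Iic hc hγ ha]
  refine Tendsto.const_mul_atTop hc ((tendsto_rpow_atTop ha).comp ?_)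
  simpa using (tendsto_natCast_atTop_atTop (R := ℝ)).atTop_div_const hγ

theorem powerIntensity_preimage (t : ℝ≥0) :
    powerIntensity c γ a hc.le hγ ha ((fun y : ℝ≥0 => (y / γ.toNNReal) ^ a) ⁻¹' Set.Iic t) =
      (c.toNNReal : ℝ≥0∞) * t := by
  have hγ' : 0 < γ.toNNReal := Real.toNNReal_pos.2 hγ
  have hpre : ((fun y : ℝ≥0 => (y / γ.toNNReal) ^ a) ⁻¹' Set.Iic t) =
      Set.Iic (t ^ a⁻¹ * γ.toNNReal) := by
    ext y
    rw [Set.mem_preimage, Set.mem_Iic, Set.mem_Iic, ← NNReal.le_rpow_inv_iff ha,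
      div_le_iff₀ hγ']
  rw [hpre, powerIntensity_Iic]
  push_cast
  rw [Real.coe_toNNReal _ hγ.le, mul_div_assoc, div_self hγ.ne', mul_one,
    ← Real.rpow_mul t.coe_nonneg, inv_mul_cancel₀ ha.ne', Real.rpow_one, ENNReal.ofReal_mul hc.le,
    ENNReal.ofReal_coe_nnreal]
  rfl

variable {Ω : Type*} [MeasurableSpace Ω] {𝒳 : Ω → Measure ℝ≥0} {P : Measure Ω}

theorem IsPoissonPointProcess.exists_lintegral_Iic_le
    (h𝒳 : IsPoissonPointProcess 𝒳 (powerIntensity c γ a hc.le hγ ha) P) {q : ℕ} (haq : a ≤ q) :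
    ∃ C : ℝ≥0, ∀ y : ℕ,
      ∫⁻ ω, 𝒳 ω (Set.Iic ((y : ℝ≥0) + 1)) ∂P ≤ C * ((y : ℝ≥0∞) + 1) ^ q := by
  refine ⟨(c / γ ^ a).toNNReal, fun y => ?_⟩
  rw [h𝒳.lintegral_apply measurableSet_Iic (powerIntensity_Iic_ne_top hc hγ ha _).lt_top,
    powerIntensity_Iic]
  calc ENNReal.ofReal (c * (((y : ℝ≥0) + 1 : ℝ≥0) / γ : ℝ) ^ a)
      ≤ ENNReal.ofReal (c / γ ^ a * ((y : ℝ) + 1) ^ q) := by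
        refine ENNReal.ofReal_le_ofReal ?_
        push_cast
        rw [Real.div_rpow (by positivity) hγ.le, mul_div_assoc', mul_div_right_comm,
          ← Real.rpow_natCast]
        gcongr
        simp
    _ = (c / γ ^ a).toNNReal * ((y : ℝ≥0∞) + 1) ^ q :=
        ofReal_mul_natCast_add_one_pow (by positivity) y q

theorem IsPoissonPointProcess.ae_powerIntensity_infinite
    (h𝒳 : IsPoissonPointProcess 𝒳 (powerIntensity c γ a hc.le hγ ha) P) :
    ∀ᵐ ω ∂P, ∀ j : ℕ, ∃ y, (j : ℝ≥0∞) + 1 ≤ 𝒳 ω (Set.Iic y) :=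
  h𝒳.ae_infinite (powerIntensity_Iic_ne_top hc hγ ha) (tendsto_powerIntensity_real_Iic hc hγ ha)

theorem IsPoissonPointProcess.ae_powerIntensity_expMass_ne_top
    (h𝒳 : IsPoissonPointProcess 𝒳 (powerIntensity c γ a hc.le hγ ha) P) :
    ∀ᵐ ω ∂P, expMass (𝒳 ω) ≠ ∞ :=
  let ⟨_, hmom⟩ := h𝒳.exists_lintegral_Iic_le hc hγ ha (Nat.le_ceil a)
  h𝒳.ae_expMass_ne_top hmom

theorem IsPoissonPointProcess.ae_arrivals
    (h𝒳 : IsPoissonPointProcess 𝒳 (powerIntensity c γ a hc.le hγ ha) P) :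
    ∀ᵐ ω ∂P, 0 < arrival (𝒳 ω) 0 ∧ StrictMono (arrival (𝒳 ω)) ∧
      𝒳 ω = Measure.sum (fun j : ℕ => Measure.dirac (arrival (𝒳 ω) j)) ∧
      Summable (fun j : ℕ => Real.exp (-(arrival (𝒳 ω) j : ℝ))) := by
  have hΛ0 : powerIntensity c γ a hc.le hγ ha (Set.Iic 0) = 0 := by
    simp [powerIntensity_Iic, Real.zero_rpow ha.ne']
  filter_upwards [h𝒳.ae_apply_eq_zero measurableSet_Iic hΛ0,
    h𝒳.ae_simple (by fun_prop) (powerIntensity_preimage hc hγ ha),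
    h𝒳.ae_powerIntensity_infinite hc hγ ha, h𝒳.ae_powerIntensity_expMass_ne_top hc hγ ha]
    with ω hzero hsimple hinf hS
  have hcount : IsCounting (𝒳 ω) := h𝒳.counting ω
  exact ⟨arrival_zero_pos hcount hzero (by simpa using hinf 0),
    strictMono_arrival hcount hinf hsimple, eq_sum_dirac_arrival hcount hinf,
    summable_exp_arrival hcount hinf hS⟩

end PowerIntensity

/-! ### Ordered weights of a finite sample -/

theorem card_filter_comp_perm {n : ℕ} (σ : Equiv.Perm (Fin n)) (p : Fin n → Prop)
    [DecidablePred p] : (Finset.univ.filter fun i => p (σ i)).card =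
      (Finset.univ.filter p).card :=
  Finset.card_equiv σ (by simp)

theorem le_nthLargest_iff {n j : ℕ} (hj : j < n) (a : Fin n → ℝ) (t : ℝ) :
    t ≤ nthLargest a j ↔ j < (Finset.univ.filter fun i => t ≤ a i).card := by
  have hanti : Antitone (a ∘ Tuple.sort fun i => -a i) := fun i l hil =>
    neg_le_neg_iff.1 (Tuple.monotone_sort (fun i => -a i) hil)
  rw [nthLargest, dif_pos hj, ← card_filter_comp_perm (Tuple.sort fun i => -a i)]
  exact (Tuple.lt_card_ge_iff_apply_ge_of_antitone hanti).symm

theorem measurable_nthLargest (n j : ℕ) : Measurable fun a : Fin n → ℝ => nthLargest a j := by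
  by_cases hj : j < n
  · refine measurable_of_Ici fun t => ?_
    have hcard : Measurable fun a : Fin n → ℝ => (Finset.univ.filter fun i => t ≤ a i).card := by
      simp_rw [Finset.card_filter]
      exact Finset.measurable_sum _ fun i _ => Measurable.ite
        (measurableSet_le measurable_const (measurable_pi_apply i)) measurable_const
        measurable_const
    simpa only [Set.preimage, Set.mem_Ici, le_nthLargest_iff hj] using
      measurableSet_lt measurable_const hcard
  · simp only [nthLargest, hj, dite_false, measurable_const]

theorem pointMeasure_eq_card (n : ℕ) (y : ℕ → ℝ≥0) {B : Set ℝ≥0} (hB : MeasurableSet B)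
    [DecidablePred (· ∈ B)] :
    pointMeasure n y B = ((Finset.univ.filter fun i : Fin n => y i ∈ B).card : ℕ) := by
  rw [pointMeasure_apply n y hB, ← Fin.sum_univ_eq_sum_range fun i => B.indicator 1 (y i)]
  simp [Set.indicator_apply]

theorem isCounting_pointMeasure (n : ℕ) (y : ℕ → ℝ≥0) : IsCounting (pointMeasure n y) := by
  classical exact fun B hB _ => ⟨_, pointMeasure_eq_card n y hB⟩

theorem expMass_pointMeasure (n : ℕ) (y : ℕ → ℝ≥0) :
    expMass (pointMeasure n y) = ENNReal.ofReal (∑ i : Fin n, Real.exp (-(y i : ℝ))) := by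
  have hexp : Measurable fun y : ℝ≥0 => ENNReal.ofReal (Real.exp (-(y : ℝ))) := by fun_prop
  rw [ENNReal.ofReal_sum_of_nonneg fun _ _ => (Real.exp_pos _).le,
    Fin.sum_univ_eq_sum_range (fun i => ENNReal.ofReal (Real.exp (-(y i : ℝ)))), expMass,
    pointMeasure, lintegral_finsetSum_measure]
  exact Finset.sum_congr rfl fun i _ => lintegral_dirac' _ hexp

theorem isArrival_pointMeasure {n : ℕ} {y : ℕ → ℝ≥0} {σ : Equiv.Perm (Fin n)}
    (hσ : Monotone fun i => y (σ i)) (j : Fin n) : IsArrival (pointMeasure n y) j (y (σ j)) := by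
  intro z
  rw [pointMeasure_eq_card n y measurableSet_Iic, ← card_filter_comp_perm σ]
  exact_mod_cast Tuple.lt_card_le_iff_apply_le_of_monotone hσ (j := j) (a := z)

theorem hasWeights_pointMeasure {n k : ℕ} (hkn : k ≤ n) (y : ℕ → ℝ≥0) :
    HasWeights (pointMeasure n y) fun j : Fin k => nthLargest
      (fun i : Fin n => Real.exp (-(y i : ℝ)) / ∑ i : Fin n, Real.exp (-(y i : ℝ))) j where
  counting := isCounting_pointMeasure n y
  expMass_ne_top := by simp [expMass_pointMeasure]
  weights := by
    set w := fun i : Fin n => Real.exp (-(y i : ℝ)) / ∑ i : Fin n, Real.exp (-(y i : ℝ))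
    refine ⟨fun j => y (Tuple.sort (fun i => -w i) (Fin.castLE hkn j)), fun j => ⟨?_, ?_⟩⟩
    · have hpos : 0 < ∑ i : Fin n, Real.exp (-(y i : ℝ)) :=
        Finset.sum_pos (fun _ _ => Real.exp_pos _) ⟨Fin.castLE hkn j, Finset.mem_univ _⟩
      refine isArrival_pointMeasure (fun i l hil => ?_) (Fin.castLE hkn j)
      have hw := neg_le_neg_iff.1 (Tuple.monotone_sort (fun i => -w i) hil)
      rw [div_le_div_iff_of_pos_right hpos, Real.exp_le_exp, neg_le_neg_iff] at hw
      exact_mod_cast hw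
    · rw [nthLargest, dif_pos (j.2.trans_le hkn), expMass_pointMeasure,
        ENNReal.toReal_ofReal (Finset.sum_nonneg fun _ _ => (Real.exp_pos _).le)]
      rfl

/-! ### Cap masses of a measure with a continuous density -/

theorem exists_forall_le_of_forall_continuousAt {X : Type*} [TopologicalSpace X] {O : Set X}
    (hO : IsCompact O) {ρ : X → ℝ≥0} (hρ : ∀ u ∈ O, ContinuousAt ρ u) :
    ∃ R : ℝ≥0, ∀ u ∈ O, ρ u ≤ R :=
  let ⟨R, hR⟩ := hO.bddAbove_image fun u hu => (hρ u hu).continuousWithinAt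
  ⟨R, fun _ hu => hR (Set.mem_image_of_mem ρ hu)⟩

section CapMass

variable {E : Type*} [NormedAddCommGroup E] [InnerProductSpace ℝ E] [FiniteDimensional ℝ E]
  [MeasurableSpace E] [BorelSpace E] {k : ℕ} {O : Set (Metric.sphere (0 : E) 1)}
  {ρ : Metric.sphere (0 : E) 1 → ℝ≥0}

theorem exists_abs_withDensity_real_cap_sub_le (hm : Measurable ρ) (hO : IsCompact O)
    (hρ : ∀ u ∈ O, ContinuousAt ρ u) {ε : ℝ} (hε : 0 < ε) :
    ∃ t₀ : ℝ, 0 < t₀ ∧ ∀ u ∈ O, ∀ t ≤ t₀,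
      |((volume : Measure E).toSphere.withDensity fun u => (ρ u : ℝ≥0∞)).real (cap u t) -
        ρ u * (volume : Measure E).toSphere.real (cap u t)| ≤
        ε * (volume : Measure E).toSphere.real (cap u t) := by
  obtain ⟨t₀, ht₀, hosc⟩ := exists_cap_oscillation hO hρ hε
  refine ⟨t₀, ht₀, fun u hu t ht => abs_withDensity_real_sub_le hm
    (isClosed_cap u t).measurableSet fun x hx => ?_⟩
  rw [← Real.dist_eq, dist_comm]
  exact (hosc u hu x (cap_mono u ht hx)).le

theorem tendstoUniformlyOn_mul_withDensity_real_cap (hk : Module.finrank ℝ E = k + 1)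
    (hk0 : k ≠ 0) (hm : Measurable ρ) (hO : IsCompact O) (hρ : ∀ u ∈ O, ContinuousAt ρ u)
    {t : ℕ → ℝ} (ht0 : ∀ᶠ n in atTop, 0 ≤ t n) (ht : Tendsto t atTop (𝓝 0)) {τ : ℝ}
    (hτ : Tendsto (fun n : ℕ => (n : ℝ) ^ (2 / (k : ℝ)) * t n) atTop (𝓝 τ)) :
    TendstoUniformlyOn (fun (n : ℕ) u => n *
        ((volume : Measure E).toSphere.withDensity fun u => (ρ u : ℝ≥0∞)).real (cap u (t n)))
      (fun u => ballVol k * (2 * τ) ^ ((k : ℝ) / 2) * ρ u) atTop O := by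
  refine Metric.tendstoUniformlyOn_iff.2 fun δ hδ => ?_
  set D := ballVol k * (2 * τ) ^ ((k : ℝ) / 2)
  obtain ⟨R, hR⟩ := exists_forall_le_of_forall_continuousAt hO hρ
  obtain ⟨ε, hε, hεδ⟩ : ∃ ε : ℝ, 0 < ε ∧ ε * (|D| + ε) + R * ε < δ := by
    have hlim : Tendsto (fun ε : ℝ => ε * (|D| + ε) + R * ε) (𝓝[>] 0) (𝓝 0) := by
      refine tendsto_nhdsWithin_of_tendsto_nhds (Continuous.tendsto' (by fun_prop) _ _ (by simp))
    exact (eventually_mem_nhdsWithin.and (hlim.eventually_lt_const hδ)).exists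
  obtain ⟨t₀, ht₀, hosc⟩ := exists_abs_withDensity_real_cap_sub_le hm hO hρ hε
  filter_upwards [ht.eventually_le_const ht₀, Metric.tendstoUniformly_iff.1
    (tendstoUniformly_mul_toSphere_real_cap hk hk0 ht0 ht hτ) ε hε] with n hn hcap u hu
  replace hosc := hosc u hu (t n) hn
  replace hcap := (hcap u).le
  set p := ((volume : Measure E).toSphere.withDensity fun u => (ρ u : ℝ≥0∞)).real (cap u (t n))
  set σ := (volume : Measure E).toSphere.real (cap u (t n))
  rw [dist_comm, Real.dist_eq] at hcap ⊢
  have hσ : n * σ ≤ |D| + ε := by linarith [(abs_le.1 hcap).2, le_abs_self D]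
  calc |n * p - D * ρ u| = |n * (p - ρ u * σ) + ρ u * (n * σ - D)| := by ring_nf
    _ ≤ n * |p - ρ u * σ| + ρ u * |n * σ - D| := by
        refine (abs_add_le _ _).trans_eq ?_
        rw [abs_mul, abs_mul, NNReal.abs_eq, Nat.abs_cast]
    _ ≤ n * (ε * σ) + R * ε := by
        gcongr
        exact hR u hu
    _ = ε * (n * σ) + R * ε := by ring
    _ ≤ ε * (|D| + ε) + R * ε := by gcongr
    _ < δ := hεδ

theorem exists_withDensity_real_cap_le_rpow (hk : Module.finrank ℝ E = k + 1)
    (hm : Measurable ρ) (hO : IsCompact O) (hρ : ∀ u ∈ O, ContinuousAt ρ u)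
    [IsFiniteMeasure ((volume : Measure E).toSphere.withDensity fun u => (ρ u : ℝ≥0∞))] :
    ∃ C : ℝ, 0 ≤ C ∧ ∀ u ∈ O, ∀ t : ℝ, 0 ≤ t →
      ((volume : Measure E).toSphere.withDensity fun u => (ρ u : ℝ≥0∞)).real (cap u t) ≤
        C * t ^ ((k : ℝ) / 2) := by
  set ν := (volume : Measure E).toSphere.withDensity fun u => (ρ u : ℝ≥0∞)
  obtain ⟨R, hR⟩ := exists_forall_le_of_forall_continuousAt hO hρ
  obtain ⟨t₀, ht₀, hosc⟩ := exists_abs_withDensity_real_cap_sub_le hm hO hρ one_pos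
  have hT : 0 < min t₀ (1 / 2) := lt_min ht₀ (by norm_num)
  set T := min t₀ (1 / 2)
  set C := (R + 1) * (ballVol k * 2 ^ k * 2 ^ ((k : ℝ) / 2))
  have hC : 0 ≤ C := by
    have := ballVol_pos k
    positivity
  refine ⟨max C (ν.real Set.univ / T ^ ((k : ℝ) / 2)), le_max_of_le_left hC,
    fun u hu t ht => ?_⟩
  rcases le_total t T with htT | htT
  · have hσ := toSphere_real_cap_le_rpow hk u ht (htT.trans (min_le_right _ _))
    have hν := (abs_le.1 (hosc u hu t (htT.trans (min_le_left _ _)))).2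
    calc ν.real (cap u t) ≤ (ρ u + 1) * (volume : Measure E).toSphere.real (cap u t) := by
          linarith
      _ ≤ (R + 1) * (ballVol k * 2 ^ k * (2 * t) ^ ((k : ℝ) / 2)) := by
          gcongr
          exact hR u hu
      _ = C * t ^ ((k : ℝ) / 2) := by
          rw [Real.mul_rpow two_pos.le ht]
          ring
      _ ≤ _ := by
          gcongr
          exact le_max_left _ _
  · calc ν.real (cap u t) ≤ ν.real Set.univ := measureReal_mono (Set.subset_univ _)
      _ = ν.real Set.univ / T ^ ((k : ℝ) / 2) * T ^ ((k : ℝ) / 2) := by field_simp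
      _ ≤ max C (ν.real Set.univ / T ^ ((k : ℝ) / 2)) * t ^ ((k : ℝ) / 2) := by
          gcongr
          exact le_max_right _ _

theorem withDensity_real_prod_le {α β : Type*} [MeasurableSpace α] [MeasurableSpace β]
    {μ : Measure α} {ν : Measure β} [IsFiniteMeasure μ] [IsFiniteMeasure ν] {g : α × β → ℝ≥0∞}
    {M : ℝ≥0} {A : Set α} {B : Set β} (hA : MeasurableSet A) (hB : MeasurableSet B)
    (hg : ∀ p ∈ A ×ˢ B, g p ≤ M) :
    ((μ.prod ν).withDensity g).real (A ×ˢ B) ≤ M * (μ.real A * ν.real B) := by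
  have hle : ((μ.prod ν).withDensity g) (A ×ˢ B) ≤ M * (μ A * ν B) := by
    rw [withDensity_apply _ (hA.prod hB), ← Measure.prod_prod, ← setLIntegral_const]
    exact setLIntegral_mono' (hA.prod hB) hg
  simpa [measureReal_def] using ENNReal.toReal_mono (by finiteness) hle

end CapMass

theorem finrank_space {L s k : ℕ} (hLs : 2 * L + s = k + 1) :
    Module.finrank ℝ (Space L s) = k + 1 := by
  rw [finrank_euclideanSpace, ← hLs]
  simp [mul_comm]

theorem orbitConst_eq {L s k : ℕ} (hLs : 2 * L + s = k + 1) (hk : k ≠ 0) (ϑ : Fin L → ℝ)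
    (q : USphere L s) (ρ : USphere L s → ℝ≥0) : orbitConst ϑ q ρ =
      2 ^ ((k : ℝ) / 2) * ballVol k * ∫ u, (ρ u : ℝ) ∂(phaseLaw ϑ q) := by
  rw [orbitConst, critExp, hLs, Nat.add_sub_cancel, sphereArea_eq]
  push_cast
  rw [add_sub_cancel_right, one_div_div]
  field_simp

namespace CorrelatedKeys

/-! ### Laws of the keys near their targets -/

section Laws

variable {L s : ℕ} {ϑ : Fin L → ℝ} {q : USphere L s} {Ω : Type*} [MeasurableSpace Ω]
  {P : Measure Ω} {x : ℤ → Ω → USphere L s} {m : ℕ} {ρ : USphere L s → ℝ≥0}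
  (hx : CorrelatedKeys ϑ q P x m ρ)

include hx

theorem continuousAt_density : ∀ u ∈ orbitClosure ϑ q, ContinuousAt ρ u := by
  obtain ⟨V, hV, hOV, hρ, -⟩ := hx.density_local
  exact fun u hu => hρ.continuousAt (hV.mem_nhds (hOV hu))

theorem continuousOn_density : ContinuousOn (fun u => (ρ u : ℝ)) (orbitClosure ϑ q) := fun u hu =>
  (NNReal.continuous_coe.continuousAt.comp (hx.continuousAt_density u hu)).continuousWithinAt

theorem measureReal_mem_cap (i : ℤ) (u : USphere L s) (t : ℝ) : P.real {ω | x i ω ∈ cap u t} =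
    ((surface L s).withDensity fun u => (ρ u : ℝ≥0∞)).real (cap u t) := by
  rw [← hx.density i, map_measureReal_apply (hx.measurable i) (isClosed_cap u t).measurableSet]
  rfl

theorem map_pair (i j : ℤ) :
    P.map (fun ω => (x i ω, x j ω)) = P.map fun ω => (x 0 ω, x (j - i) ω) := by
  have hpair : Measurable fun z : Fin 2 → USphere L s => (z 0, z 1) := by fun_prop
  have hxκ : ∀ κ : Fin 2 → ℤ, Measurable fun ω a => x (κ a) ω := fun κ =>
    measurable_pi_lambda _ fun a => hx.measurable _
  have hmap := congrArg (Measure.map fun z : Fin 2 → USphere L s => (z 0, z 1))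
    (hx.stationary 2 ![0, j - i] i)
  rw [Measure.map_map hpair (hxκ _),
    Measure.map_map hpair (hxκ fun a => ![0, j - i] a + i)] at hmap
  simpa [Function.comp_def] using hmap.symm

theorem exists_eventually_lag_le {l : ℕ} (hl : 1 ≤ l) (hlm : l ≤ m) :
    ∃ M : ℝ≥0, ∀ᶠ t in 𝓝 (0 : ℝ), ∀ u ∈ orbitClosure ϑ q, ∀ v ∈ orbitClosure ϑ q,
      (P.map fun ω => (x 0 ω, x l ω)).real (cap u t ×ˢ cap v t) ≤
        M * ((surface L s).real (cap u t) * (surface L s).real (cap v t)) := by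
  obtain ⟨g, -, hlaw, V, hV, hOV, M, hM⟩ := hx.anti_clustering l hl hlm
  obtain ⟨t₀, ht₀, hsub⟩ := exists_prod_cap_subset (isCompact_orbitClosure ϑ q) hV hOV
  refine ⟨M, (eventually_le_nhds ht₀).mono fun t ht u hu v hv => ?_⟩
  rw [hlaw]
  exact withDensity_real_prod_le (isClosed_cap u t).measurableSet (isClosed_cap v t).measurableSet
    fun p hp => hM p (hsub u hu v hv (Set.prod_mono (cap_mono u ht) (cap_mono v ht) hp))

theorem exists_eventually_pair_le :
    ∃ M : ℝ≥0, ∀ᶠ t in 𝓝 (0 : ℝ), ∀ i j : ℤ, i < j → j ≤ i + m →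
      ∀ u ∈ orbitClosure ϑ q, ∀ v ∈ orbitClosure ϑ q,
        P.real {ω | x i ω ∈ cap u t ∧ x j ω ∈ cap v t} ≤
          M * ((surface L s).real (cap u t) * (surface L s).real (cap v t)) := by
  have hlag : ∀ l ∈ Finset.Icc 1 m, ∃ M : ℝ≥0, ∀ᶠ t in 𝓝 (0 : ℝ),
      ∀ u ∈ orbitClosure ϑ q, ∀ v ∈ orbitClosure ϑ q,
        (P.map fun ω => (x 0 ω, x l ω)).real (cap u t ×ˢ cap v t) ≤
          M * ((surface L s).real (cap u t) * (surface L s).real (cap v t)) := fun l hl =>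
    hx.exists_eventually_lag_le (Finset.mem_Icc.1 hl).1 (Finset.mem_Icc.1 hl).2
  choose! M hM using hlag
  refine ⟨∑ l ∈ Finset.Icc 1 m, M l, ((Filter.eventually_all_finset _).2 hM).mono
    fun t ht i j hij hjm u hu v hv => ?_⟩
  obtain ⟨l, hl⟩ := Int.eq_ofNat_of_zero_le (show 0 ≤ j - i by lia)
  have hlm : l ∈ Finset.Icc 1 m := Finset.mem_Icc.2 ⟨by lia, by lia⟩
  have hset : MeasurableSet (cap u t ×ˢ cap v t) :=
    (isClosed_cap u _).measurableSet.prod (isClosed_cap v _).measurableSet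
  calc P.real {ω | x i ω ∈ cap u t ∧ x j ω ∈ cap v t}
      = (P.map fun ω => (x 0 ω, x l ω)).real (cap u t ×ˢ cap v t) := by
        rw [← hl, ← hx.map_pair,
          map_measureReal_apply ((hx.measurable i).prodMk (hx.measurable j)) hset]
        rfl
    _ ≤ M l * ((surface L s).real (cap u t) * (surface L s).real (cap v t)) := ht l hlm u hu v hv
    _ ≤ _ := by
        gcongr
        exact Finset.single_le_sum (fun _ _ => zero_le) hlm

theorem exists_eventually_pair_le_div_sq {k : ℕ} (hLs : 2 * L + s = k + 1) (hk : k ≠ 0)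
    {t : ℕ → ℝ} (ht0 : ∀ᶠ n in atTop, 0 ≤ t n) (ht : Tendsto t atTop (𝓝 0)) {τ : ℝ}
    (hτ : Tendsto (fun n : ℕ => (n : ℝ) ^ (2 / (k : ℝ)) * t n) atTop (𝓝 τ)) :
    ∃ C : ℝ, 0 ≤ C ∧ ∀ᶠ n : ℕ in atTop, ∀ i j : ℤ, i < j → j ≤ i + m →
      ∀ u ∈ orbitClosure ϑ q, ∀ v ∈ orbitClosure ϑ q,
        P.real {ω | x i ω ∈ cap u (t n) ∧ x j ω ∈ cap v (t n)} ≤ C / n ^ 2 := by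
  obtain ⟨M, hM⟩ := hx.exists_eventually_pair_le
  set D := |ballVol k * (2 * τ) ^ ((k : ℝ) / 2)| + 1
  refine ⟨M * D ^ 2, by positivity, ?_⟩
  filter_upwards [ht.eventually hM, eventually_gt_atTop 0, Metric.tendstoUniformly_iff.1
    (tendstoUniformly_mul_toSphere_real_cap (finrank_space hLs) hk ht0 ht hτ) 1 one_pos]
    with n hn hn0 hcap i j hij hjm u hu v hv
  have hσ : ∀ w : USphere L s, (surface L s).real (cap w (t n)) ≤ D / n := fun w => by
    have hw := hcap w
    rw [dist_comm, Real.dist_eq, abs_lt] at hw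
    rw [le_div_iff₀' (by exact_mod_cast hn0)]
    exact (sub_lt_iff_lt_add'.1 hw.2).le.trans (add_le_add_left (le_abs_self _) 1)
  calc _ ≤ M * ((surface L s).real (cap u (t n)) * (surface L s).real (cap v (t n))) :=
        hn i j hij hjm u hu v hv
    _ ≤ M * (D / n * (D / n)) := by
        gcongr
        · exact hσ u
        · exact hσ v
    _ = _ := by ring

theorem integral_density_phaseLaw_pos : 0 < ∫ u, (ρ u : ℝ) ∂(phaseLaw ϑ q) := by
  obtain ⟨V, -, hOV, -, hpos⟩ := hx.density_local
  obtain ⟨u₀, hu₀, hmin⟩ := (isCompact_orbitClosure ϑ q).exists_isMinOn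
    ⟨_, target_mem_orbitClosure ϑ q 0⟩ hx.continuousOn_density
  refine lt_of_lt_of_le (NNReal.coe_pos.2 (hpos u₀ (hOV hu₀))) (ge_of_tendsto
    (tendsto_target_average hx.density_measurable.coe_nnreal_real hx.continuousOn_density) ?_)
  filter_upwards [eventually_gt_atTop 0] with n hn
  rw [le_div_iff₀ (by exact_mod_cast hn)]
  simpa [mul_comm] using Finset.card_nsmul_le_sum Finset.univ
    (fun i : Fin n => (ρ (target ϑ q (((i : ℕ) : ℤ) + 1)) : ℝ)) (ρ u₀ : ℝ)
    fun i _ => hmin (target_mem_orbitClosure ϑ q _)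

theorem orbitConst_pos {k : ℕ} (hLs : 2 * L + s = k + 1) (hk : k ≠ 0) :
    0 < orbitConst ϑ q ρ := by
  rw [orbitConst_eq hLs hk]
  have := ballVol_pos k
  have := hx.integral_density_phaseLaw_pos
  positivity

end Laws

end CorrelatedKeys

/-! ### Rescaled distances of the keys to their targets -/

section KeyPoint

variable {L s : ℕ} {ϑ : Fin L → ℝ} {q : USphere L s}

/-- The rescaled distance `b * U_{i+1}`. The attention weights at inverse temperature `b` are the
normalized exponentials of these points. -/
def keyPoint (ϑ : Fin L → ℝ) (q : USphere L s) (x : ℤ → USphere L s) (b : ℝ) (i : ℕ) : ℝ≥0 :=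
  (b * dist2target ϑ q x ((i : ℤ) + 1)).toNNReal

theorem dist2target_nonneg (ϑ : Fin L → ℝ) (q : USphere L s) (x : ℤ → USphere L s) (i : ℤ) :
    0 ≤ dist2target ϑ q x i := by
  have h := real_inner_le_norm (target ϑ q i : Space L s) (x i : Space L s)
  rw [mem_sphere_zero_iff_norm.1 (target ϑ q i).2, mem_sphere_zero_iff_norm.1 (x i).2] at h
  unfold dist2target
  linarith

theorem keyPoint_le_iff {x : ℤ → USphere L s} {b : ℝ} (hb : 0 < b) {i : ℕ} {y : ℝ≥0} :
    keyPoint ϑ q x b i ≤ y ↔ x (i + 1) ∈ cap (target ϑ q (i + 1)) (y / b) := by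
  rw [keyPoint, Real.toNNReal_le_iff_le_coe, ← le_div_iff₀' hb]
  rfl

theorem weight_eq {x : ℤ → USphere L s} {b : ℝ} (hb : 0 < b) (n : ℕ) :
    weight ϑ q x b n = fun i : Fin n => Real.exp (-(keyPoint ϑ q x b i : ℝ)) /
      ∑ j : Fin n, Real.exp (-(keyPoint ϑ q x b j : ℝ)) := by
  have hcoe : ∀ i : ℕ, (keyPoint ϑ q x b i : ℝ) = b * dist2target ϑ q x ((i : ℤ) + 1) := fun i =>
    Real.coe_toNNReal _ (mul_nonneg hb.le (dist2target_nonneg ϑ q x _))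
  funext i
  simp_rw [weight, hcoe, neg_mul]

end KeyPoint

/-! ### The critical scaling -/

section CriticalScaling

variable {κ γ : ℝ} {β : ℕ → ℝ}

theorem eventually_pos_of_tendsto_mul_rpow (hγ : 0 < γ)
    (hβ : Tendsto (fun n : ℕ => β n * (n : ℝ) ^ (-κ)) atTop (𝓝 γ)) : ∀ᶠ n in atTop, 0 < β n :=
  (hβ.eventually_const_lt hγ).mono fun _ hn => pos_of_mul_pos_left hn (by positivity)

theorem tendsto_rpow_mul_div (hγ : γ ≠ 0)
    (hβ : Tendsto (fun n : ℕ => β n * (n : ℝ) ^ (-κ)) atTop (𝓝 γ)) (y : ℝ) :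
    Tendsto (fun n : ℕ => (n : ℝ) ^ κ * (y / β n)) atTop (𝓝 (y / γ)) := by
  refine (tendsto_const_nhds.div hβ hγ).congr fun n => ?_
  rw [Pi.div_apply, Real.rpow_neg (Nat.cast_nonneg n), ← div_eq_mul_inv, div_div_eq_mul_div]
  ring

theorem tendsto_div_zero (hκ : 0 < κ) (hγ : γ ≠ 0)
    (hβ : Tendsto (fun n : ℕ => β n * (n : ℝ) ^ (-κ)) atTop (𝓝 γ)) (y : ℝ) :
    Tendsto (fun n : ℕ => y / β n) atTop (𝓝 0) := by
  have hlim := (tendsto_rpow_mul_div hγ hβ y).mul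
    ((tendsto_rpow_neg_atTop hκ).comp (tendsto_natCast_atTop_atTop (R := ℝ)))
  rw [mul_zero] at hlim
  refine hlim.congr' ((eventually_gt_atTop 0).mono fun n hn => ?_)
  rw [Function.comp_apply, mul_right_comm, ← Real.rpow_add (by exact_mod_cast hn),
    add_neg_cancel, Real.rpow_zero, one_mul]

theorem tendsto_natCast_mul_inv_rpow (hκ : 0 < κ) (hγ : 0 < γ)
    (hβ : Tendsto (fun n : ℕ => β n * (n : ℝ) ^ (-κ)) atTop (𝓝 γ)) :
    Tendsto (fun n : ℕ => n * (1 / β n) ^ κ⁻¹) atTop (𝓝 ((1 / γ) ^ κ⁻¹)) := by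
  refine ((tendsto_rpow_mul_div hγ.ne' hβ 1).rpow_const (.inr (inv_pos.2 hκ).le)).congr' ?_
  filter_upwards [eventually_pos_of_tendsto_mul_rpow hγ hβ] with n hn
  rw [Real.mul_rpow (by positivity) (by positivity), Real.rpow_rpow_inv n.cast_nonneg hκ.ne']

theorem tendsto_sum_of_tendstoUniformly_natCast_mul {p : ℕ → ℕ → ℝ} {c : ℕ → ℝ} {l : ℝ}
    (hp : TendstoUniformly (fun (n : ℕ) i => n * p n i) c atTop)
    (hc : Tendsto (fun n : ℕ => (∑ i ∈ Finset.range n, c i) / n) atTop (𝓝 l)) :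
    Tendsto (fun n => ∑ i ∈ Finset.range n, p n i) atTop (𝓝 l) := by
  refine tendsto_of_tendsto_of_dist hc (tendsto_order.2
    ⟨fun a ha => .of_forall fun n => ha.trans_le dist_nonneg, fun a ha => ?_⟩)
  filter_upwards [Metric.tendstoUniformly_iff.1 hp (a / 2) (half_pos ha), eventually_gt_atTop 0]
    with n hclose hn
  have hn' : (0 : ℝ) < n := by exact_mod_cast hn
  calc dist ((∑ i ∈ Finset.range n, c i) / n) (∑ i ∈ Finset.range n, p n i)
      = |∑ i ∈ Finset.range n, (c i - n * p n i)| / n := by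
        rw [Finset.sum_sub_distrib, ← Finset.mul_sum, Real.dist_eq, ← abs_of_pos hn', ← abs_div,
          abs_of_pos hn', sub_div, mul_div_cancel_left₀ _ hn'.ne']
    _ ≤ (∑ _i ∈ Finset.range n, a / 2) / n := by
        gcongr
        exact (Finset.abs_sum_le_sum_abs _ _).trans (Finset.sum_le_sum fun i _ => (hclose i).le)
    _ = a / 2 := by
        rw [Finset.sum_const, Finset.card_range, nsmul_eq_mul]
        field_simp
    _ < a := half_lt_self ha

end CriticalScaling

namespace CorrelatedKeys

/-! ### Convergence of the largest attention weights -/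

section Convergence

variable {L s : ℕ} {ϑ : Fin L → ℝ} {q : USphere L s} {Ω : Type*} [MeasurableSpace Ω]
  {P : Measure Ω} {x : ℤ → Ω → USphere L s} {m : ℕ} {ρ : USphere L s → ℝ≥0}
  (hx : CorrelatedKeys ϑ q P x m ρ)

include hx

theorem measurable_dist2target (i : ℤ) :
    Measurable fun ω => dist2target ϑ q (fun i => x i ω) i := by
  have := hx.measurable i
  unfold dist2target
  fun_prop

theorem measurable_keyPoint (b : ℝ) (i : ℕ) :
    Measurable fun ω => keyPoint ϑ q (fun i => x i ω) b i :=
  ((hx.measurable_dist2target _).const_mul b).real_toNNReal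

theorem measurable_weight (b : ℝ) (n : ℕ) :
    Measurable fun ω => weight ϑ q (fun i => x i ω) b n := by
  have hexp := fun i => ((hx.measurable_dist2target i).const_mul (-b)).exp
  exact measurable_pi_lambda _ fun i => (hexp _).div (Finset.measurable_sum _ fun j _ => hexp _)

theorem indepFun_comp_prefix {β : Type*} [MeasurableSpace β] {f : ℤ → USphere L s → β}
    (hf : ∀ i, Measurable (f i)) (j : ℕ) :
    IndepFun (fun ω (i : Fin (j - m)) => f ((i : ℤ) + 1) (x ((i : ℤ) + 1) ω))
      (fun ω => f ((j : ℤ) + 1) (x ((j : ℤ) + 1) ω)) P := by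
  have hsep : ∀ i ∈ Set.range fun i : Fin (j - m) => (i : ℤ) + 1, ∀ l ∈ ({(j : ℤ) + 1} : Set ℤ),
      (m : ℤ) < |i - l| := by
    rintro _ ⟨i, rfl⟩ _ rfl
    exact lt_abs.2 (.inr (by have := i.2; lia))
  exact (hx.m_dependent _ _ hsep).comp
    (φ := fun z (i : Fin (j - m)) => f ((i : ℤ) + 1) (z ⟨(i : ℤ) + 1, i, rfl⟩))
    (ψ := fun z => f ((j : ℤ) + 1) (z ⟨(j : ℤ) + 1, rfl⟩))
    (measurable_pi_lambda _ fun i => by fun_prop) (by fun_prop)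

theorem indepFun_keyPoint (b : ℝ) (j : ℕ) :
    IndepFun (fun ω (i : Fin (j - m)) => keyPoint ϑ q (fun i => x i ω) b i)
      (fun ω => keyPoint ϑ q (fun i => x i ω) b j) P :=
  hx.indepFun_comp_prefix (f := fun i z =>
    (b * (1 - inner ℝ (target ϑ q i : Space L s) (z : Space L s))).toNNReal)
    (fun i => by fun_prop) j

theorem measureReal_keyPoint_le {b : ℝ} (hb : 0 < b) (i : ℕ) (y : ℝ≥0) :
    P.real {ω | keyPoint ϑ q (fun i => x i ω) b i ≤ y} =
      ((surface L s).withDensity fun u => (ρ u : ℝ≥0∞)).real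
        (cap (target ϑ q (i + 1)) (y / b)) := by
  simp_rw [keyPoint_le_iff hb]
  exact hx.measureReal_mem_cap _ _ _

variable {d : ℕ} (hLs : 2 * L + s = d + 1) (hd : d ≠ 0) {γ : ℝ} (hγ : 0 < γ) {β : ℕ → ℝ}
  (hβ : Tendsto (fun n : ℕ => β n * (n : ℝ) ^ (-(2 / (d : ℝ)))) atTop (𝓝 γ))

include hLs hd hγ hβ

theorem tendstoUniformly_mul_measureReal_keyPoint_le (y : ℝ≥0) :
    TendstoUniformly
      (fun (n : ℕ) i => n * P.real {ω | keyPoint ϑ q (fun i => x i ω) (β n) i ≤ y})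
      (fun i => ballVol d * (2 * (y / γ)) ^ ((d : ℝ) / 2) * ρ (target ϑ q ((i : ℤ) + 1)))
      atTop := by
  have hpos := eventually_pos_of_tendsto_mul_rpow hγ hβ
  have hcap := tendstoUniformlyOn_mul_withDensity_real_cap (finrank_space hLs) hd
    hx.density_measurable (isCompact_orbitClosure ϑ q) hx.continuousAt_density
    (hpos.mono fun n hn => div_nonneg y.coe_nonneg hn.le)
    (tendsto_div_zero (by positivity) hγ.ne' hβ y) (tendsto_rpow_mul_div hγ.ne' hβ y)
  refine Metric.tendstoUniformly_iff.2 fun ε hε => ?_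
  filter_upwards [hpos, Metric.tendstoUniformlyOn_iff.1 hcap ε hε] with n hn hclose i
  rw [hx.measureReal_keyPoint_le hn]
  exact hclose _ (target_mem_orbitClosure ϑ q _)

theorem exists_measureReal_keyPoint_le_div (y : ℝ≥0) :
    ∃ C : ℝ, 0 ≤ C ∧ ∀ᶠ n : ℕ in atTop, ∀ i < n,
      P.real {ω | keyPoint ϑ q (fun i => x i ω) (β n) i ≤ y} ≤ C / n := by
  obtain ⟨R, hR⟩ := exists_forall_le_of_forall_continuousAt (isCompact_orbitClosure ϑ q)
    hx.continuousAt_density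
  have := ballVol_pos d
  refine ⟨ballVol d * (2 * (y / γ)) ^ ((d : ℝ) / 2) * R + 1, by positivity, ?_⟩
  filter_upwards [Metric.tendstoUniformly_iff.1
    (hx.tendstoUniformly_mul_measureReal_keyPoint_le hLs hd hγ hβ y) 1 one_pos] with n hclose i hi
  rw [le_div_iff₀' (by exact_mod_cast (Nat.zero_le i).trans_lt hi)]
  have hdist := hclose i
  rw [dist_comm, Real.dist_eq, abs_lt, sub_lt_iff_lt_add'] at hdist
  refine hdist.2.le.trans ?_
  gcongr
  exact hR _ (target_mem_orbitClosure ϑ q _)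

theorem tendsto_sum_measureReal_keyPoint_le (y : ℝ≥0) :
    Tendsto (fun n => ∑ i ∈ Finset.range n,
      P.real {ω | keyPoint ϑ q (fun i => x i ω) (β n) i ≤ y}) atTop
      (𝓝 (orbitConst ϑ q ρ * (y / γ) ^ ((d : ℝ) / 2))) := by
  refine tendsto_sum_of_tendstoUniformly_natCast_mul
    (hx.tendstoUniformly_mul_measureReal_keyPoint_le hLs hd hγ hβ y) ?_
  have havg := (tendsto_target_average hx.density_measurable.coe_nnreal_real
    hx.continuousOn_density).const_mul (ballVol d * (2 * (y / γ)) ^ ((d : ℝ) / 2))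
  convert havg using 2
  · rw [← Finset.mul_sum, mul_div_assoc,
      Fin.sum_univ_eq_sum_range fun i : ℕ => (ρ (target ϑ q ((i : ℤ) + 1)) : ℝ)]
  · rw [orbitConst_eq hLs hd, Real.mul_rpow two_pos.le (by positivity)]
    ring

theorem exists_measureReal_keyPoint_pair_le_div_sq (y : ℝ≥0) :
    ∃ C : ℝ, 0 ≤ C ∧ ∀ᶠ n : ℕ in atTop, ∀ i j, i < j → j ≤ i + m → j < n →
      P.real {ω | keyPoint ϑ q (fun i => x i ω) (β n) i ≤ y ∧
        keyPoint ϑ q (fun i => x i ω) (β n) j ≤ y} ≤ C / n ^ 2 := by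
  have hpos := eventually_pos_of_tendsto_mul_rpow hγ hβ
  obtain ⟨C, hC, hpair⟩ := hx.exists_eventually_pair_le_div_sq hLs hd
    (hpos.mono fun n hn => div_nonneg y.coe_nonneg hn.le)
    (tendsto_div_zero (by positivity) hγ.ne' hβ y) (tendsto_rpow_mul_div hγ.ne' hβ y)
  refine ⟨C, hC, ?_⟩
  filter_upwards [hpos, hpair] with n hn hpair i j hij hjm _
  simp_rw [keyPoint_le_iff hn]
  exact hpair _ _ (by lia) (by lia) _ (target_mem_orbitClosure ϑ q _) _
    (target_mem_orbitClosure ϑ q _)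

theorem exists_lintegral_pointMeasure_keyPoint_le [IsFiniteMeasure P] :
    ∃ C : ℝ≥0, ∀ᶠ n in atTop, ∀ y : ℕ,
      ∫⁻ ω, pointMeasure n (keyPoint ϑ q (fun i => x i ω) (β n)) (Set.Iic ((y : ℝ≥0) + 1)) ∂P ≤
        C * ((y : ℝ≥0∞) + 1) ^ d := by
  have : IsFiniteMeasure ((volume : Measure (Space L s)).toSphere.withDensity
      fun u => (ρ u : ℝ≥0∞)) :=
    (hx.density 0 ▸ inferInstance : IsFiniteMeasure ((surface L s).withDensity _))
  obtain ⟨C, hC, hcap⟩ := exists_withDensity_real_cap_le_rpow (finrank_space hLs)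
    hx.density_measurable (isCompact_orbitClosure ϑ q) hx.continuousAt_density
  have hlim := tendsto_natCast_mul_inv_rpow (by positivity) hγ hβ
  rw [inv_div] at hlim
  set B := (1 / γ) ^ ((d : ℝ) / 2) + 1
  have : 0 ≤ B := by positivity
  refine ⟨(C * B).toNNReal, ?_⟩
  filter_upwards [eventually_pos_of_tendsto_mul_rpow hγ hβ,
    hlim.eventually_le_const (lt_add_one _)] with n hn hnB y
  have hpoint : ∀ i, P {ω | keyPoint ϑ q (fun i => x i ω) (β n) i ≤ (y : ℝ≥0) + 1} ≤
      ENNReal.ofReal (C * (((y : ℝ) + 1) / β n) ^ ((d : ℝ) / 2)) := fun i => by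
    rw [ENNReal.le_ofReal_iff_toReal_le (measure_ne_top _ _) (by positivity), ← measureReal_def,
      hx.measureReal_keyPoint_le hn]
    exact_mod_cast hcap _ (target_mem_orbitClosure ϑ q _) _ (by positivity)
  rw [lintegral_pointMeasure n (hx.measurable_keyPoint (β n)) measurableSet_Iic]
  calc _ ≤ n * ENNReal.ofReal (C * (((y : ℝ) + 1) / β n) ^ ((d : ℝ) / 2)) := by
        refine (Finset.sum_le_card_nsmul _ _ _ fun i _ => hpoint i).trans_eq ?_
        rw [Finset.card_range, nsmul_eq_mul]
    _ = ENNReal.ofReal (C * (n * (1 / β n) ^ ((d : ℝ) / 2)) * ((y : ℝ) + 1) ^ ((d : ℝ) / 2)) := by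
        rw [← ENNReal.ofReal_natCast, ← ENNReal.ofReal_mul n.cast_nonneg,
          div_eq_mul_one_div, Real.mul_rpow (by positivity) (by positivity)]
        ring_nf
    _ ≤ ENNReal.ofReal (C * B * ((y : ℝ) + 1) ^ d) := by
        rw [← Real.rpow_natCast]
        gcongr
        · simp
        · exact half_le_self d.cast_nonneg
    _ = _ := ofReal_mul_natCast_add_one_pow (by positivity) y d

variable [IsProbabilityMeasure P] {hc : 0 ≤ orbitConst ϑ q ρ} {hd2 : 0 < (d : ℝ) / 2}
  {Ω' : Type*} [MeasurableSpace Ω'] {P' : Measure Ω'} [IsProbabilityMeasure P']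
  {𝒳 : Ω' → Measure ℝ≥0}
  (h𝒳 : IsPoissonPointProcess 𝒳 (powerIntensity (orbitConst ϑ q ρ) γ (d / 2) hc hγ hd2) P')

include h𝒳

theorem tendstoInDistribution_counts_keyPoint {r : ℕ} (hr : 0 < r) :
    TendstoInDistribution
      (fun n ω => counts r (pointMeasure n (keyPoint ϑ q (fun i => x i ω) (β n)))) atTop
      (fun ω => counts r (𝒳 ω)) (fun _ => P) P' :=
  have hc := hx.orbitConst_pos hLs hd
  tendstoInDistribution_counts (fun n => hx.measurable_keyPoint (β n))
    (fun n => hx.indepFun_keyPoint (β n)) (hx.exists_measureReal_keyPoint_le_div hLs hd hγ hβ)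
    (hx.exists_measureReal_keyPoint_pair_le_div_sq hLs hd hγ hβ)
    (powerIntensity_Iic_ne_top hc hγ hd2)
    (fun y => powerIntensity_real_Iic hc hγ hd2 y ▸
      hx.tendsto_sum_measureReal_keyPoint_le hLs hd hγ hβ y) h𝒳 hr

theorem tendstoInDistribution_nthLargest_weight (k : ℕ) :
    TendstoInDistribution
      (fun n ω (j : Fin k) => nthLargest (weight ϑ q (fun i => x i ω) (β n) n) j) atTop
      (fun ω (j : Fin k) => limitWeight (𝒳 ω) j) (fun _ => P) P' := by
  have hc := hx.orbitConst_pos hLs hd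
  obtain ⟨C₁, hC₁⟩ := hx.exists_lintegral_pointMeasure_keyPoint_le hLs hd hγ hβ
  obtain ⟨C₂, hC₂⟩ := h𝒳.exists_lintegral_Iic_le hc hγ hd2 (half_le_self d.cast_nonneg)
  have hinf := h𝒳.ae_powerIntensity_infinite hc hγ hd2
  have hmass := h𝒳.ae_powerIntensity_expMass_ne_top hc hγ hd2
  have hprelimit : ∀ᶠ n in atTop, ∀ᵐ ω ∂P,
      HasWeights (pointMeasure n (keyPoint ϑ q (fun i => x i ω) (β n)))
        fun j : Fin k => nthLargest (weight ϑ q (fun i => x i ω) (β n) n) j := by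
    filter_upwards [eventually_pos_of_tendsto_mul_rpow hγ hβ, eventually_ge_atTop k] with n hn hkn
    simp only [weight_eq hn]
    exact ae_of_all _ fun ω => hasWeights_pointMeasure hkn _
  have hlimit : ∀ᵐ ω ∂P', HasWeights (𝒳 ω) fun j : Fin k => limitWeight (𝒳 ω) j := by
    filter_upwards [hinf, hmass] with ω hω hω'
    exact hasWeights_limitWeight (h𝒳.counting ω) hω hω' k
  refine tendstoInDistribution_weights
    (fun n => measurable_pointMeasure n (hx.measurable_keyPoint (β n))) h𝒳.measurable
    (fun n => (measurable_pi_lambda _ fun j : Fin k =>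
      (measurable_nthLargest n j).comp (hx.measurable_weight (β n) n)).aemeasurable)
    (h𝒳.aemeasurable_limitWeight hmass hinf) hprelimit hlimit (C := max C₁ C₂) (q := d)
    (hC₁.mono fun n h y => (h y).trans (by gcongr; exact le_max_left _ _))
    (fun y => (hC₂ y).trans (by gcongr; exact le_max_right _ _))
    (fun r hr => hx.tendstoInDistribution_counts_keyPoint hLs hd hγ hβ h𝒳 hr) ?_
  simpa only [not_le, Nat.cast_one] using h𝒳.tendsto_measure_lt
    (powerIntensity_Iic_ne_top hc hγ hd2) (tendsto_powerIntensity_real_Iic hc hγ hd2) 1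

end Convergence

end CorrelatedKeys

end RopeAttention

end

theorem theoremF3 {L s : ℕ} (hd : 2 ≤ 2 * L + s)
    (ϑ : Fin L → ℝ) (q : RopeAttention.USphere L s)
    {Ω : Type*} [MeasurableSpace Ω] (P : Measure Ω) [IsProbabilityMeasure P]
    (x : ℤ → Ω → RopeAttention.USphere L s) (m : ℕ) (ρ : RopeAttention.USphere L s → ℝ≥0)
    (hx : RopeAttention.CorrelatedKeys ϑ q P x m ρ)
    (β : ℕ → ℝ) (γ : ℝ) (hγ : 0 < γ)
    (hβ : Tendsto (fun n : ℕ => β n * (n : ℝ) ^ (-RopeAttention.critExp (2 * L + s))) atTop (𝓝 γ))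
    {Ω' : Type*} [MeasurableSpace Ω'] (P' : Measure Ω') [IsProbabilityMeasure P']
    (𝒳 : Ω' → Measure ℝ≥0)
    (h𝒳 : RopeAttention.IsPoissonPointProcess 𝒳
      (RopeAttention.powerIntensity (RopeAttention.orbitConst ϑ q ρ) γ
        (1 / RopeAttention.critExp (2 * L + s))
        (RopeAttention.orbitConst_nonneg hd ϑ q ρ) hγ
        (one_div_pos.2 (RopeAttention.critExp_pos hd))) P') :
    (∀ᵐ ω ∂P', 0 < RopeAttention.arrival (𝒳 ω) 0 ∧
      StrictMono (RopeAttention.arrival (𝒳 ω)) ∧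
      𝒳 ω = Measure.sum (fun j : ℕ => Measure.dirac (RopeAttention.arrival (𝒳 ω) j)) ∧
      Summable (fun j : ℕ => Real.exp (-(RopeAttention.arrival (𝒳 ω) j : ℝ)))) ∧
    ∀ k : ℕ, TendstoInDistribution
      (fun (n : ℕ) (ω : Ω) (j : Fin k) =>
        RopeAttention.nthLargest
          (RopeAttention.weight ϑ q (fun i => x i ω) (β n) n) j)
      atTop
      (fun (ω : Ω') (j : Fin k) => RopeAttention.limitWeight (𝒳 ω) j)
      (fun _ => P) P' := by
  obtain ⟨d, hLs⟩ : ∃ d, 2 * L + s = d + 1 := ⟨2 * L + s - 1, by lia⟩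
  have hd0 : d ≠ 0 := by lia
  have hcrit : RopeAttention.critExp (2 * L + s) = 2 / (d : ℝ) := by
    rw [RopeAttention.critExp, hLs, Nat.cast_add_one, add_sub_cancel_right]
  simp only [hcrit, one_div_div] at hβ h𝒳
  exact ⟨h𝒳.ae_arrivals (hx.orbitConst_pos hLs hd0) hγ (by positivity),
    fun k => hx.tendstoInDistribution_nthLargest_weight hLs hd0 hγ hβ h𝒳 k⟩
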